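/- Let $S\subset\mathbb P^4$ be the quartic del Pezzo surface $x_0x_1-x_2x_3=x_0x_3+x_1x_3+x_2x_4=0$, with its one singularity $Q=(0:0:0:0:1)$ of type $\mathbf A_3$, and let $\pi:\widetilde S\to S$ be its minimal desingularisation. It has $\mathrm{Pic}(\widetilde S)=\bigoplus_{k=0}^5\mathbb Z l_k$ and Cox ring $K[\eta_1,\dots,\eta_9]/(\eta_1\eta_4^2\eta_7+\eta_3\eta_6^2\eta_8+\eta_5\eta_9)$, where $\eta_j$ cuts out a curve $E_j$ and $[E_1]=l_1-l_4$, $[E_2]=l_0-l_1-l_2-l_3$, $[E_3]=l_2-l_5$, $[E_4]=l_4$, $[E_5]=l_3$, $[E_6]=l_5$, $[E_7]=l_0-l_1-l_4$, $[E_8]=l_0-l_2-l_5$, $[E_9]=l_0-l_3$; the maximal sets of these curves with a common point are those with indices $\{7,8,9\},\{1,2\},\{1,4\},\{2,3\},\{2,5\},\{3,6\},\{4,7\},\{5,9\},\{6,8\}$. The map $\pi$ is given by the anticanonical sections $$(\eta_1^2\eta_2^2\eta_3\eta_4^2\eta_5\eta_7:\eta_1\eta_2^2\eta_3^2\eta_5\eta_6^2\eta_8:\eta_1^2\eta_2^3\eta_3^2\eta_4\eta_5^2\eta_6:\eta_1\eta_2\eta_3\eta_4\eta_6\eta_7\eta_8:\eta_7\eta_8\eta_9).$$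 Let $D_1=E_1+E_2+E_3=\pi^{-1}(Q)$ and $D_2=E_1+E_2+E_3+E_4=\pi^{-1}(\{x_0=x_2=x_3=0\})$, and $\widetilde U_i=\widetilde S\setminus D_i$. For a local field with normalised absolute value $\|\cdot\|$ (so $\|z\|=|z|^2$ on $\mathbb C$), give $\omega_{\widetilde S}(D_i)^\vee$ the metric $\|s\|=\|s(\eta)\|/\max_m\|m(\eta)\|$, where $m$ runs through $x_0,x_1,x_2,x_3$ divided by $\eta_1\eta_2\eta_3$ if $i=1$, and $x_0,x_2,x_3$ divided by $\eta_1\eta_2\eta_3\eta_4$ if $i=2$ (with $x_k$ the above sections), and give $\omega_{\widetilde S}(D_i)$ the dual metric; here the form $dx\wedge dy$ in the coordinates $x=\eta_4\eta_7/(\eta_2\eta_3\eta_5\eta_6)$, $y=\eta_6\eta_8/(\eta_1\eta_2\eta_4\eta_5)$ is identified with $1/(\eta_1^2\eta_2^3\eta_3^2\eta_4\eta_5^2\eta_6)$. A face of the Clemens complex of $D_i$ is a non-empty set $A$ of components of $D_i$ with $D_A(\mathbb C)=\bigcap_{E\in A}E(\mathbb C)\neq\emptyset$; its dimension is $\#A-1$.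 For a maximal face $A$ (it has two elements) let $\tau_{i,D_A,\infty}$ be the residue measure on the finite set $D_A(\mathbb C)$: a point $P\in D_A(\mathbb C)$, $A=\{E_j,E_k\}$ has mass $$(2\pi)^{2}\lim_{(a,b)\to(0,0),\ ab\ne0}\frac{\|ab\|}{\|(da\wedge db)\otimes 1_{D_i}\|},$$ where $(a,b)$ are any local holomorphic coordinates at $P$ in which $E_j=\{a=0\}$ and $E_k=\{b=0\}$. Let $$\alpha_{i,A}=\mathrm{vol}\{x\in\mathrm{Eff}(\widetilde U_{i,A})^\vee\mid\langle x,\omega_{\widetilde S}(D_i)^\vee|_{\widetilde U_{i,A}}\rangle=1\},\qquad \widetilde U_{i,A}=\widetilde S\setminus\bigcup_{E\subset D_i,\,E\notin A}E,$$ where, with $L=\omega_{\widetilde S}(D_i)^\vee|_{\widetilde U_{i,A}}$, $\mathrm{vol}$ is the quotient by $d\langle x,L\rangle$ of the Haar measure on $\mathrm{Hom}(\mathrm{Pic}(\widetilde U_{i,A}),\mathbb R)$ for which $\mathrm{Hom}(\mathrm{Pic}(\widetilde U_{i,A}),\mathbb Z)$ has covolume one. Put $$\mathcal A_1=4\pi^2\,\mathrm{vol}\{(t_4,t_5,t_6,t_8)\in\mathbb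 R_{\ge0}^4\mid t_5+2t_6+t_8\le1,\ t_4+t_6+t_8\le1,\ t_4+t_5-t_6-t_8\le0\},$$ $$\mathcal A_2=4\pi^2\,\mathrm{vol}\{(t_5,t_6,t_8)\in\mathbb R_{\ge0}^3\mid t_6+t_8\le1,\ t_5-t_6-t_8\le0,\ 2t_5+t_6\le1\}.$$ Then: (1) The maximal faces are $A_1=\{E_1,E_2\}$, $A_2=\{E_2,E_3\}$ for $D_1$, and $A_1$, $A_2$, $A_3=\{E_1,E_4\}$ for $D_2$. (2) $\tau_{i,D_A,\infty}(D_A(\mathbb C))=4\pi^2$ for every $i\in\{1,2\}$ and every maximal face $A$. (3) The constants $\alpha_{i,A}$ are the volumes $$\alpha_{1,A_1}=\mathrm{vol}\{(t_4,t_5,t_6,t_8)\in\mathbb R^4_{\ge0}\mid -t_4+3t_6+2t_8\ge1,\ t_5+2t_6+t_8\le1,\ t_4+t_6+t_8\le1\},$$ $$\alpha_{1,A_2}=\mathrm{vol}\{(t_4,t_5,t_6,t_8)\in\mathbb R^4_{\ge0}\mid -t_4-t_5+t_6+t_8\ge0,\ -t_4+3t_6+2t_8\le1,\ t_4+t_6+t_8\le1\},$$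 $$\alpha_{2,A_1}=\mathrm{vol}\{(t_5,t_6,t_8)\in\mathbb R^3_{\ge0}\mid 3t_6+2t_8\ge1,\ t_5+2t_6+t_8\le1,\ t_6+t_8\le1\},$$ $$\alpha_{2,A_2}=\mathrm{vol}\{(t_5,t_6,t_8)\in\mathbb R^3_{\ge0}\mid 3t_6+2t_8\le1,\ -t_5+t_6+t_8\ge0,\ t_6+t_8\le1\},$$ $$\alpha_{2,A_3}=\mathrm{vol}\{(t_5,t_6,t_8)\in\mathbb R^3_{\ge0}\mid 2t_5+t_6\le1,\ t_5+2t_6+t_8\ge1,\ t_6+t_8\le1\}.$$ (4) For $i\in\{1,2\}$, the archimedean contribution is $\sum_A\alpha_{i,A}\,\tau_{i,D_A,\infty}(D_A(\mathbb C))=\mathcal A_i$, the sum running over the maximal faces $A$ of the Clemens complex of $D_i$; and $\mathcal A_1=\pi^2/18$, $\mathcal A_2=11\pi^2/18$. (5) Let $r_i=\mathrm{rk}\,\mathrm{Pic}(\widetilde U_i)$ and let $b_i=r_i+\dim\mathcal C(D_i)+1$, where $\dim\mathcal C(D_i)+1$ is the maximal number of elements of a face. Then $b_1=5$ and $b_2=4$.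 Let $K$ be any imaginary quadratic field, with discriminant $\Delta_K$, and let $\rho_K$ be the residue at $1$ of its Dedekind zeta function. Set $$c_{i,\mathrm{fin}}=\rho_K^{r_i}\prod_{\mathfrak p}\Bigl(1-\frac1{\mathfrak N\mathfrak p}\Bigr)^{r_i}\tau_{(\widetilde S,D_i),\mathfrak p}(\widetilde{\mathcal U}_i(\mathcal O_{K,\mathfrak p})),\qquad c_{i,\infty}=\frac1{|\Delta_K|}\sum_A\alpha_{i,A}\,\tau_{i,D_A,\infty}(D_A(\mathbb C)),$$ where $\tau_{(\widetilde S,D_i),\mathfrak p}$ is the measure $\|(dx\wedge dy)\otimes1_{D_i}\|_{\mathfrak p}^{-1}dx\,dy$ on $\widetilde S(K_{\mathfrak p})$, with the Haar measure on $K_{\mathfrak p}$ for which $\mathcal O_{K,\mathfrak p}$ has volume one, and where $\widetilde{\mathcal U}_i(\mathcal O_{K,\mathfrak p})$ is the set of points that have Cox coordinates $\eta\in\mathcal O_{K,\mathfrak p}^9$ satisfying the Cox ring relation, with $\eta_j$ a unit if $E_j\subset D_i$, and such that the products $\prod_{j\notin C}\eta_j$, for $C$ in the above list of sets of indices, generate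 the unit ideal. Then the product $c_{i,\mathrm{fin}}$ converges, and the expected main term $c_{i,\mathrm{fin}}\,c_{i,\infty}\,B(\log B)^{b_i-1}$ is equal to the main term of the asymptotic formula for the number of integral points of log-anticanonical height at most $B$ on $\widetilde{\mathcal U}_i$ outside the negative curves, that is, to $$\frac{\rho_K^3}{\sqrt{|\Delta_K|}^2}\frac{\pi^2}{18}\prod_{\mathfrak p}\Bigl(1-\frac1{\mathfrak N\mathfrak p}\Bigr)^3\Bigl(1+\frac3{\mathfrak N\mathfrak p}\Bigr)B(\log B)^4\quad(i=1),$$ $$\frac{\rho_K^2}{\sqrt{|\Delta_K|}^2}\frac{11\pi^2}{18}\prod_{\mathfrak p}\Bigl(1-\frac1{\mathfrak N\mathfrak p}\Bigr)^2\Bigl(1+\frac2{\mathfrak N\mathfrak p}\Bigr)B(\log B)^3\quad(i=2).$$ -/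

import Mathlib

open MeasureTheory Filter Topology
open scoped NNReal ENNReal

noncomputable section

namespace A3Surface

/-! ### The surface, through its Cox ring

The quartic del Pezzo surface `S ⊂ ℙ⁴` is `x₀x₁ - x₂x₃ = x₀x₃ + x₁x₃ + x₂x₄ = 0`; its minimal
desingularisation `S'` has Cox ring `K[η₁,…,η₉]/(η₁η₄²η₇ + η₃η₆²η₈ + η₅η₉)`.  The generator `η_j`
cuts out the curve `E_j`; it has index `j - 1` in `Fin 9` below, so the index `0` is `E₁`, the
index `8` is `E₉`. -/

/-- The Picard group of `S'`, free on `l₀, …, l₅` (pull-back of a line and the five exceptional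
classes of a description of `S'` as a five-fold blow-up of the plane). -/
abbrev PicS : Type := Fin 6 → ℤ

/-- The classes `[E₁], …, [E₉]`, i.e. the degrees of the Cox ring generators. -/
def curveClass : Fin 9 → PicS :=
  ![![0, 1, 0, 0, -1, 0],      -- `E₁ = l₁ - l₄`
    ![1, -1, -1, -1, 0, 0],    -- `E₂ = l₀ - l₁ - l₂ - l₃`
    ![0, 0, 1, 0, 0, -1],      -- `E₃ = l₂ - l₅`
    ![0, 0, 0, 0, 1, 0],       -- `E₄ = l₄`
    ![0, 0, 0, 1, 0, 0],       -- `E₅ = l₃`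
    ![0, 0, 0, 0, 0, 1],       -- `E₆ = l₅`
    ![1, -1, 0, 0, -1, 0],     -- `E₇ = l₀ - l₁ - l₄`
    ![1, 0, -1, 0, 0, -1],     -- `E₈ = l₀ - l₂ - l₅`
    ![1, 0, 0, -1, 0, 0]]      -- `E₉ = l₀ - l₃`

/-- The anticanonical class `3 l₀ - l₁ - … - l₅`. -/
def anticanonicalClass : PicS := ![3, -1, -1, -1, -1, -1]

/-- The relation of the Cox ring. -/
def coxRel {R : Type*} [CommRing R] (η : Fin 9 → R) : R :=
  η 0 * η 3 ^ 2 * η 6 + η 2 * η 5 ^ 2 * η 7 + η 4 * η 8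

/-- The monomial `∏ η_j ^ e_j`. -/
def mon {R : Type*} [CommRing R] (e : Fin 9 → ℕ) (η : Fin 9 → R) : R := ∏ j, η j ^ e j

/-- The maximal sets of curves with a common point:
`{7,8,9}, {1,2}, {1,4}, {2,3}, {2,5}, {3,6}, {4,7}, {5,9}, {6,8}`. -/
def maxMeeting : Finset (Finset (Fin 9)) :=
  {{6, 7, 8}, {0, 1}, {0, 3}, {1, 2}, {1, 4}, {2, 5}, {3, 6}, {4, 8}, {5, 7}}

/-- The `R`-points of the universal torsor `Y` (`R` a field or a local ring): solutions of the
Cox ring relation at which the irrelevant ideal, generated by the products of all `η_j` with `j`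
outside one of the sets in `maxMeeting`, becomes the unit ideal. -/
def torsor (R : Type*) [CommRing R] : Set (Fin 9 → R) :=
  {η | coxRel η = 0 ∧ Ideal.span {m : R | ∃ c ∈ maxMeeting, m = ∏ j ∈ cᶜ, η j} = ⊤}

/-- Two points of the torsor in the same orbit of the Néron–Severi torus `𝔾_m⁶`, where
`(t₀, …, t₅)` multiplies `η_j` by the character `[E_j]`. -/
def torusRel {F : Type*} [Field F] (η η' : torsor F) : Prop :=
  ∃ t : Fin 6 → Fˣ, ∀ j, η'.1 j = ((∏ k, t k ^ curveClass j k : Fˣ) : F) * η.1 j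

theorem torusRel_equivalence {F : Type*} [Field F] :
    Equivalence (torusRel : torsor F → torsor F → Prop) where
  refl η := ⟨1, fun j => by simp⟩
  symm := by
    rintro η η' ⟨t, ht⟩
    refine ⟨t⁻¹, fun j => ?_⟩
    rw [ht j, ← mul_assoc, ← Units.val_mul]
    simp [Finset.prod_inv_distrib]
  trans := by
    rintro η η' η'' ⟨t, ht⟩ ⟨s, hs⟩
    refine ⟨s * t, fun j => ?_⟩
    rw [hs j, ht j, ← mul_assoc, ← Units.val_mul]
    simp [mul_zpow, Finset.prod_mul_distrib]

instance torusSetoid (F : Type*) [Field F] : Setoid (torsor F) where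
  r := torusRel
  iseqv := torusRel_equivalence

/-- The set `S'(F) = Y(F) / 𝔾_m⁶(F)` of `F`-points of the desingularisation. -/
def Surface (F : Type*) [Field F] : Type _ := Quotient (torusSetoid F)

/-- `η` is a point of the torsor lying above `P` (Cox coordinates of `P`). -/
def Represents {F : Type*} [Field F] (η : Fin 9 → F) (P : Surface F) : Prop :=
  ∃ h : η ∈ torsor F, Quotient.mk (torusSetoid F) ⟨η, h⟩ = P

/-! ### The boundary divisors -/

/-- The two types of boundary: the singularity `Z₁ = Q` and the line `Z₂ = L₂` on `S`. -/
inductive Bdry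
  | sing
  | line

/-- The components of `D₁ = E₁ + E₂ + E₃` and `D₂ = E₁ + E₂ + E₃ + E₄`. -/
def boundary : Bdry → Finset (Fin 9)
  | .sing => {0, 1, 2}
  | .line => {0, 1, 2, 3}

/-- The map from the torsor to `S ⊂ ℙ⁴`, given by the anticanonical sections. -/
def toQuartic {F : Type*} [CommRing F] (η : Fin 9 → F) : Fin 5 → F :=
  ![mon ![2, 2, 1, 2, 1, 0, 1, 0, 0] η, mon ![1, 2, 2, 0, 1, 2, 0, 1, 0] η,
    mon ![2, 3, 2, 1, 2, 1, 0, 0, 0] η, mon ![1, 1, 1, 1, 0, 1, 1, 1, 0] η,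
    mon ![0, 0, 0, 0, 0, 0, 1, 1, 1] η]

/-- The affine cones over `Q = (0:0:0:0:1)` and `L₂ = {x₀ = x₂ = x₃ = 0}`. -/
def center {F : Type*} [CommRing F] : Bdry → Set (Fin 5 → F)
  | .sing => {x | x 0 = 0 ∧ x 1 = 0 ∧ x 2 = 0 ∧ x 3 = 0}
  | .line => {x | x 0 = 0 ∧ x 2 = 0 ∧ x 3 = 0}

/-- The map does land in `S`. -/
theorem toQuartic_mem {F : Type*} [Field F] {η : Fin 9 → F} (h : η ∈ torsor F) :
    toQuartic η 0 * toQuartic η 1 - toQuartic η 2 * toQuartic η 3 = 0 ∧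
      toQuartic η 0 * toQuartic η 3 + toQuartic η 1 * toQuartic η 3 +
        toQuartic η 2 * toQuartic η 4 = 0 := by
  have h1 := h.1
  simp only [coxRel] at h1
  simp only [toQuartic, mon, Fin.prod_univ_succ]
  simp [Fin.succ]
  constructor
  · ring
  · linear_combination (η 0 ^ 2 * η 1 ^ 3 * η 2 ^ 2 * η 3 * η 4 * η 5 * η 6 * η 7) * h1


/-- `D_i` is the preimage of `Z_i`: a point of `S'` lies over `Z_i` if and only if it lies on one
of the curves `E_j` in `boundary i`. -/
theorem toQuartic_mem_center_iff {F : Type*} [Field F] {η : Fin 9 → F} (h : η ∈ torsor F)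
    (i : Bdry) : toQuartic η ∈ center i ↔ ∃ j ∈ boundary i, η j = 0 := by
  have h2 : ∃ c ∈ maxMeeting, ∏ j ∈ cᶜ, η j ≠ 0 := by
    by_contra hc
    push Not at hc
    have h3 := h.2
    rw [Ideal.span_eq_bot.2] at h3
    · exact bot_ne_top h3
    · rintro m ⟨c, hm, rfl⟩
      exact hc c hm
  have h4 : ∃ c ∈ maxMeeting, ∀ j, η j = 0 → j ∈ c := by
    obtain ⟨c, hc, h5⟩ := h2
    refine ⟨c, hc, fun j hj => ?_⟩
    by_contra hjc
    exact Finset.prod_ne_zero_iff.1 h5 j (Finset.mem_compl.2 hjc) hj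
  obtain ⟨c, hc, h5⟩ := h4
  have e0 := h5 0
  have e1 := h5 1
  have e2 := h5 2
  have e3 := h5 3
  have e4 := h5 4
  have e5 := h5 5
  have e6 := h5 6
  have e7 := h5 7
  clear h2 h5 h
  simp only [maxMeeting, Finset.mem_insert, Finset.mem_singleton] at hc
  cases i <;>
    rcases hc with rfl | rfl | rfl | rfl | rfl | rfl | rfl | rfl | rfl <;>
    simp [toQuartic, center, boundary, mon, Fin.prod_univ_succ] at e0 e1 e2 e3 e4 e5 e6 e7 ⊢ <;>
    grind

/-! ### Clemens complex -/

/-- The points of the curve `E_j`. -/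
def curve {F : Type*} [Field F] (j : Fin 9) : Set (Surface F) :=
  {P | ∃ η, Represents η P ∧ η j = 0}

/-- The stratum `D_A(ℂ) = ⋂_{j ∈ A} E_j(ℂ)`. -/
def stratum (A : Finset (Fin 9)) : Set (Surface ℂ) := {P | ∀ j ∈ A, P ∈ curve j}

/-- `A` is a face of the Clemens complex of `D_i`: a non-empty set of components of `D_i` that have
a common complex point.  (Two different components meet in at most one point, and no three of them
meet, so every non-empty stratum is irreducible and the faces are such sets.) -/
def IsFace (i : Bdry) (A : Finset (Fin 9)) : Prop :=
  A.Nonempty ∧ A ⊆ boundary i ∧ (stratum A).Nonempty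

open Classical in
/-- All faces of the Clemens complex of `D_i`. -/
def faces (i : Bdry) : Finset (Finset (Fin 9)) :=
  (boundary i).powerset.filter (IsFace i)

open Classical in
/-- The maximal faces of the Clemens complex of `D_i`. -/
def maxFaces (i : Bdry) : Finset (Finset (Fin 9)) :=
  (boundary i).powerset.filter (Maximal (IsFace i))

/-! ### The metric on the log-canonical bundle -/

/-- The exponents of the monomials of degree `ω(D_i)^∨` that define the metric on this bundle, and
the height: they are the restrictions of the coordinates `x₀, x₁, x₂, x₃` (respectively
`x₀, x₂, x₃`), divided by `η₁η₂η₃` (respectively by `η₁η₂η₃η₄`). -/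
def logSections : Bdry → Finset (Fin 9 → ℕ)
  | .sing => {![1, 1, 0, 2, 1, 0, 1, 0, 0], ![0, 1, 1, 0, 1, 2, 0, 1, 0],
      ![1, 2, 1, 1, 2, 1, 0, 0, 0], ![0, 0, 0, 1, 0, 1, 1, 1, 0]}
  | .line => {![1, 1, 0, 1, 1, 0, 1, 0, 0], ![1, 2, 1, 0, 2, 1, 0, 0, 0],
      ![0, 0, 0, 0, 0, 1, 1, 1, 0]}

/-- The coordinates `(x, y) = (η₄η₇/(η₂η₃η₅η₆), η₆η₈/(η₁η₂η₄η₅))`, which identify the complement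
of `E₁, …, E₆` with the affine plane. -/
def planeCoord {F : Type*} [Field F] (η : Fin 9 → F) : F × F :=
  (η 3 * η 6 / (η 1 * η 2 * η 4 * η 5), η 5 * η 7 / (η 0 * η 1 * η 3 * η 4))

/-- The inverse of `planeCoord`: Cox coordinates of the point with coordinates `(x, y)`. -/
def planeParam {F : Type*} [Field F] (p : F × F) : Fin 9 → F :=
  ![1, 1, 1, 1, 1, 1, p.1, p.2, -p.1 - p.2]

/-- The norm `‖(dx ∧ dy) ⊗ 1_{D_i}‖` in `ω(D_i)` at the point with Cox coordinates `η`.  The metric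
is dual to the one on `ω(D_i)^∨` for which a section `s` has norm `‖s(η)‖ / max_m ‖m(η)‖`, with `m`
in `logSections i`; the form `dx ∧ dy` is the element `1/(η₁²η₂³η₃²η₄η₅²η₆)` of canonical degree,
and `1_{D_i}` is the product of the `η_j` with `E_j` in `D_i`.  Here `nrm` is the normalised
absolute value of the local field `F`. -/
def logFormNorm {F : Type*} [Field F] (nrm : F → ℝ≥0) (i : Bdry) (η : Fin 9 → F) : ℝ≥0 :=
  nrm (∏ j ∈ boundary i, η j) * (logSections i).sup (fun m => nrm (mon m η)) /
    nrm (mon ![2, 3, 2, 1, 2, 1, 0, 0, 0] η)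

/-- The normalised absolute value `|z|²` of `ℂ`. -/
def nrmC (z : ℂ) : ℝ≥0 := ‖z‖₊ ^ 2

/-! ### Residue measures -/

/-- `φ` is a system of local holomorphic coordinates `(a, b)` of `S'(ℂ)` around the point `P` of
`E_j ∩ E_k`, lifted to the torsor, in which `E_j = {a = 0}` and `E_k = {b = 0}`: the pull-back of
`η_j` vanishes on `a = 0`, that of `η_k` on `b = 0`, both to order one at the origin.  (Since `E_j`
and `E_k` meet transversally, `φ` is then a local biholomorphism onto a neighbourhood of `P`.) -/
structure IsAdaptedChart (j k : Fin 9) (P : Surface ℂ) (φ : ℂ × ℂ → Fin 9 → ℂ) : Prop where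
  analytic : AnalyticAt ℂ φ 0
  mem_torsor : ∀ᶠ z in 𝓝 (0 : ℂ × ℂ), φ z ∈ torsor ℂ
  center : Represents (φ 0) P
  vanish_fst : ∀ᶠ b in 𝓝 (0 : ℂ), φ (0, b) j = 0
  vanish_snd : ∀ᶠ a in 𝓝 (0 : ℂ), φ (a, 0) k = 0
  simple_fst : deriv (fun a : ℂ => φ (a, 0) j) 0 ≠ 0
  simple_snd : deriv (fun b : ℂ => φ (0, b) k) 0 ≠ 0

/-- The quotient `‖ab‖ / ‖(da ∧ db) ⊗ 1_{D_i}‖` at the point with local coordinates `z = (a, b)`,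
where `da ∧ db` is `dx ∧ dy` divided by the Jacobian determinant of `(a, b) ↦ (x, y)`. -/
def residueQuotient (i : Bdry) (φ : ℂ × ℂ → Fin 9 → ℂ) (z : ℂ × ℂ) : ℝ≥0 :=
  nrmC (z.1 * z.2) /
    (logFormNorm nrmC i (φ z) / nrmC (fderiv ℂ (fun w => planeCoord (φ w)) z).det)

/-- `m` is the mass at the point `P ∈ D_A(ℂ)`, `A = {E_j, E_k}`, of the (unnormalised) measure
`‖1 ⊗ 1_Δ‖⁻¹`, `Δ = D_i - E_j - E_k`, for the metric on `ω_{D_A} ⊗ O(Δ)|_{D_A} = ω(D_i)|_{D_A}`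
given by adjunction: the isomorphism maps the restriction of the local section
`(da ∧ db) ⊗ a⁻¹b⁻¹ ⊗ 1_Δ = (ab)⁻¹ (da ∧ db) ⊗ 1_{D_i}` to `1 ⊗ 1_Δ`, and so `m` is the limit
at the origin of `residueQuotient`, in any local coordinates. -/
def IsPointMass (i : Bdry) (A : Finset (Fin 9)) (P : Surface ℂ) (m : ℝ≥0) : Prop :=
  ∀ j k : Fin 9, j ≠ k → A = {j, k} → ∀ φ, IsAdaptedChart j k P φ →
    Tendsto (residueQuotient i φ) (𝓝[{z | z.1 ≠ 0 ∧ z.2 ≠ 0}] 0) (𝓝 m)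

open Classical in
/-- The mass at `P` of the unnormalised residue measure on `D_A(ℂ)`, for two-element `A`. -/
def pointMass (i : Bdry) (A : Finset (Fin 9)) (P : Surface ℂ) : ℝ≥0 :=
  if h : ∃ m, IsPointMass i A P m then h.choose else 0

instance surfaceMeasurableSpace : MeasurableSpace (Surface ℂ) := ⊤

/-- The residue measure `τ_{i,D_A,∞}`, supported on the finite set `D_A(ℂ)` (`A` a face with two
elements), normalised by the factor `(2π)^{#A}`. -/
def residueMeasure (i : Bdry) (A : Finset (Fin 9)) : Measure (Surface ℂ) :=
  ENNReal.ofReal ((2 * Real.pi) ^ A.card) •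
    Measure.sum fun P : stratum A => (pointMass i A P.1 : ℝ≥0∞) • Measure.dirac P.1

/-! ### Picard groups, effective cones and the constants `α` -/

/-- The Picard group of the complement in `S'` of the curves `E_j`, `j ∈ J`. -/
abbrev PicOpen (J : Finset (Fin 9)) : Type :=
  PicS ⧸ Submodule.span ℤ (curveClass '' (J : Set (Fin 9)))

/-- The restriction of a class in `Pic(S')` to the complement of the curves in `J`. -/
def restrict (J : Finset (Fin 9)) (c : PicS) : PicOpen J := Submodule.Quotient.mk c

/-- `c` is the class of an effective divisor: the degree-`c` part of the Cox ring, which is the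
space of global sections of the line bundle of class `c`, is not zero. -/
def IsEffective (c : PicS) : Prop :=
  ∃ f : MvPolynomial (Fin 9) ℂ, MvPolynomial.IsWeightedHomogeneous curveClass f c ∧
    f ∉ Ideal.span {coxRel (MvPolynomial.X : Fin 9 → MvPolynomial (Fin 9) ℂ)}

/-- The dual of the effective cone of the complement `U` of the curves in `J`, as a subset of
`Hom(Pic U, ℝ)`, the dual of `Pic(U)_ℝ`.  (The effective divisors on `U` are the restrictions of
those on `S'`.) -/
def dualEffCone (J : Finset (Fin 9)) : Set (PicOpen J →ₗ[ℤ] ℝ) :=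
  {x | ∀ c, IsEffective c → 0 ≤ x (restrict J c)}

/-- The log-anticanonical class `ω(D_i)^∨ = -K - D_i`. -/
def logAnticanonical (i : Bdry) : PicS := anticanonicalClass - ∑ j ∈ boundary i, curveClass j

open Classical in
/-- The normalised volume of a subset `X` of the affine hyperplane `{x | ⟨x, L⟩ = 1}` in
`Hom(M, ℝ)`, for `M` a finitely generated free abelian group and `L ∈ M` primitive.  The Haar
measure on `Hom(M, ℝ)` for which `Hom(M, ℤ)` has covolume one is `∏ dx(b_k)` for any basis `(b_k)`
of `M`; the measure on the hyperplane is its quotient by `dx(L)`.  With a basis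
`(L, b₁, …, b_n)`, this is `∏_{k ≥ 1} dx(b_k)`, whatever the basis. -/
def hyperplaneVolume {M : Type*} [AddCommGroup M] (L : M) (X : Set (M →ₗ[ℤ] ℝ)) : ℝ≥0∞ :=
  if h : ∃ n : ℕ, ∃ b : Module.Basis (Fin (n + 1)) ℤ M, b 0 = L then
    volume ((fun (x : M →ₗ[ℤ] ℝ) (k : Fin h.choose) => x (h.choose_spec.choose k.succ)) '' X)
  else 0

/-- `α_{i,A} = vol {x ∈ Eff(U_{i,A})^∨ | ⟨x, ω(D_i)^∨|_{U_{i,A}}⟩ = 1}`, where `U_{i,A}` is the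
complement of the components of `D_i` that do not belong to `A`. -/
def alpha (i : Bdry) (A : Finset (Fin 9)) : ℝ :=
  (hyperplaneVolume (restrict (boundary i \ A) (logAnticanonical i))
    {x | x ∈ dualEffCone (boundary i \ A) ∧
      x (restrict (boundary i \ A) (logAnticanonical i)) = 1}).toReal

/-! ### The archimedean contribution -/

/-- `∑_A α_{i,A} τ_{i,D_A,∞}(D_A(ℂ))`, over the maximal faces of the Clemens complex. -/
def archContribution (i : Bdry) : ℝ :=
  ∑ A ∈ maxFaces i, alpha i A * (residueMeasure i A (stratum A)).toReal

/-- `4π²` times the volume of a polytope, with coordinates `(t₄, t₅, t₆, t₈)` for the first type of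
boundary and `(t₅, t₆, t₈)` for the second. -/
def polytopeConstant : Bdry → ℝ
  | .sing => 4 * Real.pi ^ 2 * volume.real {t : Fin 4 → ℝ | (∀ k, 0 ≤ t k) ∧
      t 1 + 2 * t 2 + t 3 ≤ 1 ∧ t 0 + t 2 + t 3 ≤ 1 ∧ t 0 + t 1 - t 2 - t 3 ≤ 0}
  | .line => 4 * Real.pi ^ 2 * volume.real {t : Fin 3 → ℝ | (∀ k, 0 ≤ t k) ∧
      t 1 + t 2 ≤ 1 ∧ t 0 - t 1 - t 2 ≤ 0 ∧ 2 * t 0 + t 1 ≤ 1}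

/-! ### The finite part and the expected asymptotic formula -/

/-- `rk Pic(U_i)`, where `U_i` is the complement of `D_i` in `S'`. -/
def rankPic (i : Bdry) : ℕ := Module.finrank ℤ (PicOpen (boundary i))

/-- `b_i = rk Pic(U_i) + (dim C(D_i) + 1)`; the dimension of the Clemens complex plus one is the
maximal number of elements of a face. -/
def expectedExponent (i : Bdry) : ℕ := rankPic i + (faces i).sup Finset.card

section LocalFactors

open NumberField IsDedekindDomain

variable (K : Type*) [Field K] [NumberField K]

instance completionMeasurableSpace (v : HeightOneSpectrum (𝓞 K)) : MeasurableSpace (v.adicCompletion K) := borel _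

open Classical in
/-- The Haar measure on `K_v` for which the ring of integers has volume one. -/
def localHaar (v : HeightOneSpectrum (𝓞 K)) : Measure (v.adicCompletion K) :=
  if h : ∃ μ : Measure (v.adicCompletion K), μ.IsAddHaarMeasure ∧
    μ (v.adicCompletionIntegers K : Set (v.adicCompletion K)) = 1 then h.choose else 0

/-- The `v`-adic integral points of the integral model of `U_i`, as points of `S'(K_v)`: they have
Cox coordinates in the ring of integers that form an integral point of the universal torsor, and
those belonging to the boundary are units. -/
def integralPoints (i : Bdry) (v : HeightOneSpectrum (𝓞 K)) : Set (Surface (v.adicCompletion K)) :=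
  {P | ∃ η : Fin 9 → v.adicCompletionIntegers K, η ∈ torsor (v.adicCompletionIntegers K) ∧
    (∀ j ∈ boundary i, IsUnit (η j)) ∧
    Represents (fun j => (η j : v.adicCompletion K)) P}

open Classical in
/-- The `v`-adic Tamagawa volume `τ_{(S',D_i),v}(U_i(O_v))`: the integral over `U_i(O_v)` of
`‖(dx ∧ dy) ⊗ 1_{D_i}‖⁻¹ dx dy`, in the coordinates `(x, y)`, whose domain has a complement of
measure zero. -/
def localVolume (i : Bdry) (v : HeightOneSpectrum (𝓞 K)) : ℝ :=
  (∫⁻ x, ∫⁻ y,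
    (if ∃ P ∈ integralPoints K i v, Represents (planeParam (x, y)) P then
      ((logFormNorm (fun z => ‖z‖₊) i (planeParam (x, y)))⁻¹ : ℝ≥0∞) else 0)
    ∂(localHaar K v) ∂(localHaar K v)).toReal

/-- The convergence factor `(1 - 1/N𝔭)^{rk Pic(U_i)}` times the local volume. -/
def localFactor (i : Bdry) (v : HeightOneSpectrum (𝓞 K)) : ℝ :=
  (1 - 1 / (Ideal.absNorm v.asIdeal : ℝ)) ^ rankPic i * localVolume K i v

/-- The finite part `c_{i,fin}` of the expected constant; `dedekindZeta_residue K` is `ρ_K`. -/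
def finitePart (i : Bdry) : ℝ :=
  dedekindZeta_residue K ^ rankPic i * ∏' v, localFactor K i v

/-- The archimedean part of the expected constant over `K`: the archimedean contribution divided by
`|Δ_K|^{dim(U_i)/2} = |Δ_K|`. -/
def archPart (i : Bdry) : ℝ := (|discr K| : ℝ)⁻¹ * archContribution i

/-- The expected main term `c_{i,fin} c_{i,∞} B (log B)^{b_i - 1}`. -/
def expectedMainTerm (i : Bdry) (B : ℝ) : ℝ :=
  finitePart K i * archPart K i * B * Real.log B ^ (expectedExponent i - 1)

/-- The main terms of the asymptotic formulas for the number of integral points of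
log-anticanonical height at most `B` over an imaginary quadratic field. -/
def mainTheoremTerm : Bdry → ℝ → ℝ
  | .sing, B => dedekindZeta_residue K ^ 3 / √(|discr K| : ℝ) ^ 2 * (Real.pi ^ 2 / 18) *
      (∏' v : HeightOneSpectrum (𝓞 K), (1 - 1 / (Ideal.absNorm v.asIdeal : ℝ)) ^ 3 *
        (1 + 3 / (Ideal.absNorm v.asIdeal : ℝ))) * B * Real.log B ^ 4
  | .line, B => dedekindZeta_residue K ^ 2 / √(|discr K| : ℝ) ^ 2 * (11 * Real.pi ^ 2 / 18) *
      (∏' v : HeightOneSpectrum (𝓞 K), (1 - 1 / (Ideal.absNorm v.asIdeal : ℝ)) ^ 2 *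
        (1 + 2 / (Ideal.absNorm v.asIdeal : ℝ))) * B * Real.log B ^ 3

end LocalFactors

end A3Surface

end

/-! All constants in the expected main term can be computed explicitly in Cox coordinates, and the
conjectured formula agrees with the main term because each local volume has the expected value.

* **Clemens complexes.**  At a point of the torsor, the coordinates that vanish have their indices
  in one of the sets of `maxMeeting`; conversely explicit points of the torsor lie on the pairs
  `{E₁, E₂}`, `{E₂, E₃}`, `{E₁, E₄}` (`isFace_iff`).  The torus acts transitively on the points of
  the torsor above each of these pairs, so that the three strata are single points.

* **Residue measures.**  The plane coordinates `x, y` are Laurent monomials in the `η_l`, so `‖ab‖`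
  times the Jacobian of `(a, b) ↦ (x, y)`, divided by `‖xy‖`, is a determinant of logarithmic
  derivatives `a ∂_a η_l / η_l`, `b ∂_b η_l / η_l`, summed with the exponents of `x` and `y`.  In
  any adapted chart these derivatives tend to the orders of vanishing along the axes
  (`IsAdaptedChart.tendsto_log_deriv`), hence the determinant tends to a minor of the matrix of
  exponents, which is `±1`.  The remaining factor compares `x₃`, divided by the equation of `D_i`,
  with the maximum of all sections in the metric; it tends to `1` because the other sections vanish
  at the point (`isPointMass_of_exponents`).

* **Constants `α`.**  The effective cone is generated by the nine curves, and `hyperplaneVolume`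
  does not depend on the basis used in its definition, as two bases differ by an integral matrix of
  determinant `±1` (`volume_image_basis_eq`).  In the basis of the log-anticanonical class and some
  of the `[E_j]`, the cone becomes the asserted polytope (`alpha_eq`).  For each boundary these
  polytopes are the pieces into which hyperplanes cut the polytope of `polytopeConstant`, and the
  volume of the latter comes from a dissection into simplices.

* **Local volumes.**  As `O_v` is local, an integral point has unit coordinates outside one of the
  sets of `maxMeeting`.  It follows that the integral points are described, in the plane
  coordinates, by the disjoint regions `‖x‖, ‖y‖ ≤ 1`, `‖x + y‖ ≤ 1 < ‖x‖`, `‖x‖‖y‖ ≤ 1 < ‖x‖`, and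
  for `D₁` also `‖x‖‖y‖ ≤ 1 < ‖y‖` (`exists_integralPoint_sing_iff`,
  `exists_integralPoint_line_iff`): they contain the points that reduce outside `E₄, E₅, E₆` and to
  `E₅`, `E₆`, `E₄`.  The density is `1` on the first region and integrates to `1 / N𝔭` over each of
  the others, whence `1 + 3 / N𝔭` and `1 + 2 / N𝔭` (`localVolume_sing`, `localVolume_line`).  The
  convergence factors remove the terms of order `1 / N𝔭`, and `∑ 1 / N𝔭²` converges because at most
  `[K : ℚ]` primes lie above a given prime number. -/

noncomputable section

namespace A3Surface

/-! ### Points of the torsor, strata and the Clemens complex -/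

theorem exists_maxMeeting_of_mem_torsor {F : Type*} [Field F] {η : Fin 9 → F}
    (h : η ∈ torsor F) : ∃ c ∈ maxMeeting, ∀ j, η j = 0 → j ∈ c := by
  have h2 : ∃ c ∈ maxMeeting, ∏ j ∈ cᶜ, η j ≠ 0 := by
    by_contra hc
    push Not at hc
    have h3 := h.2
    rw [Ideal.span_eq_bot.2] at h3
    · exact bot_ne_top h3
    · rintro m ⟨c, hm, rfl⟩
      exact hc c hm
  obtain ⟨c, hc, h5⟩ := h2
  refine ⟨c, hc, fun j hj => ?_⟩
  by_contra hjc
  exact Finset.prod_ne_zero_iff.1 h5 j (Finset.mem_compl.2 hjc) hj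

theorem mem_torsor_of_isUnit {R : Type*} [CommRing R] {η : Fin 9 → R} (h : coxRel η = 0)
    {c : Finset (Fin 9)} (hc : c ∈ maxMeeting) (hu : ∀ j, j ∉ c → IsUnit (η j)) :
    η ∈ torsor R := by
  refine ⟨h, Ideal.eq_top_of_isUnit_mem _ (Ideal.subset_span ⟨c, hc, rfl⟩) ?_⟩
  exact (Finset.prod_induction η IsUnit (fun _ _ => IsUnit.mul) isUnit_one)
    fun j hj => hu j (Finset.mem_compl.1 hj)

/-- Membership in a curve can be tested on any Cox coordinates, since the torus scales every
coordinate by a unit. -/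
theorem Represents.mem_curve_iff {F : Type*} [Field F] {η : Fin 9 → F} {P : Surface F}
    (h : Represents η P) (j : Fin 9) : P ∈ curve j ↔ η j = 0 := by
  refine ⟨?_, fun hj => ⟨η, h, hj⟩⟩
  rintro ⟨η', ⟨h', rfl⟩, hj⟩
  obtain ⟨h, hP⟩ := h
  obtain ⟨t, ht⟩ := Quotient.exact hP
  have : η' j = _ * η j := ht j
  rw [hj] at this
  exact (mul_eq_zero.1 this.symm).resolve_left (Units.ne_zero _)

/-- Two points of the torsor define the same point of the surface if a family of scalars
`t₀, …, t₅` relates them coordinatewise. -/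
theorem represents_of_scaling {F : Type*} [Field F] {η η' : Fin 9 → F} {P : Surface F}
    (h : Represents η P) (h' : η' ∈ torsor F) (t : Fin 6 → Fˣ)
    (ht : ∀ j, η' j = ((∏ k, t k ^ curveClass j k : Fˣ) : F) * η j) : Represents η' P := by
  obtain ⟨h, rfl⟩ := h
  exact ⟨h', (Quotient.sound (s := torusSetoid F)
    (show torusRel ⟨η, h⟩ ⟨η', h'⟩ from ⟨t, ht⟩)).symm⟩

/-- Coordinates `(a, b)` at the intersection point of `E₁` and `E₂`, lifted to the torsor. -/
def chart₁₂ (z : ℂ × ℂ) : Fin 9 → ℂ := ![z.1, z.2, 1, 1, 1, 1, 1, 1, -1 - z.1]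

/-- Coordinates `(a, b)` at the intersection point of `E₂` and `E₃`, lifted to the torsor. -/
def chart₂₃ (z : ℂ × ℂ) : Fin 9 → ℂ := ![1, z.1, z.2, 1, 1, 1, 1, 1, -1 - z.2]

/-- Coordinates `(a, b)` at the intersection point of `E₁` and `E₄`, lifted to the torsor. -/
def chart₁₄ (z : ℂ × ℂ) : Fin 9 → ℂ := ![z.1, 1, 1, z.2, 1, 1, 1, 1, -1 - z.1 * z.2 ^ 2]

theorem chart₁₂_mem_torsor {z : ℂ × ℂ} (h : -1 - z.1 ≠ 0) : chart₁₂ z ∈ torsor ℂ := by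
  refine mem_torsor_of_isUnit (c := {0, 1}) (by simp [coxRel, chart₁₂]; ring) (by decide)
    fun j hj => ?_
  fin_cases j <;> simp_all [chart₁₂]

theorem chart₂₃_mem_torsor {z : ℂ × ℂ} (h : -1 - z.2 ≠ 0) : chart₂₃ z ∈ torsor ℂ := by
  refine mem_torsor_of_isUnit (c := {1, 2}) (by simp [coxRel, chart₂₃]) (by decide)
    fun j hj => ?_
  fin_cases j <;> simp_all [chart₂₃]

theorem chart₁₄_mem_torsor {z : ℂ × ℂ} (h : -1 - z.1 * z.2 ^ 2 ≠ 0) : chart₁₄ z ∈ torsor ℂ := by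
  refine mem_torsor_of_isUnit (c := {0, 3}) (by simp [coxRel, chart₁₄]; ring) (by decide)
    fun j hj => ?_
  fin_cases j <;> simp_all [chart₁₄]

/-- The point `E₁ ∩ E₂`. -/
def node₁₂ : Surface ℂ := Quotient.mk (torusSetoid ℂ) ⟨chart₁₂ 0, chart₁₂_mem_torsor (by simp)⟩

/-- The point `E₂ ∩ E₃`. -/
def node₂₃ : Surface ℂ := Quotient.mk (torusSetoid ℂ) ⟨chart₂₃ 0, chart₂₃_mem_torsor (by simp)⟩

/-- The point `E₁ ∩ E₄`. -/
def node₁₄ : Surface ℂ := Quotient.mk (torusSetoid ℂ) ⟨chart₁₄ 0, chart₁₄_mem_torsor (by simp)⟩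

theorem represents_node₁₂ : Represents (chart₁₂ 0) node₁₂ := ⟨_, rfl⟩
theorem represents_node₂₃ : Represents (chart₂₃ 0) node₂₃ := ⟨_, rfl⟩
theorem represents_node₁₄ : Represents (chart₁₄ 0) node₁₄ := ⟨_, rfl⟩

/-- Every point has Cox coordinates. -/
theorem exists_represents {F : Type*} [Field F] (P : Surface F) : ∃ η, Represents η P := by
  obtain ⟨⟨η, h⟩, rfl⟩ := Quotient.exists_rep P
  exact ⟨η, h, rfl⟩

/-- A stratum is a single point if the torus acts transitively on the part of the torsor above it.
-/
theorem stratum_eq_singleton {j k : Fin 9} {P : Surface ℂ} {η₀ : Fin 9 → ℂ}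
    (h₀ : Represents η₀ P) (hj : η₀ j = 0) (hk : η₀ k = 0)
    (H : ∀ η ∈ torsor ℂ, η j = 0 → η k = 0 → ∃ t : Fin 6 → ℂˣ,
      ∀ l, η l = ((∏ m, t m ^ curveClass l m : ℂˣ) : ℂ) * η₀ l) :
    stratum {j, k} = {P} := by
  ext P'
  simp only [stratum, Finset.mem_insert, Finset.mem_singleton, forall_eq_or_imp, forall_eq,
    Set.mem_ofPred_eq, Set.mem_singleton_iff]
  constructor
  · rintro ⟨h1, h2⟩
    obtain ⟨η, hη⟩ := exists_represents P'
    obtain ⟨t, ht⟩ := H η hη.1 ((hη.mem_curve_iff j).1 h1) ((hη.mem_curve_iff k).1 h2)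
    exact hη.2.symm.trans (represents_of_scaling h₀ hη.1 t ht).2
  · rintro rfl
    exact ⟨(h₀.mem_curve_iff j).2 hj, (h₀.mem_curve_iff k).2 hk⟩

/-- If two curves that meet only each other contain a point, then no other coordinate vanishes. -/
theorem ne_zero_of_mem_torsor {F : Type*} [Field F] {η : Fin 9 → F} (h : η ∈ torsor F)
    {j k : Fin 9} (hj : η j = 0) (hk : η k = 0)
    (H : ∀ c ∈ maxMeeting, j ∈ c → k ∈ c → c = {j, k}) (l : Fin 9) (hlj : l ≠ j) (hlk : l ≠ k) :
    η l ≠ 0 := by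
  intro hl
  obtain ⟨c, hc, h5⟩ := exists_maxMeeting_of_mem_torsor h
  have := h5 l hl
  rw [H c hc (h5 j hj) (h5 k hk)] at this
  simp_all

theorem stratum₁₂ : stratum {0, 1} = {node₁₂} := by
  refine stratum_eq_singleton represents_node₁₂ (by simp [chart₁₂]) (by simp [chart₁₂]) ?_
  intro η hη h0 h1
  have hne := ne_zero_of_mem_torsor hη h0 h1 (by decide +kernel)
  have e2 := hne 2 (by decide) (by decide)
  have e3 := hne 3 (by decide) (by decide)
  have e4 := hne 4 (by decide) (by decide)
  have e5 := hne 5 (by decide) (by decide)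
  have e6 := hne 6 (by decide) (by decide)
  have e7 := hne 7 (by decide) (by decide)
  have hr := hη.1
  simp only [coxRel, h0] at hr
  -- the scalars are read off from the degrees of `η₃, …, η₈`; the relation then fixes `η₉`
  refine ⟨![Units.mk0 (η 7 * η 2 * η 5 ^ 2) (by simp [*]),
    Units.mk0 (η 7 * η 2 * η 5 ^ 2 / (η 3 * η 6)) (by simp [*]),
    Units.mk0 (η 2 * η 5) (by simp [*]),
    Units.mk0 (η 4) e4, Units.mk0 (η 3) e3, Units.mk0 (η 5) e5], fun l => ?_⟩
  fin_cases l <;> simp [chart₁₂, curveClass, Fin.prod_univ_succ, h0, h1] <;> field_simp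
  linear_combination hr

theorem stratum₂₃ : stratum {1, 2} = {node₂₃} := by
  refine stratum_eq_singleton represents_node₂₃ (by simp [chart₂₃]) (by simp [chart₂₃]) ?_
  intro η hη h0 h1
  have hne := ne_zero_of_mem_torsor hη h0 h1 (by decide +kernel)
  have e0 := hne 0 (by decide) (by decide)
  have e3 := hne 3 (by decide) (by decide)
  have e4 := hne 4 (by decide) (by decide)
  have e5 := hne 5 (by decide) (by decide)
  have e6 := hne 6 (by decide) (by decide)
  have e7 := hne 7 (by decide) (by decide)
  have hr := hη.1
  simp only [coxRel, h1] at hr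
  refine ⟨![Units.mk0 (η 6 * η 0 * η 3 ^ 2) (by simp [*]),
    Units.mk0 (η 0 * η 3) (by simp [*]),
    Units.mk0 (η 6 * η 0 * η 3 ^ 2 / (η 5 * η 7)) (by simp [*]),
    Units.mk0 (η 4) e4, Units.mk0 (η 3) e3, Units.mk0 (η 5) e5], fun l => ?_⟩
  fin_cases l <;> simp [chart₂₃, curveClass, Fin.prod_univ_succ, h0, h1] <;> field_simp
  linear_combination hr

theorem stratum₁₄ : stratum {0, 3} = {node₁₄} := by
  refine stratum_eq_singleton represents_node₁₄ (by simp [chart₁₄]) (by simp [chart₁₄]) ?_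
  intro η hη h0 h1
  have hne := ne_zero_of_mem_torsor hη h0 h1 (by decide +kernel)
  have e1 := hne 1 (by decide) (by decide)
  have e2 := hne 2 (by decide) (by decide)
  have e4 := hne 4 (by decide) (by decide)
  have e5 := hne 5 (by decide) (by decide)
  have e6 := hne 6 (by decide) (by decide)
  have e7 := hne 7 (by decide) (by decide)
  have hr := hη.1
  simp only [coxRel, h0] at hr
  refine ⟨![Units.mk0 (η 7 * η 2 * η 5 ^ 2) (by simp [*]),
    Units.mk0 (η 7 * η 5 / (η 4 * η 1)) (by simp [*]),
    Units.mk0 (η 2 * η 5) (by simp [*]),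
    Units.mk0 (η 4) e4, Units.mk0 (η 2 * η 5 * η 4 * η 1 / η 6) (by simp [*]),
    Units.mk0 (η 5) e5], fun l => ?_⟩
  fin_cases l <;> simp [chart₁₄, curveClass, Fin.prod_univ_succ, h0, h1] <;> field_simp
  linear_combination hr

theorem stratum_anti {A B : Finset (Fin 9)} (h : A ⊆ B) : stratum B ⊆ stratum A :=
  fun _ hP j hj => hP j (h hj)

/-- The faces are the non-empty sets of components contained in a maximal set of meeting
curves. -/
theorem isFace_iff (i : Bdry) (A : Finset (Fin 9)) :
    IsFace i A ↔ A.Nonempty ∧ A ⊆ boundary i ∧ ∃ c ∈ maxMeeting, A ⊆ c := by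
  refine and_congr_right fun hne => and_congr_right fun hA => ⟨?_, ?_⟩
  · rintro ⟨P, hP⟩
    obtain ⟨η, hη⟩ := exists_represents P
    obtain ⟨c, hc, h⟩ := exists_maxMeeting_of_mem_torsor hη.1
    exact ⟨c, hc, fun j hj => h j ((hη.mem_curve_iff j).1 (hP j hj))⟩
  · intro h
    have hA' : A ∈ ({0, 1, 2, 3} : Finset (Fin 9)).powerset := by
      rw [Finset.mem_powerset]
      refine hA.trans ?_
      cases i <;> decide
    have key : A ⊆ {0, 1} ∨ A ⊆ {1, 2} ∨ A ⊆ {0, 3} := by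
      clear hA hne
      revert A
      decide +kernel
    rcases key with h | h | h
    · exact Set.Nonempty.mono (stratum_anti h) (by simp [stratum₁₂])
    · exact Set.Nonempty.mono (stratum_anti h) (by simp [stratum₂₃])
    · exact Set.Nonempty.mono (stratum_anti h) (by simp [stratum₁₄])

theorem faces_eq (i : Bdry) : faces i = (boundary i).powerset.filter
    fun A => A.Nonempty ∧ ∃ c ∈ maxMeeting, A ⊆ c := by
  ext A
  simp only [faces, Finset.mem_filter, Finset.mem_powerset, isFace_iff]
  tauto

theorem faces_sup_card (i : Bdry) : (faces i).sup Finset.card = 2 := by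
  rw [faces_eq]
  cases i <;> decide +kernel

theorem maxFaces_eq (i : Bdry) : maxFaces i = (boundary i).powerset.filter
    fun A => (A.Nonempty ∧ ∃ c ∈ maxMeeting, A ⊆ c) ∧
      ∀ B ∈ (boundary i).powerset, (B.Nonempty ∧ ∃ c ∈ maxMeeting, B ⊆ c) → A ⊆ B → B ⊆ A := by
  ext A
  simp only [maxFaces, Finset.mem_filter, Finset.mem_powerset, Maximal, isFace_iff]
  constructor
  · rintro ⟨h1, ⟨h2, -, h3⟩, h4⟩
    exact ⟨h1, ⟨h2, h3⟩, fun B hB hB' h => h4 ⟨hB'.1, hB, hB'.2⟩ h⟩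
  · rintro ⟨h1, ⟨h2, h3⟩, h4⟩
    exact ⟨h1, ⟨h2, h1, h3⟩, fun B hB h => h4 B hB.2.1 ⟨hB.1, hB.2.2⟩ h⟩

theorem maxFaces_sing : maxFaces .sing = {{0, 1}, {1, 2}} := by
  rw [maxFaces_eq]
  decide +kernel

theorem maxFaces_line : maxFaces .line = {{0, 1}, {1, 2}, {0, 3}} := by
  rw [maxFaces_eq]
  decide +kernel

/-! ### Residue measures -/

/-- The exponents of the Cox coordinates in the plane coordinate `x`. -/
def expX : Fin 9 → ℤ := ![0, -1, -1, 1, -1, -1, 1, 0, 0]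

/-- The exponents of the Cox coordinates in the plane coordinate `y`. -/
def expY : Fin 9 → ℤ := ![-1, -1, 0, -1, -1, 1, 0, 1, 0]

theorem planeCoord_eq {F : Type*} [Field F] (η : Fin 9 → F) :
    planeCoord η = (∏ l, η l ^ expX l, ∏ l, η l ^ expY l) := by
  ext
  · simp [planeCoord, expX, Fin.prod_univ_succ]
    ring
  · simp [planeCoord, expY, Fin.prod_univ_succ]
    ring

theorem det_prod_eq (L : ℂ × ℂ →L[ℂ] ℂ × ℂ) :
    L.det = (L (1, 0)).1 * (L (0, 1)).2 - (L (0, 1)).1 * (L (1, 0)).2 := by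
  rw [ContinuousLinearMap.det, ← LinearMap.det_toMatrix (Module.Basis.finTwoProd ℂ),
    Matrix.det_fin_two]
  simp [LinearMap.toMatrix_apply]

/-- The punctured neighbourhood filter used for residues: `(a, b) → (0, 0)` with `ab ≠ 0`. -/
abbrev residueFilter : Filter (ℂ × ℂ) := 𝓝[{z | z.1 ≠ 0 ∧ z.2 ≠ 0}] 0

instance residueFilter_neBot : residueFilter.NeBot := by
  have : {z : ℂ × ℂ | z.1 ≠ 0 ∧ z.2 ≠ 0} = ({0}ᶜ : Set ℂ) ×ˢ ({0}ᶜ : Set ℂ) := by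
    ext; simp
  rw [residueFilter, this, show (0 : ℂ × ℂ) = (0, 0) from rfl, nhdsWithin_prod_eq]
  infer_instance

/-- Logarithmic derivative of a product of powers along a direction. -/
theorem fderiv_prod_zpow_apply {f : ℂ × ℂ → Fin 9 → ℂ} {z : ℂ × ℂ} (hf : DifferentiableAt ℂ f z)
    (e : Fin 9 → ℤ) (h : ∀ l, e l ≠ 0 → f z l ≠ 0) (v : ℂ × ℂ) :
    DifferentiableAt ℂ (fun w => ∏ l, f w l ^ e l) z ∧
    fderiv ℂ (fun w => ∏ l, f w l ^ e l) z v =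
      (∏ l, f z l ^ e l) * ∑ l, e l * (fderiv ℂ (fun w => f w l) z v / f z l) := by
  have hfl : ∀ l, DifferentiableAt ℂ (fun w => f w l) z := fun l => differentiableAt_pi.1 hf l
  have hp : ∀ l, DifferentiableAt ℂ (fun w => f w l ^ e l) z := fun l =>
    (hfl l).zpow (by by_cases hl : e l = 0 <;> simp [hl, h])
  have hd : DifferentiableAt ℂ (fun w => ∏ l, f w l ^ e l) z :=
    (HasFDerivAt.finsetProd fun l _ => (hp l).hasFDerivAt).differentiableAt
  refine ⟨hd, ?_⟩
  have hne : ∀ l, f z l ^ e l ≠ 0 := fun l => by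
    by_cases hl : e l = 0
    · simp [hl]
    · exact zpow_ne_zero _ (h l hl)
  have hline : HasDerivAt (fun t : ℂ => z + t • v) v 0 := by
    simpa using ((hasDerivAt_id (0 : ℂ)).smul_const v).const_add z
  have key : ∀ g : ℂ × ℂ → ℂ, DifferentiableAt ℂ g z →
      HasDerivAt (fun t : ℂ => g (z + t • v)) (fderiv ℂ g z v) 0 := fun g hg => by
    have : HasFDerivAt g (fderiv ℂ g z) (z + (0 : ℂ) • v) := by simpa using hg.hasFDerivAt
    exact this.comp_hasDerivAt 0 hline
  have h1 := (key _ hd)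
  have h2 : logDeriv (fun t : ℂ => ∏ l, f (z + t • v) l ^ e l) 0 =
      ∑ l, logDeriv (fun t : ℂ => f (z + t • v) l ^ e l) 0 :=
    logDeriv_prod (by simpa using fun l => hne l) (fun l _ => (key _ (hp l)).differentiableAt)
  have h3 : ∀ l, logDeriv (fun t : ℂ => f (z + t • v) l ^ e l) 0 =
      e l * (fderiv ℂ (fun w => f w l) z v / f z l) := fun l => by
    rw [logDeriv_fun_zpow (key _ (hfl l)).differentiableAt, logDeriv_apply, (key _ (hfl l)).deriv]
    simp
  simp only [h3] at h2
  rw [← h2, logDeriv_apply, h1.deriv]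
  simp only [zero_smul, add_zero]
  rw [mul_div_cancel₀]
  exact Finset.prod_ne_zero_iff.2 fun l _ => hne l

/-- The Jacobian determinant of `(a, b) ↦ (x, y)`, divided by `xy`, is the determinant of the
logarithmic derivatives. -/
theorem det_fderiv_planeCoord {φ : ℂ × ℂ → Fin 9 → ℂ} {z : ℂ × ℂ} (hφ : DifferentiableAt ℂ φ z)
    (h : ∀ l, l ≠ 8 → φ z l ≠ 0) :
    (fderiv ℂ (fun w => planeCoord (φ w)) z).det =
      (planeCoord (φ z)).1 * (planeCoord (φ z)).2 *
      ((∑ l, expX l * (fderiv ℂ (fun w => φ w l) z (1, 0) / φ z l)) *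
        (∑ l, expY l * (fderiv ℂ (fun w => φ w l) z (0, 1) / φ z l)) -
      (∑ l, expX l * (fderiv ℂ (fun w => φ w l) z (0, 1) / φ z l)) *
        (∑ l, expY l * (fderiv ℂ (fun w => φ w l) z (1, 0) / φ z l))) := by
  have hX : ∀ l, expX l ≠ 0 → φ z l ≠ 0 := fun l hl => h l (by rintro rfl; simp [expX] at hl)
  have hY : ∀ l, expY l ≠ 0 → φ z l ≠ 0 := fun l hl => h l (by rintro rfl; simp [expY] at hl)
  have h1 := fun v => fderiv_prod_zpow_apply hφ expX hX v
  have h2 := fun v => fderiv_prod_zpow_apply hφ expY hY v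
  simp only [planeCoord_eq]
  rw [DifferentiableAt.fderiv_prodMk (h1 0).1 (h2 0).1, det_prod_eq]
  simp only [ContinuousLinearMap.prod_apply, (h1 _).2, (h2 _).2]
  ring

/-- The logarithmic derivative of a function that does not vanish at the origin is bounded, so its
product with a linear form tends to zero. -/
theorem tendsto_log_deriv_of_ne_zero {g : ℂ × ℂ → ℂ} (hg : AnalyticAt ℂ g 0) (h0 : g 0 ≠ 0)
    (v : ℂ × ℂ) (p : ℂ × ℂ →L[ℂ] ℂ) :
    Tendsto (fun z => p z * (fderiv ℂ g z v / g z)) residueFilter (𝓝 0) := by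
  have h1 : ContinuousAt (fun z => p z * (fderiv ℂ g z v / g z)) 0 :=
    p.continuous.continuousAt.mul
      ((hg.fderiv.continuousAt.clm_apply continuousAt_const).div hg.continuousAt h0)
  have h2 := h1.tendsto
  simp only [map_zero, zero_mul] at h2
  exact h2.mono_left nhdsWithin_le_nhds

/-- The map `z ↦ z - s(z) u` projects along `u`, onto the line `s = 0` if `s(u) = 1`.  A function
that vanishes on the image of this map has the quotient by `s` tending to its derivative in the
direction `u`. -/
theorem tendsto_div_coord {g : ℂ × ℂ → ℂ} (hg : AnalyticAt ℂ g 0)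
    {s : ℂ × ℂ →L[ℂ] ℂ} {u : ℂ × ℂ}
    (hz : ∀ᶠ z in 𝓝 (0 : ℂ × ℂ), g (z - s z • u) = 0) (hs : ∀ᶠ z in residueFilter, s z ≠ 0) :
    Tendsto (fun z => g z / s z) residueFilter (𝓝 (fderiv ℂ g 0 u)) := by
  have hlim : Tendsto (fun z : ℂ × ℂ => (z, z - s z • u)) (𝓝 0) (𝓝 (0, 0)) := by
    have : Continuous fun z : ℂ × ℂ => (z, z - s z • u) := by fun_prop
    simpa using this.tendsto 0
  have h1 := hg.hasStrictFDerivAt.isLittleO.comp_tendsto hlim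
  have h2 : (fun z => g z - s z * fderiv ℂ g 0 u) =o[𝓝 0] fun z => s z := by
    refine Asymptotics.IsLittleO.trans_isBigO (h1.congr' ?_ EventuallyEq.rfl) ?_
    · filter_upwards [hz] with z hz
      simp [hz]
    · refine Asymptotics.IsBigO.of_bound ‖u‖ (Eventually.of_forall fun z => ?_)
      simp [norm_smul, mul_comm]
  have h3 := (h2.mono (nhdsWithin_le_nhds : residueFilter ≤ 𝓝 0)).tendsto_div_nhds_zero
  have h4 := h3.add_const (fderiv ℂ g 0 u)
  rw [zero_add] at h4
  refine h4.congr' ?_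
  filter_upwards [hs] with z hz
  field_simp
  ring

/-- A coordinate `g` that vanishes to order one on the line `s = 0` has logarithmic derivative
`s ∂_u g / g → 1` in the transversal direction `u`, and `r ∂_w g / g → 0` along the line. -/
theorem tendsto_log_deriv_of_vanish {g : ℂ × ℂ → ℂ} (hg : AnalyticAt ℂ g 0)
    {s r : ℂ × ℂ →L[ℂ] ℂ} {u w : ℂ × ℂ} (hsu : s u = 1) (hsw : s w = 0)
    (hz : ∀ᶠ z in 𝓝 (0 : ℂ × ℂ), g (z - s z • u) = 0) (hs : ∀ᶠ z in residueFilter, s z ≠ 0)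
    (hc : fderiv ℂ g 0 u ≠ 0) :
    (∀ᶠ z in residueFilter, g z ≠ 0) ∧
    Tendsto (fun z => s z * (fderiv ℂ g z u / g z)) residueFilter (𝓝 1) ∧
    Tendsto (fun z => r z * (fderiv ℂ g z w / g z)) residueFilter (𝓝 0) := by
  have h1 := tendsto_div_coord hg hz hs
  have hne : ∀ᶠ z in residueFilter, g z ≠ 0 := by
    filter_upwards [h1.eventually_ne hc] with z hz h
    simp [h] at hz
  have hlim : Tendsto (fun z : ℂ × ℂ => z - s z • u) (𝓝 0) (𝓝 0) := by
    have : Continuous fun z : ℂ × ℂ => z - s z • u := by fun_prop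
    simpa using this.tendsto 0
  have hh : AnalyticAt ℂ (fun z => fderiv ℂ g z w) 0 :=
    ((ContinuousLinearMap.apply ℂ ℂ w).analyticAt _).comp hg.fderiv
  -- the derivative along the line `s = 0` vanishes on this line, because `g` does
  have hz' : ∀ᶠ z in 𝓝 (0 : ℂ × ℂ), fderiv ℂ g (z - s z • u) w = 0 := by
    filter_upwards [hlim.eventually hz.eventually_nhds,
      hlim.eventually hg.eventually_analyticAt] with z h3 h4
    set z' := z - s z • u with hz'
    have hs' : s z' = 0 := by simp [hz', hsu]
    have hline : HasDerivAt (fun t : ℂ => z' + t • w) w 0 := by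
      simpa using ((hasDerivAt_id (0 : ℂ)).smul_const w).const_add z'
    have h5 : HasFDerivAt g (fderiv ℂ g z') (z' + (0 : ℂ) • w) := by
      simpa using h4.differentiableAt.hasFDerivAt
    have h6 := h5.comp_hasDerivAt 0 hline
    have h7 : Tendsto (fun t : ℂ => z' + t • w) (𝓝 0) (𝓝 z') := by
      simpa using hline.continuousAt.tendsto
    have h8 : (g ∘ fun t : ℂ => z' + t • w) =ᶠ[𝓝 0] fun _ => 0 := by
      filter_upwards [h7.eventually h3] with t ht
      simpa [hs', hsw] using ht
    exact h6.unique ((hasDerivAt_const (0 : ℂ) (0 : ℂ)).congr_of_eventuallyEq h8)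
  have h2 := tendsto_div_coord hh hz' hs
  have hr : Tendsto (fun z => r z) residueFilter (𝓝 0) := by
    have := r.continuous.tendsto 0
    rw [map_zero] at this
    exact this.mono_left nhdsWithin_le_nhds
  have hu : Tendsto (fun z => fderiv ℂ g z u) residueFilter (𝓝 (fderiv ℂ g 0 u)) :=
    (hg.fderiv.continuousAt.clm_apply continuousAt_const).tendsto.mono_left nhdsWithin_le_nhds
  refine ⟨hne, ?_, ?_⟩
  · have := hu.div h1 hc
    rw [div_self hc] at this
    refine this.congr' ?_
    filter_upwards [hs, hne] with z h3 h4
    simp only [Pi.div_apply]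
    field_simp
  · have := (hr.mul h2).div h1 hc
    rw [zero_mul, zero_div] at this
    refine this.congr' ?_
    filter_upwards [hs, hne] with z h3 h4
    simp only [Pi.div_apply]
    field_simp

/-- In adapted coordinates `(a, b)`, the logarithmic derivatives `a ∂_a η_l / η_l` and
`b ∂_b η_l / η_l` tend to the orders of vanishing of `η_l` along the two axes. -/
theorem IsAdaptedChart.tendsto_log_deriv {j k : Fin 9} {P : Surface ℂ} {φ : ℂ × ℂ → Fin 9 → ℂ}
    (h : IsAdaptedChart j k P φ) (hjk : j ≠ k)
    (h0 : ∀ l, l ≠ 8 → l ≠ j → l ≠ k → φ 0 l ≠ 0) (l : Fin 9) (hl : l ≠ 8) :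
    (∀ᶠ z in residueFilter, φ z l ≠ 0) ∧
    Tendsto (fun z => z.1 * (fderiv ℂ (fun w => φ w l) z (1, 0) / φ z l)) residueFilter
      (𝓝 (if l = j then 1 else 0)) ∧
    Tendsto (fun z => z.2 * (fderiv ℂ (fun w => φ w l) z (0, 1) / φ z l)) residueFilter
      (𝓝 (if l = k then 1 else 0)) := by
  have han : AnalyticAt ℂ (fun w => φ w l) 0 :=
    ((ContinuousLinearMap.proj l : (Fin 9 → ℂ) →L[ℂ] ℂ).analyticAt _).comp h.analytic
  have hd : HasFDerivAt (fun w => φ w l) (fderiv ℂ (fun w => φ w l) 0) ((0 : ℂ), (0 : ℂ)) :=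
    han.differentiableAt.hasFDerivAt
  have hmem : ∀ᶠ z in residueFilter, z ∈ {z : ℂ × ℂ | z.1 ≠ 0 ∧ z.2 ≠ 0} :=
    eventually_mem_nhdsWithin
  by_cases hj : l = j
  · subst hj
    have hc : fderiv ℂ (fun w => φ w l) 0 (1, 0) ≠ 0 := by
      have h1 := hd.comp_hasDerivAt (f := fun a : ℂ => (a, (0 : ℂ))) (0 : ℂ)
        ((hasDerivAt_id (0 : ℂ)).prodMk (hasDerivAt_const (0 : ℂ) (0 : ℂ)))
      have := h.simple_fst
      rwa [show deriv (fun a : ℂ => φ (a, 0) l) 0 = _ from h1.deriv] at this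
    obtain ⟨h1, h2, h3⟩ := tendsto_log_deriv_of_vanish (s := ContinuousLinearMap.fst ℂ ℂ ℂ)
      (r := ContinuousLinearMap.snd ℂ ℂ ℂ) (u := (1, 0)) (w := (0, 1)) han (by simp) (by simp)
      (by
        filter_upwards [(continuous_snd.tendsto (0 : ℂ × ℂ)).eventually h.vanish_fst] with z hz
        have e : z - (ContinuousLinearMap.fst ℂ ℂ ℂ) z • ((1 : ℂ), (0 : ℂ)) = (0, z.2) := by
          ext <;> simp
        simpa only [e] using hz)
      (by filter_upwards [hmem] with z hz using hz.1) hc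
    exact ⟨h1, by simpa using h2, by simpa [hjk] using h3⟩
  by_cases hk : l = k
  · subst hk
    have hc : fderiv ℂ (fun w => φ w l) 0 (0, 1) ≠ 0 := by
      have h1 := hd.comp_hasDerivAt (f := fun a : ℂ => ((0 : ℂ), a)) (0 : ℂ)
        ((hasDerivAt_const (0 : ℂ) (0 : ℂ)).prodMk (hasDerivAt_id (0 : ℂ)))
      have := h.simple_snd
      rwa [show deriv (fun a : ℂ => φ (0, a) l) 0 = _ from h1.deriv] at this
    obtain ⟨h1, h2, h3⟩ := tendsto_log_deriv_of_vanish (s := ContinuousLinearMap.snd ℂ ℂ ℂ)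
      (r := ContinuousLinearMap.fst ℂ ℂ ℂ) (u := (0, 1)) (w := (1, 0)) han (by simp) (by simp)
      (by
        filter_upwards [(continuous_fst.tendsto (0 : ℂ × ℂ)).eventually h.vanish_snd] with z hz
        have e : z - (ContinuousLinearMap.snd ℂ ℂ ℂ) z • ((0 : ℂ), (1 : ℂ)) = (z.1, 0) := by
          ext <;> simp
        simpa only [e] using hz)
      (by filter_upwards [hmem] with z hz using hz.2) hc
    exact ⟨h1, by simpa [hj] using h3, by simpa using h2⟩
  · refine ⟨?_, ?_, ?_⟩
    · exact (han.continuousAt.eventually_ne (h0 l hl hj hk)).filter_mono nhdsWithin_le_nhds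
    · simpa [hj] using
        tendsto_log_deriv_of_ne_zero han (h0 l hl hj hk) (1, 0) (ContinuousLinearMap.fst ℂ ℂ ℂ)
    · simpa [hk] using
        tendsto_log_deriv_of_ne_zero han (h0 l hl hj hk) (0, 1) (ContinuousLinearMap.snd ℂ ℂ ℂ)

/-- The exponents of the coordinate `x₃` divided by the equation of `D_i`: the log-anticanonical
section that does not vanish at the intersection points of the boundary components. -/
def nodeSection : Bdry → Fin 9 → ℕ
  | .sing => ![0, 0, 0, 1, 0, 1, 1, 1, 0]
  | .line => ![0, 0, 0, 0, 0, 1, 1, 1, 0]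

theorem nrmC_mul (z w : ℂ) : nrmC (z * w) = nrmC z * nrmC w := by
  simp [nrmC, mul_pow]

theorem nrmC_eq_zero {z : ℂ} : nrmC z = 0 ↔ z = 0 := by simp [nrmC]

theorem continuous_nrmC : Continuous nrmC := by
  unfold nrmC
  fun_prop

/-- The product `xy` is, up to the factors defining the norm of `dx ∧ dy ⊗ 1_{D_i}`, the section
`nodeSection`. -/
theorem planeCoord_mul_mon (i : Bdry) {η : Fin 9 → ℂ} (h : ∀ l, l ≠ 8 → η l ≠ 0) :
    (planeCoord η).1 * (planeCoord η).2 * mon ![2, 3, 2, 1, 2, 1, 0, 0, 0] η =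
      (∏ j ∈ boundary i, η j) * mon (nodeSection i) η := by
  have h0 := h 0 (by decide)
  have h1 := h 1 (by decide)
  have h2 := h 2 (by decide)
  have h3 := h 3 (by decide)
  have h4 := h 4 (by decide)
  have h5 := h 5 (by decide)
  cases i <;> simp [planeCoord, mon, nodeSection, boundary, Fin.prod_univ_succ] <;> field_simp

theorem continuous_mon (e : Fin 9 → ℕ) : Continuous fun η : Fin 9 → ℂ => mon e η := by
  unfold mon
  fun_prop

theorem mon_eq_zero {e : Fin 9 → ℕ} {η : Fin 9 → ℂ} {l : Fin 9} (he : e l ≠ 0) (h : η l = 0) :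
    mon e η = 0 :=
  Finset.prod_eq_zero (Finset.mem_univ l) (by rw [h, zero_pow he])

theorem mon_ne_zero {e : Fin 9 → ℕ} {η : Fin 9 → ℂ} (h : ∀ l, e l ≠ 0 → η l ≠ 0) :
    mon e η ≠ 0 := by
  refine Finset.prod_ne_zero_iff.2 fun l _ => ?_
  by_cases hl : e l = 0
  · simp [hl]
  · exact pow_ne_zero _ (h l hl)

/-- The residue quotient is the norm of the logarithmic Jacobian determinant of `(a, b) ↦ (x, y)`
times the share of `nodeSection` in the maximum that defines the metric. -/
theorem residueQuotient_eq (i : Bdry) {φ : ℂ × ℂ → Fin 9 → ℂ} {z : ℂ × ℂ}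
    (hφ : DifferentiableAt ℂ φ z) (h : ∀ l, l ≠ 8 → φ z l ≠ 0) :
    residueQuotient i φ z =
      nrmC ((∑ l, expX l * (z.1 * (fderiv ℂ (fun w => φ w l) z (1, 0) / φ z l))) *
        (∑ l, expY l * (z.2 * (fderiv ℂ (fun w => φ w l) z (0, 1) / φ z l))) -
      (∑ l, expX l * (z.2 * (fderiv ℂ (fun w => φ w l) z (0, 1) / φ z l))) *
        (∑ l, expY l * (z.1 * (fderiv ℂ (fun w => φ w l) z (1, 0) / φ z l)))) *
      (nrmC (mon (nodeSection i) (φ z)) /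
        (logSections i).sup fun m => nrmC (mon m (φ z))) := by
  have hm : nrmC (mon ![2, 3, 2, 1, 2, 1, 0, 0, 0] (φ z)) ≠ 0 := by
    rw [Ne, nrmC_eq_zero]
    refine mon_ne_zero fun l hl => h l ?_
    rintro rfl
    simp at hl
  have hb : nrmC (∏ j ∈ boundary i, φ z j) ≠ 0 := by
    rw [Ne, nrmC_eq_zero]
    refine Finset.prod_ne_zero_iff.2 fun j hj => h j ?_
    rintro rfl
    revert hj
    cases i <;> decide
  have hxy := congrArg nrmC (planeCoord_mul_mon i h)
  rw [nrmC_mul, nrmC_mul _ (mon (nodeSection i) (φ z))] at hxy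
  have hlog : ∀ (e : Fin 9 → ℤ) (c : ℂ) (v : ℂ × ℂ),
      ∑ l, e l * (c * (fderiv ℂ (fun w => φ w l) z v / φ z l)) =
        c * ∑ l, e l * (fderiv ℂ (fun w => φ w l) z v / φ z l) := fun e c v => by
    rw [Finset.mul_sum]
    exact Finset.sum_congr rfl fun l _ => by ring
  simp only [hlog]
  rw [residueQuotient, logFormNorm, det_fderiv_planeCoord hφ h]
  set sX := ∑ l, expX l * (fderiv ℂ (fun w => φ w l) z (1, 0) / φ z l)
  set sY := ∑ l, expY l * (fderiv ℂ (fun w => φ w l) z (0, 1) / φ z l)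
  set tX := ∑ l, expX l * (fderiv ℂ (fun w => φ w l) z (0, 1) / φ z l)
  set tY := ∑ l, expY l * (fderiv ℂ (fun w => φ w l) z (1, 0) / φ z l)
  rw [show z.1 * sX * (z.2 * sY) - z.2 * tX * (z.1 * tY) = z.1 * z.2 * (sX * sY - tX * tY) by ring,
    nrmC_mul _ (sX * sY - tX * tY), nrmC_mul (z.1 * z.2) (sX * sY - tX * tY)]
  rw [eq_div_of_mul_eq hm hxy]
  by_cases hS : ((logSections i).sup fun m => nrmC (mon m (φ z))) = 0
  · simp [hS]
  field_simp

/-- A combinatorial criterion for mass one.  At the point the logarithmic Jacobian tends to the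
minor of the exponents of `x` and `y` at `η_j` and `η_k`, which has to be `±1`, and the maximum in
the metric is attained by `nodeSection` alone, as the other sections contain `η_j` or `η_k`. -/
theorem isPointMass_of_exponents (i : Bdry) (A : Finset (Fin 9)) (P : Surface ℂ)
    (hA : ∀ j k : Fin 9, j ≠ k → A = {j, k} →
      (∀ c ∈ maxMeeting, j ∈ c → k ∈ c → c = {j, k}) ∧
      (expX j * expY k - expX k * expY j).natAbs = 1 ∧
      (∀ l, nodeSection i l ≠ 0 → l ≠ j ∧ l ≠ k) ∧ nodeSection i ∈ logSections i ∧
      ∀ m ∈ logSections i, m ≠ nodeSection i → m j ≠ 0 ∨ m k ≠ 0) :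
    IsPointMass i A P 1 := by
  intro j k hjk hAjk φ hφ
  obtain ⟨hc, hdet, hns, hmem, hother⟩ := hA j k hjk hAjk
  have hj0 : φ 0 j = 0 := hφ.vanish_fst.self_of_nhds
  have hk0 : φ 0 k = 0 := hφ.vanish_snd.self_of_nhds
  have hne := ne_zero_of_mem_torsor hφ.center.1 hj0 hk0 hc
  have hld := hφ.tendsto_log_deriv hjk fun l _ => hne l
  have hsum : ∀ e : Fin 9 → ℤ, e 8 = 0 →
      Tendsto (fun z => ∑ l, (e l : ℂ) * (z.1 * (fderiv ℂ (fun w => φ w l) z (1, 0) / φ z l)))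
        residueFilter (𝓝 (e j)) ∧
      Tendsto (fun z => ∑ l, (e l : ℂ) * (z.2 * (fderiv ℂ (fun w => φ w l) z (0, 1) / φ z l)))
        residueFilter (𝓝 (e k)) := by
    intro e he
    constructor
    · have : (e j : ℂ) = ∑ l, (e l : ℂ) * if l = j then 1 else 0 := by simp
      rw [this]
      refine tendsto_finsetSum _ fun l _ => ?_
      by_cases hl : l = 8
      · subst hl
        simp [he]
      · exact (hld l hl).2.1.const_mul _
    · have : (e k : ℂ) = ∑ l, (e l : ℂ) * if l = k then 1 else 0 := by simp
      rw [this]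
      refine tendsto_finsetSum _ fun l _ => ?_
      by_cases hl : l = 8
      · subst hl
        simp [he]
      · exact (hld l hl).2.2.const_mul _
  obtain ⟨hX1, hX2⟩ := hsum expX (by simp [expX])
  obtain ⟨hY1, hY2⟩ := hsum expY (by simp [expY])
  have hcont : ContinuousAt φ 0 := hφ.analytic.continuousAt
  have hn0 : mon (nodeSection i) (φ 0) ≠ 0 :=
    mon_ne_zero fun l hl => hne l (hns l hl).1 (hns l hl).2
  have hsup0 : ((logSections i).sup fun m => nrmC (mon m (φ 0))) =
      nrmC (mon (nodeSection i) (φ 0)) := by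
    refine le_antisymm (Finset.sup_le fun m hm => ?_)
      (Finset.le_sup (f := fun m => nrmC (mon m (φ 0))) hmem)
    by_cases h : m = nodeSection i
    · rw [h]
    · have : mon m (φ 0) = 0 := by
        rcases hother m hm h with h | h
        · exact mon_eq_zero h hj0
        · exact mon_eq_zero h hk0
      simp [this, nrmC]
  have hsup : Tendsto (fun z => (logSections i).sup fun m => nrmC (mon m (φ z))) residueFilter
      (𝓝 (nrmC (mon (nodeSection i) (φ 0)))) := by
    rw [← hsup0]
    have : Continuous fun η : Fin 9 → ℂ => (logSections i).sup fun m => nrmC (mon m η) :=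
      Continuous.finset_sup_apply fun m _ => continuous_nrmC.comp (continuous_mon m)
    exact (this.continuousAt.comp hcont).tendsto.mono_left nhdsWithin_le_nhds
  have hnode : Tendsto (fun z => nrmC (mon (nodeSection i) (φ z))) residueFilter
      (𝓝 (nrmC (mon (nodeSection i) (φ 0)))) :=
    ((continuous_nrmC.comp (continuous_mon _)).continuousAt.comp hcont).tendsto.mono_left
      nhdsWithin_le_nhds
  have hlim := ((continuous_nrmC.tendsto _).comp ((hX1.mul hY2).sub (hX2.mul hY1))).mul
    (hnode.div hsup (by rwa [Ne, nrmC_eq_zero]))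
  have hone : nrmC ((expX j : ℂ) * expY k - expX k * expY j) = 1 := by
    rcases Int.natAbs_eq_iff.1 hdet with h | h
    · rw [show ((expX j : ℂ) * expY k - expX k * expY j) = ((1 : ℤ) : ℂ) by exact_mod_cast h]
      simp [nrmC]
    · rw [show ((expX j : ℂ) * expY k - expX k * expY j) = ((-1 : ℤ) : ℂ) by exact_mod_cast h]
      simp [nrmC]
  rw [hone, div_self (by rwa [Ne, nrmC_eq_zero]), one_mul] at hlim
  refine hlim.congr' ?_
  have hall : ∀ᶠ z in residueFilter, ∀ l : Fin 9, l ≠ 8 → φ z l ≠ 0 := by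
    refine eventually_all.2 fun l => ?_
    by_cases hl : l = 8
    · simp [hl]
    · filter_upwards [(hld l hl).1] with z hz _ using hz
  have hdiff : ∀ᶠ z in residueFilter, AnalyticAt ℂ φ z :=
    hφ.analytic.eventually_analyticAt.filter_mono nhdsWithin_le_nhds
  filter_upwards [hall, hdiff] with z h1 h2
  exact (residueQuotient_eq i h2.differentiableAt h1).symm

theorem isAdaptedChart₁₂ : IsAdaptedChart 0 1 node₁₂ chart₁₂ where
  analytic := by
    refine ContDiffAt.analyticAt (contDiffAt_pi.2 fun l => ?_)
    fin_cases l <;> simp [chart₁₂] <;> fun_prop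
  mem_torsor := by
    have : ContinuousAt (fun z : ℂ × ℂ => -1 - z.1) 0 := by fun_prop
    filter_upwards [this.eventually_ne (y := 0) (by simp)] with z hz using chart₁₂_mem_torsor hz
  center := represents_node₁₂
  vanish_fst := by simp [chart₁₂]
  vanish_snd := by simp [chart₁₂]
  simple_fst := by simp [chart₁₂]
  simple_snd := by simp [chart₁₂]

theorem isAdaptedChart₂₃ : IsAdaptedChart 1 2 node₂₃ chart₂₃ where
  analytic := by
    refine ContDiffAt.analyticAt (contDiffAt_pi.2 fun l => ?_)
    fin_cases l <;> simp [chart₂₃] <;> fun_prop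
  mem_torsor := by
    have : ContinuousAt (fun z : ℂ × ℂ => -1 - z.2) 0 := by fun_prop
    filter_upwards [this.eventually_ne (y := 0) (by simp)] with z hz using chart₂₃_mem_torsor hz
  center := represents_node₂₃
  vanish_fst := by simp [chart₂₃]
  vanish_snd := by simp [chart₂₃]
  simple_fst := by simp [chart₂₃]
  simple_snd := by simp [chart₂₃]

theorem isAdaptedChart₁₄ : IsAdaptedChart 0 3 node₁₄ chart₁₄ where
  analytic := by
    refine ContDiffAt.analyticAt (contDiffAt_pi.2 fun l => ?_)
    fin_cases l <;> simp [chart₁₄] <;> fun_prop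
  mem_torsor := by
    have : ContinuousAt (fun z : ℂ × ℂ => -1 - z.1 * z.2 ^ 2) 0 := by fun_prop
    filter_upwards [this.eventually_ne (y := 0) (by simp)] with z hz using chart₁₄_mem_torsor hz
  center := represents_node₁₄
  vanish_fst := by simp [chart₁₄]
  vanish_snd := by simp [chart₁₄]
  simple_fst := by simp [chart₁₄]
  simple_snd := by simp [chart₁₄]

/-- The chosen mass is the limit in any adapted chart, and is determined as soon as there is
one. -/
theorem pointMass_eq {i : Bdry} {j k : Fin 9} (hjk : j ≠ k) {P : Surface ℂ}
    {φ : ℂ × ℂ → Fin 9 → ℂ} (hφ : IsAdaptedChart j k P φ) {m : ℝ≥0}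
    (h : IsPointMass i {j, k} P m) : pointMass i {j, k} P = m := by
  have hex : ∃ m, IsPointMass i {j, k} P m := ⟨m, h⟩
  rw [pointMass, dif_pos hex]
  exact tendsto_nhds_unique (hex.choose_spec j k hjk rfl φ hφ) (h j k hjk rfl φ hφ)

theorem residueMeasure_stratum {i : Bdry} {j k : Fin 9} (hjk : j ≠ k) {P : Surface ℂ}
    (hs : stratum {j, k} = {P}) (hm : pointMass i {j, k} P = 1) :
    residueMeasure i {j, k} (stratum {j, k}) = ENNReal.ofReal (4 * Real.pi ^ 2) := by
  have hP : P ∈ stratum {j, k} := by simp [hs]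
  let : Unique (stratum {j, k}) := ⟨⟨⟨P, hP⟩⟩, fun x => Subtype.ext (hs.subset x.2)⟩
  rw [residueMeasure, Measure.smul_apply, Measure.sum_apply _ MeasurableSpace.measurableSet_top,
    tsum_fintype, Fintype.sum_unique, Finset.card_pair hjk]
  have h1 : ((default : stratum {j, k}) : Surface ℂ) = P := rfl
  rw [h1, hm]
  rw [ENNReal.coe_one, one_smul, Measure.dirac_apply' _ MeasurableSpace.measurableSet_top,
    Set.indicator_of_mem hP, Pi.one_apply, smul_eq_mul, mul_one, mul_pow]
  norm_num

theorem residueMeasure_maxFaces (i : Bdry) (A : Finset (Fin 9)) (hA : A ∈ maxFaces i) :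
    residueMeasure i A (stratum A) = ENNReal.ofReal (4 * Real.pi ^ 2) := by
  have h : A = {0, 1} ∨ A = {1, 2} ∨ (i = .line ∧ A = {0, 3}) := by
    cases i
    · rw [maxFaces_sing] at hA
      simp only [Finset.mem_insert, Finset.mem_singleton] at hA
      tauto
    · rw [maxFaces_line] at hA
      simp only [Finset.mem_insert, Finset.mem_singleton] at hA
      tauto
  rcases h with rfl | rfl | ⟨rfl, rfl⟩
  · refine residueMeasure_stratum (by decide) stratum₁₂
      (pointMass_eq (by decide) isAdaptedChart₁₂ (isPointMass_of_exponents i _ _ ?_))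
    cases i <;> decide +kernel
  · refine residueMeasure_stratum (by decide) stratum₂₃
      (pointMass_eq (by decide) isAdaptedChart₂₃ (isPointMass_of_exponents i _ _ ?_))
    cases i <;> decide +kernel
  · refine residueMeasure_stratum (by decide) stratum₁₄
      (pointMass_eq (by decide) isAdaptedChart₁₄ (isPointMass_of_exponents _ _ _ ?_))
    decide +kernel

/-! ### Picard groups and the constants `α` -/

theorem isEffective_curveClass (j : Fin 9) : IsEffective (curveClass j) := by
  refine ⟨MvPolynomial.X j, MvPolynomial.isWeightedHomogeneous_X _ _ _, fun hmem => ?_⟩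
  -- a zero of the relation without vanishing coordinates
  let η : Fin 9 → ℂ := ![1, 1, 1, 1, 1, 1, 1, 1, -2]
  rw [Ideal.mem_span_singleton] at hmem
  have h := map_dvd (MvPolynomial.eval η) hmem
  have h0 : MvPolynomial.eval η (coxRel MvPolynomial.X) = 0 := by
    simp [coxRel, η]
    norm_num
  rw [h0, zero_dvd_iff, MvPolynomial.eval_X] at h
  revert h
  fin_cases j <;> simp [η]

/-- The effective cone is generated by the classes of the nine curves. -/
theorem mem_dualEffCone_iff (J : Finset (Fin 9)) (x : PicOpen J →ₗ[ℤ] ℝ) :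
    x ∈ dualEffCone J ↔ ∀ j, 0 ≤ x (restrict J (curveClass j)) := by
  refine ⟨fun h j => h _ (isEffective_curveClass j), fun h c hc => ?_⟩
  obtain ⟨f, hf, hmem⟩ := hc
  have hf0 : f ≠ 0 := fun h0 => hmem (h0 ▸ Submodule.zero_mem _)
  obtain ⟨d, hd⟩ := MvPolynomial.ne_zero_iff.1 hf0
  have hw : Finsupp.weight curveClass d = c := hf hd
  have hc : restrict J c = ∑ j, d j • restrict J (curveClass j) := by
    rw [← hw, Finsupp.weight_apply, Finsupp.sum_fintype _ _ (by simp)]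
    exact map_sum (Submodule.mkQ _) _ _ |>.trans
      (Finset.sum_congr rfl fun j _ => map_nsmul (Submodule.mkQ _) _ _)
  rw [hc, map_sum]
  refine Finset.sum_nonneg fun j _ => ?_
  rw [map_nsmul]
  exact nsmul_nonneg (h j) _

/-- Two bases with the same first element give the same volume on the hyperplane: the change of
the remaining coordinates is an integral affine map whose linear part has determinant `±1`. -/
theorem volume_image_basis_eq {M : Type*} [AddCommGroup M] {n : ℕ}
    (b b' : Module.Basis (Fin (n + 1)) ℤ M) (hb : b 0 = b' 0) (X : Set (M →ₗ[ℤ] ℝ))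
    (hX : ∀ x ∈ X, x (b 0) = 1) :
    volume ((fun (x : M →ₗ[ℤ] ℝ) (k : Fin n) => x (b' k.succ)) '' X) =
      volume ((fun (x : M →ₗ[ℤ] ℝ) (k : Fin n) => x (b k.succ)) '' X) := by
  set P : Matrix (Fin (n + 1)) (Fin (n + 1)) ℤ := b.toMatrix b' with hP
  have hexp : ∀ j, b' j = ∑ i, P i j • b i := fun j => (b.sum_toMatrix_smul_self b' j).symm
  have hcol : ∀ i, P i 0 = if i = 0 then 1 else 0 := fun i => by
    rw [hP, Module.Basis.toMatrix_apply, ← hb, Module.Basis.repr_self, Finsupp.single_apply]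
    simp [eq_comm]
  set Q : Matrix (Fin n) (Fin n) ℤ := P.submatrix Fin.succ Fin.succ with hQ
  have hdet : |((Q.map (Int.cast : ℤ → ℝ)).transpose).det| = 1 := by
    have h1 : IsUnit P.det := by
      have := b.isUnit_det b'
      rwa [Module.Basis.det_apply] at this
    have h2 : P.det = Q.det := by
      rw [Matrix.det_succ_column_zero, Fin.sum_univ_succ]
      simp [hcol, hQ, Fin.succAbove_zero]
    rw [h2, Int.isUnit_iff_abs_eq] at h1
    have h3 : (Q.map (Int.cast : ℤ → ℝ)).det = (Q.det : ℝ) :=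
      (RingHom.map_det (Int.castRingHom ℝ) Q).symm
    rw [Matrix.det_transpose, h3]
    exact_mod_cast h1
  set A : (Fin n → ℝ) →ₗ[ℝ] (Fin n → ℝ) :=
    Matrix.toLin' (Q.map (Int.cast : ℤ → ℝ)).transpose with hA
  set c : Fin n → ℝ := fun k => P 0 k.succ with hc
  have himg : (fun (x : M →ₗ[ℤ] ℝ) (k : Fin n) => x (b' k.succ)) '' X =
      (fun y => y + c) '' (A '' ((fun (x : M →ₗ[ℤ] ℝ) (k : Fin n) => x (b k.succ)) '' X)) := by
    rw [Set.image_image, Set.image_image]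
    refine Set.image_congr fun x hx => ?_
    ext k
    have : x (b' k.succ) = ∑ i, (P i k.succ : ℝ) * x (b i) := by
      rw [hexp, map_sum]
      exact Finset.sum_congr rfl fun i _ => by rw [map_zsmul, zsmul_eq_mul]
    rw [this, Fin.sum_univ_succ, hX x hx]
    simp [hA, hc, hQ, Matrix.mulVec, dotProduct, add_comm]
  rw [himg, Set.image_add_right, measure_preimage_add_right, Measure.addHaar_image_linearMap, hA,
    LinearMap.det_toLin', hdet]
  simp

theorem hyperplaneVolume_eq {M : Type*} [AddCommGroup M] {L : M} {n : ℕ}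
    (b : Module.Basis (Fin (n + 1)) ℤ M) (hb : b 0 = L) (X : Set (M →ₗ[ℤ] ℝ))
    (hX : ∀ x ∈ X, x L = 1) :
    hyperplaneVolume L X = volume ((fun (x : M →ₗ[ℤ] ℝ) (k : Fin n) => x (b k.succ)) '' X) := by
  have key : ∀ (m : ℕ) (b' : Module.Basis (Fin (m + 1)) ℤ M), b' 0 = L →
      volume ((fun (x : M →ₗ[ℤ] ℝ) (k : Fin m) => x (b' k.succ)) '' X) =
        volume ((fun (x : M →ₗ[ℤ] ℝ) (k : Fin n) => x (b k.succ)) '' X) := by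
    intro m b' hb'
    have hmn : m = n := by
      have h1 := Module.finrank_eq_card_basis b
      have h2 := Module.finrank_eq_card_basis b'
      simp only [Fintype.card_fin] at h1 h2
      omega
    subst hmn
    exact volume_image_basis_eq b b' (hb.trans hb'.symm) X (by rwa [hb])
  have h : ∃ n : ℕ, ∃ b : Module.Basis (Fin (n + 1)) ℤ M, b 0 = L := ⟨n, b, hb⟩
  rw [hyperplaneVolume, dif_pos h]
  exact key _ _ h.choose_spec.choose_spec

/-- Coordinates on `Pic` of the complement of the curves in `J`: the rows of `F` are coordinate
functions that vanish on the classes of these curves, the columns of `G` are classes that lift the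
dual basis, and `H` writes the remaining part of a class as a combination of the `[E_j]`,
`j ∈ J`. -/
structure IsPicCoord (J : Finset (Fin 9)) {n : ℕ} (F : Matrix (Fin n) (Fin 6) ℤ)
    (G : Matrix (Fin 6) (Fin n) ℤ) (H : Matrix (Fin 9) (Fin 6) ℤ) : Prop where
  mul_eq_one : F * G = 1
  decomp : G * F + (Matrix.of curveClass).transpose * H = 1
  support : ∀ j, j ∉ J → ∀ k, H j k = 0
  vanish : ∀ j ∈ J, F.mulVec (curveClass j) = 0

section PicCoord

variable {J : Finset (Fin 9)} {n : ℕ} {F : Matrix (Fin n) (Fin 6) ℤ}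
  {G : Matrix (Fin 6) (Fin n) ℤ} {H : Matrix (Fin 9) (Fin 6) ℤ}

theorem IsPicCoord.ker_eq (h : IsPicCoord J F G H) :
    F.mulVecLin.ker = Submodule.span ℤ (curveClass '' (J : Set (Fin 9))) := by
  apply le_antisymm
  · intro v hv
    have hv' : F.mulVec v = 0 := hv
    have h1 : v = ∑ j, (H.mulVec v) j • curveClass j := by
      have h2 : (G * F + (Matrix.of curveClass).transpose * H).mulVec v = v := by
        rw [h.decomp, Matrix.one_mulVec]
      rw [Matrix.add_mulVec, ← Matrix.mulVec_mulVec, hv', Matrix.mulVec_zero, zero_add,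
        ← Matrix.mulVec_mulVec] at h2
      generalize H.mulVec v = w at h2 ⊢
      rw [← h2]
      ext k
      simp [Matrix.mulVec, dotProduct, mul_comm]
    rw [h1]
    refine Submodule.sum_mem _ fun j _ => ?_
    by_cases hj : j ∈ J
    · exact Submodule.smul_mem _ _ (Submodule.subset_span ⟨j, hj, rfl⟩)
    · have : H.mulVec v j = 0 := by simp [Matrix.mulVec, dotProduct, h.support j hj]
      rw [this, zero_smul]
      exact Submodule.zero_mem _
  · rw [Submodule.span_le]
    rintro _ ⟨j, hj, rfl⟩
    exact h.vanish j hj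

/-- The basis of the Picard group of the complement belonging to such coordinates. -/
def IsPicCoord.basis (h : IsPicCoord J F G H) : Module.Basis (Fin n) ℤ (PicOpen J) :=
  Module.Basis.ofEquivFun ((Submodule.quotEquivOfEq _ _ h.ker_eq.symm).trans
    (F.mulVecLin.quotKerEquivOfSurjective fun w =>
      ⟨G.mulVec w, by simp [Matrix.mulVec_mulVec, h.mul_eq_one]⟩))

theorem IsPicCoord.repr_restrict (h : IsPicCoord J F G H) (c : PicS) :
    ⇑(h.basis.repr (restrict J c)) = F.mulVec c := by
  ext k
  simp [IsPicCoord.basis, restrict]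
  rfl

theorem IsPicCoord.apply_restrict (h : IsPicCoord J F G H) (x : PicOpen J →ₗ[ℤ] ℝ) (c : PicS) :
    x (restrict J c) = ∑ k, (F.mulVec c k : ℝ) * x (h.basis k) := by
  conv_lhs => rw [← h.basis.sum_repr (restrict J c), map_sum]
  refine Finset.sum_congr rfl fun k _ => ?_
  rw [map_zsmul, zsmul_eq_mul, h.repr_restrict]

theorem IsPicCoord.finrank_eq (h : IsPicCoord J F G H) : Module.finrank ℤ (PicOpen J) = n := by
  simp [Module.finrank_eq_card_basis h.basis]

end PicCoord

/-- In coordinates in which the log-anticanonical class is the first unit vector, `α_{i,A}` is the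
volume of the polytope with one inequality for each of the nine curves. -/
theorem alpha_eq (i : Bdry) (A : Finset (Fin 9)) {n : ℕ} {F : Matrix (Fin (n + 1)) (Fin 6) ℤ}
    {G : Matrix (Fin 6) (Fin (n + 1)) ℤ} {H : Matrix (Fin 9) (Fin 6) ℤ}
    (h : IsPicCoord (boundary i \ A) F G H)
    (hL : F.mulVec (logAnticanonical i) = Pi.single 0 1) :
    alpha i A = volume.real {t : Fin n → ℝ | ∀ j, 0 ≤ (F.mulVec (curveClass j) 0 : ℝ) +
      ∑ k : Fin n, (F.mulVec (curveClass j) k.succ : ℝ) * t k} := by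
  have hb : h.basis 0 = restrict (boundary i \ A) (logAnticanonical i) := by
    apply h.basis.repr.injective
    apply DFunLike.coe_injective
    rw [h.repr_restrict, hL, Module.Basis.repr_self, Finsupp.single_eq_pi_single]
  rw [alpha]
  have hset : {x | x ∈ dualEffCone (boundary i \ A) ∧
      x (restrict (boundary i \ A) (logAnticanonical i)) = 1} =
      {x : PicOpen (boundary i \ A) →ₗ[ℤ] ℝ | (∀ j, 0 ≤ (F.mulVec (curveClass j) 0 : ℝ) +
        ∑ k : Fin n, (F.mulVec (curveClass j) k.succ : ℝ) * x (h.basis k.succ)) ∧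
        x (h.basis 0) = 1} := by
    ext x
    simp only [Set.mem_ofPred_eq, ← hb]
    refine and_congr_left fun hx => ?_
    rw [mem_dualEffCone_iff]
    refine forall_congr' fun j => ?_
    rw [h.apply_restrict, Fin.sum_univ_succ, hx, mul_one]
  have key := hyperplaneVolume_eq h.basis hb {x | x ∈ dualEffCone (boundary i \ A) ∧
      x (restrict (boundary i \ A) (logAnticanonical i)) = 1} (fun x hx => hx.2)
  rw [Measure.real]
  refine congrArg ENNReal.toReal ?_
  -- `alpha` forms `boundary i \ A` with a classical decidability instance
  convert key using 2
  rw [hset]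
  ext t
  constructor
  · intro ht
    refine ⟨h.basis.constr ℤ (Fin.cons 1 t), ⟨?_, ?_⟩, ?_⟩
    · simpa [Module.Basis.constr_basis] using ht
    · simp
    · ext k
      simp
  · rintro ⟨x, ⟨hx, -⟩, rfl⟩
    exact hx

theorem rankPic_sing : rankPic .sing = 3 := by
  refine IsPicCoord.finrank_eq (F := !![1, 1, 0, 0, 1, 0; 1, 0, 0, 1, 0, 0; 1, 0, 1, 0, 0, 1])
    (G := !![0, 0, 0; 0, 0, 0; 0, 0, 0; 0, 1, 0; 1, 0, 0; 0, 0, 1])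
    (H := Pi.single 0 ![1, 1, 0, 0, 0, 0] + Pi.single 1 ![1, 0, 0, 0, 0, 0] +
      Pi.single 2 ![1, 0, 1, 0, 0, 0])
    ⟨by decide, by decide, by decide, by decide⟩

theorem rankPic_line : rankPic .line = 2 := by
  refine IsPicCoord.finrank_eq (F := !![1, 0, 0, 1, 0, 0; 1, 0, 1, 0, 0, 1])
    (G := !![0, 0; 0, 0; 0, 0; 1, 0; 0, 0; 0, 1])
    (H := Pi.single 0 ![1, 1, 0, 0, 0, 0] + Pi.single 1 ![1, 0, 0, 0, 0, 0] +
      Pi.single 2 ![1, 0, 1, 0, 0, 0] + Pi.single 3 ![1, 1, 0, 0, 1, 0])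
    ⟨by decide, by decide, by decide, by decide⟩

/-- Here and below, the basis of the Picard group consists of the log-anticanonical class, followed
by the classes of `E₄, E₅, E₆, E₈` for the first type of boundary and of `E₅, E₆, E₈` for the
second. -/
theorem isPicCoord_sing₁₂ : IsPicCoord (boundary .sing \ {0, 1})
    !![0, -1, 0, 0, 0, 0; 0, 0, 0, 0, 1, 0; 0, 0, 0, 1, 0, 0; 2, 3, 1, 0, 0, 1; 1, 2, 0, 0, 0, 0]
    !![2, 0, 0, 0, 1; -1, 0, 0, 0, 0; -1, 0, 0, 0, -1; 0, 0, 1, 0, 0; 0, 1, 0, 0, 0;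
      0, 0, 0, 1, -1]
    (Pi.single 2 ![1, 1, 1, 0, 0, 0]) :=
  ⟨by decide, by decide, by decide, by decide⟩

theorem isPicCoord_sing₂₃ : IsPicCoord (boundary .sing \ {1, 2})
    !![1, 0, 1, 0, 0, 0; 1, 1, 1, 0, 1, 0; 0, 0, 0, 1, 0, 0; -1, 0, -2, 0, 0, 1;
      -1, 0, -2, 0, 0, 0]
    !![2, 0, 0, 0, 1; -1, 0, 0, 0, 0; -1, 0, 0, 0, -1; 0, 0, 1, 0, 0; 0, 1, 0, 0, 0;
      0, 0, 0, 1, -1]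
    (Pi.single 0 ![1, 1, 1, 0, 0, 0]) :=
  ⟨by decide, by decide, by decide, by decide⟩

theorem isPicCoord_line₁₂ : IsPicCoord (boundary .line \ {0, 1})
    !![0, -1, 0, 0, 0, 0; 0, 0, 0, 1, 0, 0; 2, 3, 1, 0, 0, 1; 1, 2, 0, 0, 0, 0]
    !![2, 0, 0, 1; -1, 0, 0, 0; -1, 0, 0, -1; 0, 1, 0, 0; -1, 0, 0, 0; 0, 0, 1, -1]
    (Pi.single 2 ![1, 1, 1, 0, 0, 0] + Pi.single 3 ![0, -1, 0, 0, 1, 0]) :=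
  ⟨by decide, by decide, by decide, by decide⟩

theorem isPicCoord_line₂₃ : IsPicCoord (boundary .line \ {1, 2})
    !![1, 0, 1, 0, 0, 0; 0, 0, 0, 1, 0, 0; -1, 0, -2, 0, 0, 1; -1, 0, -2, 0, 0, 0]
    !![2, 0, 0, 1; -1, 0, 0, 0; -1, 0, 0, -1; 0, 1, 0, 0; -1, 0, 0, 0; 0, 0, 1, -1]
    (Pi.single 0 ![1, 1, 1, 0, 0, 0] + Pi.single 3 ![2, 1, 2, 0, 1, 0]) :=
  ⟨by decide, by decide, by decide, by decide⟩

theorem isPicCoord_line₁₄ : IsPicCoord (boundary .line \ {0, 3})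
    !![0, 0, 0, 0, -1, 0; 0, -1, 0, 1, 1, 0; 2, 1, 1, 0, 2, 1; 1, 1, 0, 0, 1, 0]
    !![2, 0, 0, 1; -1, 0, 0, 0; -1, 0, 0, -1; 0, 1, 0, 0; -1, 0, 0, 0; 0, 0, 1, -1]
    (Pi.single 1 ![0, -1, 0, 0, 1, 0] + Pi.single 2 ![1, 0, 1, 0, 1, 0]) :=
  ⟨by decide, by decide, by decide, by decide⟩

theorem alpha_sing₁₂ : alpha .sing {0, 1} = volume.real {t : Fin 4 → ℝ | (∀ k, 0 ≤ t k) ∧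
      1 ≤ -t 0 + 3 * t 2 + 2 * t 3 ∧ t 1 + 2 * t 2 + t 3 ≤ 1 ∧ t 0 + t 2 + t 3 ≤ 1} := by
  rw [alpha_eq _ _ isPicCoord_sing₁₂ (by decide)]
  congr 1
  ext t
  simp [Fin.forall_fin_succ, Fin.sum_univ_succ, Matrix.mulVec, dotProduct, curveClass]
  constructor
  · rintro ⟨h1, h2, h3, h4, h5, h6, h7, h8⟩
    and_intros <;> linarith
  · rintro ⟨⟨h1, h2, h3, h4⟩, h5, h6, h7⟩
    and_intros <;> linarith

theorem alpha_sing₂₃ : alpha .sing {1, 2} = volume.real {t : Fin 4 → ℝ | (∀ k, 0 ≤ t k) ∧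
      0 ≤ -t 0 - t 1 + t 2 + t 3 ∧ -t 0 + 3 * t 2 + 2 * t 3 ≤ 1 ∧ t 0 + t 2 + t 3 ≤ 1} := by
  rw [alpha_eq _ _ isPicCoord_sing₂₃ (by decide)]
  congr 1
  ext t
  simp [Fin.forall_fin_succ, Fin.sum_univ_succ, Matrix.mulVec, dotProduct, curveClass]
  constructor
  · rintro ⟨h1, h2, h3, h4, h5, h6, h7, h8⟩
    and_intros <;> linarith
  · rintro ⟨⟨h1, h2, h3, h4⟩, h5, h6, h7⟩
    and_intros <;> linarith

theorem alpha_line₁₂ : alpha .line {0, 1} = volume.real {t : Fin 3 → ℝ | (∀ k, 0 ≤ t k) ∧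
      1 ≤ 3 * t 1 + 2 * t 2 ∧ t 0 + 2 * t 1 + t 2 ≤ 1 ∧ t 1 + t 2 ≤ 1} := by
  rw [alpha_eq _ _ isPicCoord_line₁₂ (by decide)]
  congr 1
  ext t
  simp [Fin.forall_fin_succ, Fin.sum_univ_succ, Matrix.mulVec, dotProduct, curveClass]
  constructor
  · rintro ⟨h1, h2, h3, h4, h5, h6, h7⟩
    and_intros <;> linarith
  · rintro ⟨⟨h1, h2, h3⟩, h5, h6, h7⟩
    and_intros <;> linarith

theorem alpha_line₂₃ : alpha .line {1, 2} = volume.real {t : Fin 3 → ℝ | (∀ k, 0 ≤ t k) ∧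
      3 * t 1 + 2 * t 2 ≤ 1 ∧ 0 ≤ -t 0 + t 1 + t 2 ∧ t 1 + t 2 ≤ 1} := by
  rw [alpha_eq _ _ isPicCoord_line₂₃ (by decide)]
  congr 1
  ext t
  simp [Fin.forall_fin_succ, Fin.sum_univ_succ, Matrix.mulVec, dotProduct, curveClass]
  constructor
  · rintro ⟨h1, h2, h3, h4, h5, h6, h7⟩
    and_intros <;> linarith
  · rintro ⟨⟨h1, h2, h3⟩, h5, h6, h7⟩
    and_intros <;> linarith

theorem alpha_line₁₄ : alpha .line {0, 3} = volume.real {t : Fin 3 → ℝ | (∀ k, 0 ≤ t k) ∧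
      2 * t 0 + t 1 ≤ 1 ∧ 1 ≤ t 0 + 2 * t 1 + t 2 ∧ t 1 + t 2 ≤ 1} := by
  rw [alpha_eq _ _ isPicCoord_line₁₄ (by decide)]
  congr 1
  ext t
  simp [Fin.forall_fin_succ, Fin.sum_univ_succ, Matrix.mulVec, dotProduct, curveClass]
  constructor
  · rintro ⟨h1, h2, h3, h4, h5, h6, h7⟩
    and_intros <;> linarith
  · rintro ⟨⟨h1, h2, h3⟩, h5, h6, h7⟩
    and_intros <;> linarith

/-! ### Volumes of polytopes -/

/-- The volume of the standard simplex of size `s`, by slicing. -/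
theorem volume_corner (n : ℕ) (s : ℝ) (hs : 0 ≤ s) :
    volume {t : Fin n → ℝ | (∀ k, 0 ≤ t k) ∧ ∑ k, t k ≤ s} =
      ENNReal.ofReal (s ^ n / n.factorial) := by
  induction n generalizing s with
  | zero =>
    have : {t : Fin 0 → ℝ | (∀ k, 0 ≤ t k) ∧ ∑ k, t k ≤ s} = Set.univ := by
      ext; simp [hs]
    rw [this, volume_pi, Measure.pi_of_empty (fun _ => volume) 0]
    simp
  | succ n ih =>
    set S : Set (ℝ × (Fin n → ℝ)) :=
      {p | 0 ≤ p.1 ∧ (∀ k, 0 ≤ p.2 k) ∧ p.1 + ∑ k, p.2 k ≤ s} with hS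
    have hmeas : MeasurableSet S := by
      refine IsClosed.measurableSet ?_
      have h1 : IsClosed {p : ℝ × (Fin n → ℝ) | 0 ≤ p.1} :=
        isClosed_le continuous_const continuous_fst
      have h2 : IsClosed {p : ℝ × (Fin n → ℝ) | ∀ k, 0 ≤ p.2 k} := by
        simp only [Set.ofPred_forall]
        exact isClosed_iInter fun k => isClosed_le continuous_const (by fun_prop)
      have h3 : IsClosed {p : ℝ × (Fin n → ℝ) | p.1 + ∑ k, p.2 k ≤ s} :=
        isClosed_le (by fun_prop) continuous_const
      exact h1.inter (h2.inter h3)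
    have hpre : {t : Fin (n + 1) → ℝ | (∀ k, 0 ≤ t k) ∧ ∑ k, t k ≤ s} =
        MeasurableEquiv.piFinSuccAbove (fun _ => ℝ) 0 ⁻¹' S := by
      ext t
      simp [hS, Fin.forall_fin_succ, Fin.sum_univ_succ, MeasurableEquiv.piFinSuccAbove,
        Fin.insertNthEquiv, Fin.tail, and_assoc]
    rw [hpre, (volume_preserving_piFinSuccAbove (fun _ => ℝ) 0).measure_preimage
      hmeas.nullMeasurableSet, Measure.volume_eq_prod, Measure.prod_apply hmeas]
    have hsec : ∀ x : ℝ, volume (Prod.mk x ⁻¹' S) =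
        (Set.Icc 0 s).indicator (fun x => ENNReal.ofReal ((s - x) ^ n / n.factorial)) x := by
      intro x
      by_cases hx : x ∈ Set.Icc 0 s
      · rw [Set.indicator_of_mem hx, ← ih (s - x) (by linarith [hx.2])]
        congr 1
        ext t
        simp [hS, hx.1, le_sub_iff_add_le']
      · rw [Set.indicator_of_notMem hx]
        have : Prod.mk x ⁻¹' S = ∅ := by
          ext t
          simp only [hS, Set.mem_preimage, Set.mem_ofPred_eq, Set.mem_empty_iff_false, iff_false]
          rintro ⟨h1, h2, h3⟩
          exact hx ⟨h1, by linarith [Finset.sum_nonneg fun k (_ : k ∈ Finset.univ) => h2 k]⟩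
        rw [this, measure_empty]
    simp only [hsec]
    rw [lintegral_indicator measurableSet_Icc, ← ofReal_integral_eq_lintegral_ofReal]
    · congr 1
      rw [integral_Icc_eq_integral_Ioc, ← intervalIntegral.integral_of_le hs,
        intervalIntegral.integral_div, intervalIntegral.integral_comp_sub_left (fun x => x ^ n),
        integral_pow]
      simp [Nat.factorial_succ]
      field_simp
    · have hc : Continuous fun x : ℝ => (s - x) ^ n / n.factorial := by fun_prop
      exact hc.continuousOn.integrableOn_Icc
    · refine (ae_restrict_iff' measurableSet_Icc).2 (Eventually.of_forall fun x hx => ?_)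
      have : 0 ≤ s - x := by linarith [hx.2]
      positivity

/-- The simplex cut out by `n` linearly independent forms and the condition that their sum is at
most one. -/
theorem volume_simplex {n : ℕ} (A : Matrix (Fin n) (Fin n) ℝ) (hA : A.det ≠ 0) :
    volume {t : Fin n → ℝ | (∀ k, 0 ≤ A.mulVec t k) ∧ ∑ k, A.mulVec t k ≤ 1} =
      ENNReal.ofReal (|A.det|⁻¹ / n.factorial) := by
  have h := Measure.addHaar_preimage_linearMap (volume : Measure (Fin n → ℝ))
    (f := Matrix.toLin' A) (by rwa [LinearMap.det_toLin'])
    {t : Fin n → ℝ | (∀ k, 0 ≤ t k) ∧ ∑ k, t k ≤ 1}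
  rw [volume_corner n 1 zero_le_one, LinearMap.det_toLin', ← ENNReal.ofReal_mul (abs_nonneg _)]
    at h
  refine Eq.trans ?_ (h.trans ?_)
  · congr 1
  · rw [abs_inv, one_pow, mul_one_div]

theorem volume_hyperplane {n : ℕ} {a : Fin n → ℝ} (ha : a ≠ 0) (c : ℝ) :
    volume {t : Fin n → ℝ | a ⬝ᵥ t = c} = 0 := by
  rcases Set.eq_empty_or_nonempty {t : Fin n → ℝ | a ⬝ᵥ t = c} with h | ⟨t₀, ht₀⟩
  · rw [h, measure_empty]
  · have h1 : {t : Fin n → ℝ | a ⬝ᵥ t = c} =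
        (fun t => t + -t₀) ⁻¹' ((dotProductBilin ℝ ℝ a).ker : Set (Fin n → ℝ)) := by
      ext t
      have ht : a ⬝ᵥ t₀ = c := ht₀
      simp [← ht, ← sub_eq_add_neg, sub_eq_zero]
    rw [h1, measure_preimage_add_right]
    refine Measure.addHaar_submodule _ _ fun htop => ha ?_
    rw [LinearMap.ker_eq_top] at htop
    have : a ⬝ᵥ a = 0 := by simpa using LinearMap.congr_fun htop a
    exact dotProduct_self_eq_zero.1 this

/-- A hyperplane cuts the volume of a set into two. -/
theorem volume_split {n : ℕ} {a : Fin n → ℝ} (ha : a ≠ 0) (c : ℝ) (S : Set (Fin n → ℝ)) :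
    volume S = volume {t | t ∈ S ∧ c ≤ a ⬝ᵥ t} + volume {t | t ∈ S ∧ a ⬝ᵥ t ≤ c} := by
  have hm : MeasurableSet {t : Fin n → ℝ | c ≤ a ⬝ᵥ t} :=
    (isClosed_le continuous_const (by fun_prop)).measurableSet
  rw [← measure_inter_add_sdiff S hm]
  congr 1
  refine measure_congr ?_
  have h0 : ∀ᵐ t ∂(volume : Measure (Fin n → ℝ)), a ⬝ᵥ t ≠ c := by
    rw [ae_iff]
    simpa using volume_hyperplane ha c
  filter_upwards [h0] with t ht
  apply propext
  show (t ∈ S ∧ ¬ c ≤ a ⬝ᵥ t) ↔ (t ∈ S ∧ a ⬝ᵥ t ≤ c)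
  rw [not_le]
  exact and_congr_right fun _ => ⟨le_of_lt, fun h => lt_of_le_of_ne h ht⟩

/-- The planes `t₈ = 2 t₅` and `t₈ = t₅` cut the polytope into three simplices with a vertex at the
origin; the rows of each matrix are the forms that are `1` at one of the other vertices and vanish
on the opposite facet. -/
theorem volume_line_polytope : volume {t : Fin 3 → ℝ | (∀ k, 0 ≤ t k) ∧
    t 1 + t 2 ≤ 1 ∧ t 0 - t 1 - t 2 ≤ 0 ∧ 2 * t 0 + t 1 ≤ 1} = ENNReal.ofReal (11 / 72) := by
  have e1 : {t : Fin 3 → ℝ | t ∈ {t : Fin 3 → ℝ | (∀ k, 0 ≤ t k) ∧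
      t 1 + t 2 ≤ 1 ∧ t 0 - t 1 - t 2 ≤ 0 ∧ 2 * t 0 + t 1 ≤ 1} ∧ 0 ≤ ![-2, 0, 1] ⬝ᵥ t} =
      {t | (∀ k, 0 ≤ (!![2, 0, 0; 0, 1, 0; -2, 0, 1] : Matrix _ _ ℝ).mulVec t k) ∧
        ∑ k, (!![2, 0, 0; 0, 1, 0; -2, 0, 1] : Matrix _ _ ℝ).mulVec t k ≤ 1} := by
    ext t
    simp [Fin.forall_fin_succ, Fin.sum_univ_succ, Matrix.mulVec, dotProduct]
    constructor
    · rintro ⟨⟨⟨h1, h2, h3⟩, h4, h5, h6⟩, h7⟩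
      and_intros <;> linarith
    · rintro ⟨⟨h1, h2, h3⟩, h4⟩
      and_intros <;> linarith
  have e2 : {t : Fin 3 → ℝ | t ∈ {t : Fin 3 → ℝ | t ∈ {t : Fin 3 → ℝ | (∀ k, 0 ≤ t k) ∧
      t 1 + t 2 ≤ 1 ∧ t 0 - t 1 - t 2 ≤ 0 ∧ 2 * t 0 + t 1 ≤ 1} ∧ ![-2, 0, 1] ⬝ᵥ t ≤ 0} ∧
        0 ≤ ![-1, 0, 1] ⬝ᵥ t} =
      {t | (∀ k, 0 ≤ (!![-2, 0, 2; 4, 0, -2; 0, 1, 0] : Matrix _ _ ℝ).mulVec t k) ∧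
        ∑ k, (!![-2, 0, 2; 4, 0, -2; 0, 1, 0] : Matrix _ _ ℝ).mulVec t k ≤ 1} := by
    ext t
    simp [Fin.forall_fin_succ, Fin.sum_univ_succ, Matrix.mulVec, dotProduct]
    constructor
    · rintro ⟨⟨⟨⟨h1, h2, h3⟩, h4, h5, h6⟩, h7⟩, h8⟩
      and_intros <;> linarith
    · rintro ⟨⟨h1, h2, h3⟩, h4⟩
      and_intros <;> linarith
  have e3 : {t : Fin 3 → ℝ | t ∈ {t : Fin 3 → ℝ | t ∈ {t : Fin 3 → ℝ | (∀ k, 0 ≤ t k) ∧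
      t 1 + t 2 ≤ 1 ∧ t 0 - t 1 - t 2 ≤ 0 ∧ 2 * t 0 + t 1 ≤ 1} ∧ ![-2, 0, 1] ⬝ᵥ t ≤ 0} ∧
        ![-1, 0, 1] ⬝ᵥ t ≤ 0} =
      {t | (∀ k, 0 ≤ (!![3, 0, -3; -1, 1, 1; 0, 0, 2] : Matrix _ _ ℝ).mulVec t k) ∧
        ∑ k, (!![3, 0, -3; -1, 1, 1; 0, 0, 2] : Matrix _ _ ℝ).mulVec t k ≤ 1} := by
    ext t
    simp [Fin.forall_fin_succ, Fin.sum_univ_succ, Matrix.mulVec, dotProduct]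
    constructor
    · rintro ⟨⟨⟨⟨h1, h2, h3⟩, h4, h5, h6⟩, h7⟩, h8⟩
      and_intros <;> linarith
    · rintro ⟨⟨h1, h2, h3⟩, h4⟩
      and_intros <;> linarith
  have d1 : (!![2, 0, 0; 0, 1, 0; -2, 0, 1] : Matrix (Fin 3) (Fin 3) ℝ).det = 2 := by
    simp [Matrix.det_fin_three]
  have d2 : (!![-2, 0, 2; 4, 0, -2; 0, 1, 0] : Matrix (Fin 3) (Fin 3) ℝ).det = 4 := by
    simp [Matrix.det_fin_three]
    norm_num
  have d3 : (!![3, 0, -3; -1, 1, 1; 0, 0, 2] : Matrix (Fin 3) (Fin 3) ℝ).det = 6 := by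
    simp [Matrix.det_fin_three]
    norm_num
  rw [volume_split (a := ![-2, 0, 1]) (by simp) 0, e1,
    volume_split (a := ![-1, 0, 1]) (by simp) 0 {t | _ ∧ ![-2, 0, 1] ⬝ᵥ t ≤ 0}, e2, e3,
    volume_simplex _ (by rw [d1]; norm_num), volume_simplex _ (by rw [d2]; norm_num),
    volume_simplex _ (by rw [d3]; norm_num), d1, d2, d3,
    ← ENNReal.ofReal_add (by positivity) (by positivity),
    ← ENNReal.ofReal_add (by positivity) (by positivity)]
  congr 1
  norm_num [Nat.factorial]

/-- The hyperplanes `t₄ = t₅ + t₆`, `t₆ = t₄ + t₅` and `t₅ = t₄ + t₆` successively cut the polytope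
into four simplices with a vertex at the origin, encoded as in `volume_line_polytope`. -/
theorem volume_sing_polytope : volume {t : Fin 4 → ℝ | (∀ k, 0 ≤ t k) ∧
    t 1 + 2 * t 2 + t 3 ≤ 1 ∧ t 0 + t 2 + t 3 ≤ 1 ∧ t 0 + t 1 - t 2 - t 3 ≤ 0} =
      ENNReal.ofReal (1 / 72) := by
  set S : Set (Fin 4 → ℝ) := {t : Fin 4 → ℝ | (∀ k, 0 ≤ t k) ∧
    t 1 + 2 * t 2 + t 3 ≤ 1 ∧ t 0 + t 2 + t 3 ≤ 1 ∧ t 0 + t 1 - t 2 - t 3 ≤ 0} with hS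
  set A₁ : Matrix (Fin 4) (Fin 4) ℝ := !![2, -2, -2, 0; -1, -1, 1, 1; 0, 3, 0, 0; 0, 0, 2, 0]
  set A₂ : Matrix (Fin 4) (Fin 4) ℝ := !![0, 3, 0, 0; -2, -2, 2, 0; 2, 0, 0, 0; 0, 0, 0, 1]
  set A₃ : Matrix (Fin 4) (Fin 4) ℝ :=
    !![3 / 2, 3 / 2, -(3 / 2), 0; -(3 / 2), 3 / 2, 3 / 2, 0; 1, -1, 1, 0; -1, -1, 1, 1]
  set A₄ : Matrix (Fin 4) (Fin 4) ℝ := !![3, 0, 0, 0; 0, 0, 3, 0; -2, 2, -2, 0; -1, -1, 1, 1]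
  set T₁ := {t | t ∈ S ∧ ![1, -1, -1, 0] ⬝ᵥ t ≤ 0} with hT₁
  set T₂ := {t | t ∈ T₁ ∧ 0 ≤ ![1, 1, -1, 0] ⬝ᵥ t} with hT₂
  have e1 : {t | t ∈ S ∧ 0 ≤ ![1, -1, -1, 0] ⬝ᵥ t} =
      {t | (∀ k, 0 ≤ A₁.mulVec t k) ∧ ∑ k, A₁.mulVec t k ≤ 1} := by
    ext t
    simp [hS, A₁, Fin.forall_fin_succ, Fin.sum_univ_succ, Matrix.mulVec, dotProduct]
    constructor
    · rintro ⟨⟨⟨h1, h2, h3, h4⟩, h5, h6, h7⟩, h8⟩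
      and_intros <;> linarith
    · rintro ⟨⟨h1, h2, h3, h4⟩, h5⟩
      and_intros <;> linarith
  have e2 : {t | t ∈ T₁ ∧ ![1, 1, -1, 0] ⬝ᵥ t ≤ 0} =
      {t | (∀ k, 0 ≤ A₂.mulVec t k) ∧ ∑ k, A₂.mulVec t k ≤ 1} := by
    ext t
    simp [hS, hT₁, A₂, Fin.forall_fin_succ, Fin.sum_univ_succ, Matrix.mulVec, dotProduct]
    constructor
    · rintro ⟨⟨⟨⟨h1, h2, h3, h4⟩, h5, h6, h7⟩, h8⟩, h9⟩
      and_intros <;> linarith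
    · rintro ⟨⟨h1, h2, h3, h4⟩, h5⟩
      and_intros <;> linarith
  have e3 : {t | t ∈ T₂ ∧ 0 ≤ ![1, -1, 1, 0] ⬝ᵥ t} =
      {t | (∀ k, 0 ≤ A₃.mulVec t k) ∧ ∑ k, A₃.mulVec t k ≤ 1} := by
    ext t
    simp [hS, hT₁, hT₂, A₃, Fin.forall_fin_succ, Fin.sum_univ_succ, Matrix.mulVec, dotProduct]
    constructor
    · rintro ⟨⟨⟨⟨⟨h1, h2, h3, h4⟩, h5, h6, h7⟩, h8⟩, h9⟩, h10⟩
      and_intros <;> linarith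
    · rintro ⟨⟨h1, h2, h3, h4⟩, h5⟩
      and_intros <;> linarith
  have e4 : {t | t ∈ T₂ ∧ ![1, -1, 1, 0] ⬝ᵥ t ≤ 0} =
      {t | (∀ k, 0 ≤ A₄.mulVec t k) ∧ ∑ k, A₄.mulVec t k ≤ 1} := by
    ext t
    simp [hS, hT₁, hT₂, A₄, Fin.forall_fin_succ, Fin.sum_univ_succ, Matrix.mulVec, dotProduct]
    constructor
    · rintro ⟨⟨⟨⟨⟨h1, h2, h3, h4⟩, h5, h6, h7⟩, h8⟩, h9⟩, h10⟩
      and_intros <;> linarith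
    · rintro ⟨⟨h1, h2, h3, h4⟩, h5⟩
      and_intros <;> linarith
  have d1 : |A₁.det| = 12 := by
    simp [A₁, Matrix.det_succ_row_zero, Fin.sum_univ_succ, Fin.succAbove]
    norm_num
  have d2 : |A₂.det| = 12 := by
    simp [A₂, Matrix.det_succ_row_zero, Fin.sum_univ_succ, Fin.succAbove]
    norm_num
  have d3 : |A₃.det| = 9 := by
    simp [A₃, Matrix.det_succ_row_zero, Fin.sum_univ_succ, Fin.succAbove]
    norm_num
  have d4 : |A₄.det| = 18 := by
    simp [A₄, Matrix.det_succ_row_zero, Fin.sum_univ_succ, Fin.succAbove]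
    norm_num
  rw [volume_split (a := ![1, -1, -1, 0]) (by simp) 0 S, e1, ← hT₁,
    volume_split (a := ![1, 1, -1, 0]) (by simp) 0 T₁, e2, ← hT₂,
    volume_split (a := ![1, -1, 1, 0]) (by simp) 0 T₂, e3, e4,
    volume_simplex _ (by rw [← abs_pos, d1]; norm_num),
    volume_simplex _ (by rw [← abs_pos, d3]; norm_num),
    volume_simplex _ (by rw [← abs_pos, d4]; norm_num),
    volume_simplex _ (by rw [← abs_pos, d2]; norm_num), d1, d2, d3, d4,
    ← ENNReal.ofReal_add (by positivity) (by positivity),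
    ← ENNReal.ofReal_add (by positivity) (by positivity),
    ← ENNReal.ofReal_add (by positivity) (by positivity)]
  congr 1
  norm_num [Nat.factorial]

theorem polytopeConstant_sing : polytopeConstant .sing = Real.pi ^ 2 / 18 := by
  rw [polytopeConstant, Measure.real, volume_sing_polytope, ENNReal.toReal_ofReal (by norm_num)]
  ring

theorem polytopeConstant_line : polytopeConstant .line = 11 * Real.pi ^ 2 / 18 := by
  rw [polytopeConstant, Measure.real, volume_line_polytope, ENNReal.toReal_ofReal (by norm_num)]
  ring

/-- The polytopes of the two maximal faces fit together along `-t₄ + 3 t₆ + 2 t₈ = 1`. -/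
theorem alpha_sing_add : alpha .sing {0, 1} + alpha .sing {1, 2} =
    volume.real {t : Fin 4 → ℝ | (∀ k, 0 ≤ t k) ∧
      t 1 + 2 * t 2 + t 3 ≤ 1 ∧ t 0 + t 2 + t 3 ≤ 1 ∧ t 0 + t 1 - t 2 - t 3 ≤ 0} := by
  set S : Set (Fin 4 → ℝ) := {t : Fin 4 → ℝ | (∀ k, 0 ≤ t k) ∧
    t 1 + 2 * t 2 + t 3 ≤ 1 ∧ t 0 + t 2 + t 3 ≤ 1 ∧ t 0 + t 1 - t 2 - t 3 ≤ 0} with hS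
  have hfin : volume S ≠ ⊤ := by
    rw [hS, volume_sing_polytope]
    exact ENNReal.ofReal_ne_top
  have hsplit := volume_split (a := ![-1, 0, 3, 2]) (by simp) 1 S
  have e1 : {t | t ∈ S ∧ 1 ≤ ![-1, 0, 3, 2] ⬝ᵥ t} = {t : Fin 4 → ℝ | (∀ k, 0 ≤ t k) ∧
      1 ≤ -t 0 + 3 * t 2 + 2 * t 3 ∧ t 1 + 2 * t 2 + t 3 ≤ 1 ∧ t 0 + t 2 + t 3 ≤ 1} := by
    ext t
    simp [hS, Fin.forall_fin_succ, Fin.sum_univ_succ, dotProduct]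
    constructor
    · rintro ⟨⟨⟨h1, h2, h3, h4⟩, h5, h6, h7⟩, h8⟩
      and_intros <;> linarith
    · rintro ⟨⟨h1, h2, h3, h4⟩, h5, h6, h7⟩
      and_intros <;> linarith
  have e2 : {t | t ∈ S ∧ ![-1, 0, 3, 2] ⬝ᵥ t ≤ 1} = {t : Fin 4 → ℝ | (∀ k, 0 ≤ t k) ∧
      0 ≤ -t 0 - t 1 + t 2 + t 3 ∧ -t 0 + 3 * t 2 + 2 * t 3 ≤ 1 ∧ t 0 + t 2 + t 3 ≤ 1} := by
    ext t
    simp [hS, Fin.forall_fin_succ, Fin.sum_univ_succ, dotProduct]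
    constructor
    · rintro ⟨⟨⟨h1, h2, h3, h4⟩, h5, h6, h7⟩, h8⟩
      and_intros <;> linarith
    · rintro ⟨⟨h1, h2, h3, h4⟩, h5, h6, h7⟩
      and_intros <;> linarith
  rw [e1, e2] at hsplit
  rw [alpha_sing₁₂, alpha_sing₂₃, Measure.real, Measure.real, Measure.real, hsplit,
    ENNReal.toReal_add]
  · exact fun h => hfin (by rw [hsplit, h, top_add])
  · exact fun h => hfin (by rw [hsplit, h, add_top])

/-- The polytopes of the three maximal faces fit together along `t₅ + 2 t₆ + t₈ = 1` and
`3 t₆ + 2 t₈ = 1`. -/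
theorem alpha_line_add : alpha .line {0, 1} + alpha .line {1, 2} + alpha .line {0, 3} =
    volume.real {t : Fin 3 → ℝ | (∀ k, 0 ≤ t k) ∧
      t 1 + t 2 ≤ 1 ∧ t 0 - t 1 - t 2 ≤ 0 ∧ 2 * t 0 + t 1 ≤ 1} := by
  set S : Set (Fin 3 → ℝ) := {t : Fin 3 → ℝ | (∀ k, 0 ≤ t k) ∧
      t 1 + t 2 ≤ 1 ∧ t 0 - t 1 - t 2 ≤ 0 ∧ 2 * t 0 + t 1 ≤ 1} with hS
  have hfin : volume S ≠ ⊤ := by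
    rw [hS, volume_line_polytope]
    exact ENNReal.ofReal_ne_top
  set T := {t | t ∈ S ∧ ![1, 2, 1] ⬝ᵥ t ≤ 1} with hT
  have hsplit := volume_split (a := ![1, 2, 1]) (by simp) 1 S
  rw [← hT, volume_split (a := ![0, 3, 2]) (by simp) 1 T] at hsplit
  have e1 : {t | t ∈ S ∧ 1 ≤ ![1, 2, 1] ⬝ᵥ t} = {t : Fin 3 → ℝ | (∀ k, 0 ≤ t k) ∧
      2 * t 0 + t 1 ≤ 1 ∧ 1 ≤ t 0 + 2 * t 1 + t 2 ∧ t 1 + t 2 ≤ 1} := by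
    ext t
    simp [hS, Fin.forall_fin_succ, Fin.sum_univ_succ, dotProduct]
    constructor
    · rintro ⟨⟨⟨h1, h2, h3⟩, h5, h6, h7⟩, h8⟩
      and_intros <;> linarith
    · rintro ⟨⟨h1, h2, h3⟩, h5, h6, h7⟩
      and_intros <;> linarith
  have e2 : {t | t ∈ T ∧ 1 ≤ ![0, 3, 2] ⬝ᵥ t} = {t : Fin 3 → ℝ | (∀ k, 0 ≤ t k) ∧
      1 ≤ 3 * t 1 + 2 * t 2 ∧ t 0 + 2 * t 1 + t 2 ≤ 1 ∧ t 1 + t 2 ≤ 1} := by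
    ext t
    simp [hS, hT, Fin.forall_fin_succ, Fin.sum_univ_succ, dotProduct]
    constructor
    · rintro ⟨⟨⟨⟨h1, h2, h3⟩, h5, h6, h7⟩, h8⟩, h9⟩
      and_intros <;> linarith
    · rintro ⟨⟨h1, h2, h3⟩, h5, h6, h7⟩
      and_intros <;> linarith
  have e3 : {t | t ∈ T ∧ ![0, 3, 2] ⬝ᵥ t ≤ 1} = {t : Fin 3 → ℝ | (∀ k, 0 ≤ t k) ∧
      3 * t 1 + 2 * t 2 ≤ 1 ∧ 0 ≤ -t 0 + t 1 + t 2 ∧ t 1 + t 2 ≤ 1} := by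
    ext t
    simp [hS, hT, Fin.forall_fin_succ, Fin.sum_univ_succ, dotProduct]
    constructor
    · rintro ⟨⟨⟨⟨h1, h2, h3⟩, h5, h6, h7⟩, h8⟩, h9⟩
      and_intros <;> linarith
    · rintro ⟨⟨h1, h2, h3⟩, h5, h6, h7⟩
      and_intros <;> linarith
  rw [e1, e2, e3] at hsplit
  rw [hsplit] at hfin
  obtain ⟨h1, h2⟩ := ENNReal.add_ne_top.1 hfin
  obtain ⟨h2, h3⟩ := ENNReal.add_ne_top.1 h2
  rw [alpha_line₁₂, alpha_line₂₃, alpha_line₁₄, Measure.real, Measure.real, Measure.real,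
    Measure.real, hsplit, ENNReal.toReal_add h1 (ENNReal.add_ne_top.2 ⟨h2, h3⟩),
    ENNReal.toReal_add h2 h3]
  ring

theorem archContribution_eq (i : Bdry) : archContribution i = polytopeConstant i := by
  have h : ∀ A ∈ maxFaces i, alpha i A * (residueMeasure i A (stratum A)).toReal =
      4 * Real.pi ^ 2 * alpha i A := fun A hA => by
    rw [residueMeasure_maxFaces i A hA, ENNReal.toReal_ofReal (by positivity), mul_comm]
  rw [archContribution, Finset.sum_congr rfl h, ← Finset.mul_sum]
  cases i
  · rw [maxFaces_sing, Finset.sum_pair (by decide), alpha_sing_add, polytopeConstant]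
  · rw [maxFaces_line, Finset.sum_insert (by decide), Finset.sum_pair (by decide), ← add_assoc,
      alpha_line_add, polytopeConstant]

/-! ### Non-archimedean local fields -/

/-- A field with a discrete absolute value, normalised so that its values are the powers of the
number `q` of elements of the residue field; `r` runs through representatives of the residue
field. -/
structure HasResidueCard (F : Type*) [NormedField F] (q : ℕ) : Prop where
  one_lt : 1 < q
  exists_uniformizer : ∃ π : F, ‖π‖ = (q : ℝ)⁻¹
  norm_eq_zpow : ∀ x : F, x ≠ 0 → ∃ n : ℤ, ‖x‖ = (q : ℝ) ^ n
  exists_residues : ∃ r : Fin q → F, (∀ c, ‖r c‖ ≤ 1) ∧ ∀ x : F, ‖x‖ ≤ 1 → ∃! c, ‖x - r c‖ < 1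

section Completion

open NumberField IsDedekindDomain HeightOneSpectrum WithZeroMulInt

variable (K : Type*) [Field K] [NumberField K] (v : HeightOneSpectrum (𝓞 K))

instance : IsUltrametricDist (v.adicCompletion K) :=
  inferInstanceAs (@IsUltrametricDist _ (Valued.toNormedField (v.adicCompletion K) _).toDist)

instance : BorelSpace (v.adicCompletion K) := ⟨rfl⟩

theorem mem_integers_iff_norm_le_one (x : v.adicCompletion K) :
    x ∈ v.adicCompletionIntegers K ↔ ‖x‖ ≤ 1 :=
  (v.mem_adicCompletionIntegers (𝓞 K) K).trans
    (Valued.toNormedField.norm_le_one_iff (x := x)).symm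

theorem norm_algebraMap_lt_one_iff (a : 𝓞 K) :
    ‖algebraMap (𝓞 K) (v.adicCompletion K) a‖ < 1 ↔ a ∈ v.asIdeal := by
  rw [← FinitePlace.norm_lt_one_iff_mem K v a]
  rfl

theorem exists_integer_norm_sub_lt_one (x : v.adicCompletion K) (hx : ‖x‖ ≤ 1) :
    ∃ a : 𝓞 K, ‖x - algebraMap (𝓞 K) (v.adicCompletion K) a‖ < 1 := by
  obtain ⟨k, hk⟩ := (v.denseRange_algebraMap K).exists_dist_lt x one_pos
  rw [dist_eq_norm] at hk
  have h1 : ‖algebraMap K (v.adicCompletion K) k‖ ≤ 1 := by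
    have := IsUltrametricDist.norm_add_le_max (algebraMap K (v.adicCompletion K) k - x) x
    rw [sub_add_cancel] at this
    exact this.trans (max_le (by rw [norm_sub_rev]; exact hk.le) hx)
  have h2 : v.valuation K k ≤ 1 := by
    have := Valued.toNormedField.norm_le_one_iff.1 h1
    have e : Valued.v (algebraMap K (v.adicCompletion K) k) = v.valuation K k :=
      v.valuedAdicCompletion_eq_valuation' k
    rwa [e] at this
  obtain ⟨a, ha⟩ := v.exists_valuation_sub_lt_of_integer h2 1
  refine ⟨a, ?_⟩
  have h3 : ‖algebraMap K (v.adicCompletion K) (algebraMap (𝓞 K) K a - k)‖ < 1 := by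
    refine Valued.toNormedField.norm_lt_one_iff.2 ?_
    have e := v.valuedAdicCompletion_eq_valuation' (algebraMap (𝓞 K) K a - k)
    exact (e.trans_lt ha)
  rw [map_sub, ← IsScalarTower.algebraMap_apply, norm_sub_rev] at h3
  have := IsUltrametricDist.norm_add_le_max (x - algebraMap K (v.adicCompletion K) k)
    (algebraMap K (v.adicCompletion K) k - algebraMap (𝓞 K) (v.adicCompletion K) a)
  rw [sub_add_sub_cancel] at this
  exact this.trans_lt (max_lt hk h3)

/-- Representatives of the residue field are taken from the ring of integers of `K`, which is dense
in the ring of integers of the completion. -/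
theorem hasResidueCard_adicCompletion :
    HasResidueCard (v.adicCompletion K) (Ideal.absNorm v.asIdeal) where
  one_lt := one_lt_absNorm v
  exists_uniformizer := by
    obtain ⟨π, hπ⟩ := v.valuedAdicCompletion_surjective K (WithZero.exp (-1))
    refine ⟨π, ?_⟩
    rw [FinitePlace.norm_def, hπ, toNNReal_neg_apply _ (by simp),
      show Multiplicative.toAdd (WithZero.unzero (x := WithZero.exp (-1 : ℤ)) (by simp)) = -1
        from rfl]
    simp
  norm_eq_zpow x hx := by
    have h0 : Valued.v x ≠ 0 := (Valuation.ne_zero_iff _).2 hx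
    refine ⟨Multiplicative.toAdd (WithZero.unzero h0), ?_⟩
    rw [FinitePlace.norm_def, toNNReal_neg_apply _ h0]
    simp
  exists_residues := by
    have hcard : Nat.card (𝓞 K ⧸ v.asIdeal) = Ideal.absNorm v.asIdeal := rfl
    have : Finite (𝓞 K ⧸ v.asIdeal) := v.asIdeal.finiteQuotientOfFreeOfNeBot v.ne_bot
    let e : 𝓞 K ⧸ v.asIdeal ≃ Fin (Ideal.absNorm v.asIdeal) := Finite.equivFinOfCardEq hcard
    refine ⟨fun c => algebraMap (𝓞 K) (v.adicCompletion K) (Quotient.out (e.symm c)),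
      fun c => FinitePlace.norm_le_one K v _, fun x hx => ?_⟩
    obtain ⟨a, ha⟩ := exists_integer_norm_sub_lt_one K v x hx
    have key : ∀ b : 𝓞 K, ‖x - algebraMap (𝓞 K) (v.adicCompletion K) b‖ < 1 ↔
        Ideal.Quotient.mk v.asIdeal a = Ideal.Quotient.mk v.asIdeal b := by
      intro b
      rw [Ideal.Quotient.eq, ← norm_algebraMap_lt_one_iff, map_sub]
      constructor
      · intro hb
        have := IsUltrametricDist.norm_add_le_max
          (algebraMap (𝓞 K) (v.adicCompletion K) a - x)
          (x - algebraMap (𝓞 K) (v.adicCompletion K) b)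
        rw [sub_add_sub_cancel] at this
        exact this.trans_lt (max_lt (by rwa [norm_sub_rev]) hb)
      · intro hb
        have := IsUltrametricDist.norm_add_le_max (x - algebraMap (𝓞 K) (v.adicCompletion K) a)
          (algebraMap (𝓞 K) (v.adicCompletion K) a - algebraMap (𝓞 K) (v.adicCompletion K) b)
        rw [sub_add_sub_cancel] at this
        exact this.trans_lt (max_lt ha hb)
    have hout : ∀ c, Ideal.Quotient.mk v.asIdeal (Quotient.out (e.symm c)) = e.symm c :=
      fun c => Quotient.out_eq _
    refine ⟨e (Ideal.Quotient.mk v.asIdeal a), ?_, fun c hc => ?_⟩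
    · exact (key _).2 (by rw [hout, e.symm_apply_apply])
    · simp only [key, hout] at hc
      rw [hc, e.apply_symm_apply]

end Completion

/-! ### Volumes over a non-archimedean local field -/

section Balls

variable {F : Type*} [NormedField F] [MeasurableSpace F] [BorelSpace F] {μ : Measure F}

theorem measurable_inv_sq :
    Measurable fun x : F => if 1 < ‖x‖ then ENNReal.ofReal (‖x‖⁻¹ ^ 2) else 0 :=
  Measurable.ite (isOpen_lt continuous_const continuous_norm).measurableSet
    (by fun_prop) measurable_const

/-- The contribution of the points that reduce to the complement of `E₄, E₅, E₆`. -/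
theorem lintegral_region_unit (hμ : μ (Metric.closedBall (0 : F) 1) = 1) (x : F) :
    ∫⁻ y, (if ‖x‖ ≤ 1 ∧ ‖y‖ ≤ 1 then (1 : ℝ≥0∞) else 0) ∂μ = if ‖x‖ ≤ 1 then 1 else 0 := by
  by_cases hx : ‖x‖ ≤ 1
  · simp only [hx, true_and, if_true]
    refine (lintegral_congr fun y => ?_).trans
      ((lintegral_indicator_one Metric.isClosed_closedBall.measurableSet).trans hμ)
    classical
    rw [Set.indicator_apply]
    simp
  · simp [hx]

variable [μ.IsAddHaarMeasure]

theorem measure_closedBall_center (x : F) (r : ℝ) :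
    μ (Metric.closedBall x r) = μ (Metric.closedBall 0 r) := by
  rw [← measure_preimage_add_right μ (-x) (Metric.closedBall 0 r)]
  congr 1
  ext y
  simp [sub_eq_add_neg]

/-- The contribution of the points that reduce to `E₅`. -/
theorem lintegral_region_diagonal (hμ : μ (Metric.closedBall (0 : F) 1) = 1) (x : F) :
    ∫⁻ y, (if 1 < ‖x‖ ∧ ‖x + y‖ ≤ 1 then ENNReal.ofReal (‖x‖⁻¹ ^ 2) else 0) ∂μ =
      if 1 < ‖x‖ then ENNReal.ofReal (‖x‖⁻¹ ^ 2) else 0 := by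
  by_cases hx : 1 < ‖x‖
  · simp only [hx, true_and, if_true]
    classical
    have : ∀ y : F, (if ‖x + y‖ ≤ 1 then ENNReal.ofReal (‖x‖⁻¹ ^ 2) else 0) =
        (Metric.closedBall (-x) 1).indicator (fun _ => ENNReal.ofReal (‖x‖⁻¹ ^ 2)) y := fun y => by
      rw [Set.indicator_apply, mem_closedBall_iff_norm, sub_neg_eq_add, add_comm]
    simp only [this]
    rw [lintegral_indicator_const Metric.isClosed_closedBall.measurableSet,
      measure_closedBall_center, hμ, mul_one]
  · simp [hx]

end Balls

namespace HasResidueCard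

variable {F : Type*} [NormedField F] {q : ℕ}

theorem cast_pos (h : HasResidueCard F q) : (0 : ℝ) < q := by
  exact_mod_cast zero_lt_one.trans h.one_lt

theorem one_lt_cast (h : HasResidueCard F q) : (1 : ℝ) < q := by
  exact_mod_cast h.one_lt

theorem norm_lt_one_iff (h : HasResidueCard F q) (x : F) : ‖x‖ < 1 ↔ ‖x‖ ≤ (q : ℝ)⁻¹ := by
  refine ⟨fun hx => ?_, fun hx => hx.trans_lt (inv_lt_one_of_one_lt₀ h.one_lt_cast)⟩
  by_cases h0 : x = 0
  · rw [h0, norm_zero]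
    exact inv_nonneg.2 h.cast_pos.le
  · obtain ⟨n, hn⟩ := h.norm_eq_zpow x h0
    rw [hn] at hx ⊢
    have : n ≤ -1 := by
      have := (zpow_lt_one_iff_right₀ h.one_lt_cast).1 hx
      omega
    rw [← zpow_neg_one]
    exact zpow_le_zpow_right₀ h.one_lt_cast.le this

theorem tsum_shells (h : HasResidueCard F q) :
    ∑' n : ℕ, ENNReal.ofReal ((((q : ℝ) ^ (n + 1))⁻¹) ^ 2) *
      ENNReal.ofReal ((q : ℝ) ^ (n + 1) * (1 - (q : ℝ)⁻¹)) = ENNReal.ofReal (q : ℝ)⁻¹ := by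
  have hq := h.cast_pos
  have h1 : (q : ℝ)⁻¹ < 1 := inv_lt_one_of_one_lt₀ h.one_lt_cast
  have h0 : 0 < (q : ℝ)⁻¹ := inv_pos.2 hq
  have hterm : ∀ n : ℕ, ENNReal.ofReal ((((q : ℝ) ^ (n + 1))⁻¹) ^ 2) *
      ENNReal.ofReal ((q : ℝ) ^ (n + 1) * (1 - (q : ℝ)⁻¹)) =
      ENNReal.ofReal ((q : ℝ)⁻¹ ^ n * ((q : ℝ)⁻¹ * (1 - (q : ℝ)⁻¹))) := by
    intro n
    rw [← ENNReal.ofReal_mul (by positivity)]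
    congr 1
    rw [sq, mul_assoc, inv_mul_cancel_left₀ (pow_pos hq _).ne', ← inv_pow, pow_succ, mul_assoc]
  have hsum := (hasSum_geometric_of_lt_one h0.le h1).mul_right ((q : ℝ)⁻¹ * (1 - (q : ℝ)⁻¹))
  have hnn : 0 ≤ (q : ℝ)⁻¹ * (1 - (q : ℝ)⁻¹) := mul_nonneg h0.le (by linarith)
  simp only [hterm]
  rw [← ENNReal.ofReal_tsum_of_nonneg (fun n => mul_nonneg (by positivity) hnn) hsum.summable,
    hsum.tsum_eq]
  congr 1
  have : 1 - (q : ℝ)⁻¹ ≠ 0 := by linarith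
  rw [mul_left_comm, inv_mul_cancel₀ this, mul_one]

variable [IsUltrametricDist F]

/-- A ball is the disjoint union of `q` translates of the next smaller ball. -/
theorem exists_cosets (h : HasResidueCard F q) (n : ℤ) : ∃ s : Fin q → F,
    Metric.closedBall (0 : F) ((q : ℝ) ^ (n + 1)) = ⋃ c, Metric.closedBall (s c) ((q : ℝ) ^ n) ∧
    Pairwise (Function.onFun Disjoint fun c => Metric.closedBall (s c) ((q : ℝ) ^ n)) := by
  obtain ⟨π, hπ⟩ := h.exists_uniformizer
  obtain ⟨r, hr1, hr⟩ := h.exists_residues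
  have hq := h.cast_pos
  have hπ0 : π ≠ 0 := fun h0 => by
    rw [h0, norm_zero] at hπ
    exact (inv_pos.2 hq).ne hπ
  set ϖ := π ^ (n + 1) with hϖ
  have hϖ0 : ϖ ≠ 0 := zpow_ne_zero _ hπ0
  have hϖn : ‖ϖ‖ = ((q : ℝ) ^ (n + 1))⁻¹ := by rw [hϖ, norm_zpow, hπ, inv_zpow]
  have hpos : (0 : ℝ) < (q : ℝ) ^ (n + 1) := zpow_pos hq _
  have hsc : ∀ (x : F) c, x ∈ Metric.closedBall (ϖ⁻¹ * r c) ((q : ℝ) ^ n) ↔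
      ‖ϖ * x - r c‖ < 1 := by
    intro x c
    rw [h.norm_lt_one_iff, mem_closedBall_iff_norm,
      show ϖ * x - r c = ϖ * (x - ϖ⁻¹ * r c) by field_simp, norm_mul, hϖn, zpow_add_one₀ hq.ne',
      mul_inv, mul_comm ((q : ℝ) ^ n)⁻¹, mul_assoc, mul_le_iff_le_one_right (inv_pos.2 hq),
      inv_mul_le_iff₀ (zpow_pos hq _), mul_one]
  have hball : ∀ x : F, x ∈ Metric.closedBall (0 : F) ((q : ℝ) ^ (n + 1)) ↔ ‖ϖ * x‖ ≤ 1 := by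
    intro x
    rw [mem_closedBall_zero_iff, norm_mul, hϖn, inv_mul_le_iff₀ hpos, mul_one]
  refine ⟨fun c => ϖ⁻¹ * r c, ?_, fun c c' hcc' => ?_⟩
  · ext x
    rw [hball, Set.mem_iUnion]
    constructor
    · intro hx
      obtain ⟨c, hc, -⟩ := hr _ hx
      exact ⟨c, (hsc x c).2 hc⟩
    · rintro ⟨c, hc⟩
      rw [hsc] at hc
      have := IsUltrametricDist.norm_add_le_max (ϖ * x - r c) (r c)
      rw [sub_add_cancel] at this
      exact this.trans (max_le hc.le (hr1 c))
  · refine Set.disjoint_left.2 fun x hx hx' => hcc' ?_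
    rw [hsc] at hx hx'
    have hx1 : ‖ϖ * x‖ ≤ 1 := by
      have := IsUltrametricDist.norm_add_le_max (ϖ * x - r c) (r c)
      rw [sub_add_cancel] at this
      exact this.trans (max_le hx.le (hr1 c))
    exact (hr _ hx1).unique hx hx'

/-- Iterated subdivision into cosets covers the unit ball by finitely many balls of any radius
`q ^ (-n)`. -/
theorem exists_finite_cover (h : HasResidueCard F q) (n : ℕ) : ∃ t : Set F, t.Finite ∧
    Metric.closedBall (0 : F) 1 ⊆ ⋃ y ∈ t, Metric.closedBall y ((q : ℝ) ^ (-n : ℤ)) := by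
  induction n with
  | zero => exact ⟨{0}, Set.finite_singleton _, by simp⟩
  | succ n ih =>
    obtain ⟨t, ht, hcov⟩ := ih
    obtain ⟨s, hs, -⟩ := h.exists_cosets (-(n + 1 : ℕ) : ℤ)
    refine ⟨Set.image2 (fun y c => y + s c) t Set.univ, ht.image2 _ Set.finite_univ, fun x hx => ?_⟩
    obtain ⟨y, hy, hxy⟩ := Set.mem_iUnion₂.1 (hcov hx)
    have hx' : x - y ∈ Metric.closedBall (0 : F) ((q : ℝ) ^ (-(n + 1 : ℕ) + 1 : ℤ)) := by
      rw [mem_closedBall_zero_iff, show (-(n + 1 : ℕ) + 1 : ℤ) = -n by push_cast; ring]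
      exact mem_closedBall_iff_norm.1 hxy
    rw [hs] at hx'
    obtain ⟨c, hc⟩ := Set.mem_iUnion.1 hx'
    refine Set.mem_iUnion₂.2 ⟨y + s c, Set.mem_image2_of_mem hy (Set.mem_univ c), ?_⟩
    rw [mem_closedBall_iff_norm] at hc ⊢
    rwa [← sub_sub]

theorem isCompact_closedBall [CompleteSpace F] (h : HasResidueCard F q) :
    IsCompact (Metric.closedBall (0 : F) 1) := by
  refine isCompact_iff_totallyBounded_isComplete.2
    ⟨Metric.totallyBounded_iff.2 fun ε hε => ?_, Metric.isClosed_closedBall.isComplete⟩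
  obtain ⟨n, hn⟩ := exists_pow_lt_of_lt_one hε (inv_lt_one_of_one_lt₀ h.one_lt_cast)
  obtain ⟨t, ht, hcov⟩ := h.exists_finite_cover n
  refine ⟨t, ht, hcov.trans (Set.iUnion₂_mono fun y _ => Metric.closedBall_subset_ball ?_)⟩
  rwa [zpow_neg, zpow_natCast, ← inv_pow]

variable [MeasurableSpace F] [BorelSpace F]

theorem exists_haar [CompleteSpace F] (h : HasResidueCard F q) :
    ∃ μ : Measure F, μ.IsAddHaarMeasure ∧ μ (Metric.closedBall (0 : F) 1) = 1 := by
  let B : TopologicalSpace.PositiveCompacts F := ⟨⟨Metric.closedBall (0 : F) 1,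
    h.isCompact_closedBall⟩, ⟨0, Metric.ball_subset_interior_closedBall (by simp)⟩⟩
  exact ⟨Measure.addHaarMeasure B, inferInstance, Measure.addHaarMeasure_self⟩

variable {μ : Measure F} [μ.IsAddHaarMeasure]

theorem measure_closedBall (h : HasResidueCard F q) (hμ : μ (Metric.closedBall (0 : F) 1) = 1)
    (n : ℤ) : μ (Metric.closedBall (0 : F) ((q : ℝ) ^ n)) = ENNReal.ofReal ((q : ℝ) ^ n) := by
  have hq := h.cast_pos
  have step : ∀ n : ℤ, μ (Metric.closedBall (0 : F) ((q : ℝ) ^ (n + 1))) =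
      ENNReal.ofReal q * μ (Metric.closedBall (0 : F) ((q : ℝ) ^ n)) := by
    intro n
    obtain ⟨s, hs, hd⟩ := h.exists_cosets n
    rw [hs, measure_iUnion hd fun c => Metric.isClosed_closedBall.measurableSet]
    simp [measure_closedBall_center (s _)]
  have hq0 : ENNReal.ofReal q ≠ 0 := (ENNReal.ofReal_pos.2 hq).ne'
  induction n using Int.induction_on with
  | zero => simpa using hμ
  | succ n ih => rw [step, ih, ← ENNReal.ofReal_mul hq.le, mul_comm, zpow_add_one₀ hq.ne']
  | pred n ih =>
    have := step (-n - 1)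
    rw [sub_add_cancel, ih] at this
    rw [← ENNReal.mul_right_inj hq0 ENNReal.ofReal_ne_top, ← this, ← ENNReal.ofReal_mul hq.le,
      mul_comm, zpow_sub_one₀ hq.ne', inv_mul_cancel_right₀ hq.ne']

theorem measure_closedBall_inv_norm (h : HasResidueCard F q)
    (hμ : μ (Metric.closedBall (0 : F) 1) = 1) {x : F} (hx : x ≠ 0) :
    μ (Metric.closedBall (0 : F) ‖x‖⁻¹) = ENNReal.ofReal ‖x‖⁻¹ := by
  obtain ⟨n, hn⟩ := h.norm_eq_zpow x hx
  rw [hn, ← zpow_neg, h.measure_closedBall hμ]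

theorem measure_sphere (h : HasResidueCard F q) (hμ : μ (Metric.closedBall (0 : F) 1) = 1)
    (n : ℤ) : μ {x : F | ‖x‖ = (q : ℝ) ^ n} =
      ENNReal.ofReal ((q : ℝ) ^ n * (1 - (q : ℝ)⁻¹)) := by
  have hq := h.cast_pos
  have hset : {x : F | ‖x‖ = (q : ℝ) ^ n} =
      Metric.closedBall (0 : F) ((q : ℝ) ^ n) \ Metric.closedBall (0 : F) ((q : ℝ) ^ (n - 1)) := by
    ext x
    simp only [Set.mem_ofPred_eq, Set.mem_sdiff, mem_closedBall_zero_iff, not_le]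
    constructor
    · intro hx
      rw [hx]
      exact ⟨le_rfl, zpow_lt_zpow_right₀ h.one_lt_cast (by omega)⟩
    · rintro ⟨h1, h2⟩
      have hx : x ≠ 0 := fun h0 => by
        rw [h0, norm_zero] at h2
        exact (zpow_pos hq _).not_gt h2
      obtain ⟨m, hm⟩ := h.norm_eq_zpow x hx
      rw [hm] at h1 h2 ⊢
      rw [zpow_le_zpow_iff_right₀ h.one_lt_cast] at h1
      rw [zpow_lt_zpow_iff_right₀ h.one_lt_cast] at h2
      rw [show m = n by omega]
  rw [hset, measure_sdiff (Metric.closedBall_subset_closedBall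
    (zpow_le_zpow_right₀ h.one_lt_cast.le (by omega)))
    Metric.isClosed_closedBall.measurableSet.nullMeasurableSet
    (by rw [h.measure_closedBall hμ]; exact ENNReal.ofReal_ne_top),
    h.measure_closedBall hμ, h.measure_closedBall hμ, ← ENNReal.ofReal_sub _ (zpow_pos hq _).le,
    zpow_sub_one₀ hq.ne', mul_sub, mul_one]

/-- Integration of a radial function over the complement of the unit ball. -/
theorem lintegral_radial (h : HasResidueCard F q) (hμ : μ (Metric.closedBall (0 : F) 1) = 1)
    (φ : ℝ → ℝ≥0∞) : ∫⁻ x, (if 1 < ‖x‖ then φ ‖x‖ else 0) ∂μ =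
      ∑' n : ℕ, φ ((q : ℝ) ^ (n + 1)) *
        ENNReal.ofReal ((q : ℝ) ^ (n + 1) * (1 - (q : ℝ)⁻¹)) := by
  have hq := h.cast_pos
  have hset : {x : F | 1 < ‖x‖} = ⋃ n : ℕ, {x : F | ‖x‖ = (q : ℝ) ^ (n + 1)} := by
    ext x
    simp only [Set.mem_ofPred_eq, Set.mem_iUnion]
    constructor
    · intro hx
      obtain ⟨m, hm⟩ := h.norm_eq_zpow x (norm_pos_iff.1 (zero_lt_one.trans hx))
      rw [hm] at hx
      have hm0 := (one_lt_zpow_iff_right₀ h.one_lt_cast).1 hx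
      obtain ⟨k, rfl⟩ : ∃ k : ℕ, m = k + 1 := ⟨(m - 1).toNat, by omega⟩
      exact ⟨k, by rw [hm]; norm_cast⟩
    · rintro ⟨n, hn⟩
      rw [hn]
      exact one_lt_pow₀ h.one_lt_cast (by omega)
  have hmeas : ∀ c : ℝ, MeasurableSet {x : F | ‖x‖ = c} := fun c =>
    (isClosed_eq continuous_norm continuous_const).measurableSet
  have hpull : ∫⁻ x, (if 1 < ‖x‖ then φ ‖x‖ else 0) ∂μ = ∫⁻ x in {x : F | 1 < ‖x‖}, φ ‖x‖ ∂μ := by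
    rw [← lintegral_indicator (isOpen_lt continuous_const continuous_norm).measurableSet]
    rfl
  rw [hpull, hset, lintegral_iUnion (fun n => hmeas _)]
  · refine tsum_congr fun n => ?_
    rw [setLIntegral_congr_fun (hmeas _) (g := fun _ => φ ((q : ℝ) ^ (n + 1)))
      (fun x hx => by rw [Set.mem_ofPred_eq] at hx; simp only [hx]), setLIntegral_const]
    have e : ((q : ℝ) ^ (n + 1)) = (q : ℝ) ^ (n + 1 : ℤ) := by norm_cast
    rw [e, h.measure_sphere hμ]
  · intro m n hmn
    refine Set.disjoint_left.2 fun x hx hx' => hmn ?_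
    have := hx.symm.trans hx'
    have := pow_right_injective₀ hq h.one_lt_cast.ne' this
    omega

theorem lintegral_inv_sq (h : HasResidueCard F q) (hμ : μ (Metric.closedBall (0 : F) 1) = 1) :
    ∫⁻ x, (if 1 < ‖x‖ then ENNReal.ofReal (‖x‖⁻¹ ^ 2) else 0) ∂μ = ENNReal.ofReal (q : ℝ)⁻¹ := by
  rw [h.lintegral_radial hμ fun r => ENNReal.ofReal (r⁻¹ ^ 2), h.tsum_shells]

/-- The contribution of the points that reduce to `E₆`. -/
theorem lintegral_region_hyperbola (h : HasResidueCard F q)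
    (hμ : μ (Metric.closedBall (0 : F) 1) = 1) (x : F) :
    ∫⁻ y, (if 1 < ‖x‖ ∧ ‖x‖ * ‖y‖ ≤ 1 then ENNReal.ofReal ‖x‖⁻¹ else 0) ∂μ =
      if 1 < ‖x‖ then ENNReal.ofReal (‖x‖⁻¹ ^ 2) else 0 := by
  by_cases hx : 1 < ‖x‖
  · have hpos := zero_lt_one.trans hx
    simp only [hx, true_and, if_true]
    classical
    have : ∀ y : F, (if ‖x‖ * ‖y‖ ≤ 1 then ENNReal.ofReal ‖x‖⁻¹ else 0) =
        (Metric.closedBall (0 : F) ‖x‖⁻¹).indicator (fun _ => ENNReal.ofReal ‖x‖⁻¹) y := fun y => by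
      rw [Set.indicator_apply, mem_closedBall_zero_iff, ← one_div, le_div_iff₀' hpos]
    simp only [this]
    rw [lintegral_indicator_const Metric.isClosed_closedBall.measurableSet,
      h.measure_closedBall_inv_norm hμ (norm_pos_iff.1 hpos), ← ENNReal.ofReal_mul (by positivity),
      sq]
  · simp [hx]

/-- The contribution of the points that reduce to `E₄`.  Here the integrals are interchanged by
summing over the values of `‖y‖`. -/
theorem lintegral_region_hyperbola' (h : HasResidueCard F q)
    (hμ : μ (Metric.closedBall (0 : F) 1) = 1) :
    ∫⁻ x, ∫⁻ y, (if 1 < ‖y‖ ∧ ‖x‖ * ‖y‖ ≤ 1 then ENNReal.ofReal ‖y‖⁻¹ else 0) ∂μ ∂μ =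
      ENNReal.ofReal (q : ℝ)⁻¹ := by
  classical
  have hq := h.cast_pos
  have inner : ∀ x : F,
      ∫⁻ y, (if 1 < ‖y‖ ∧ ‖x‖ * ‖y‖ ≤ 1 then ENNReal.ofReal ‖y‖⁻¹ else 0) ∂μ =
      ∑' n : ℕ, (Metric.closedBall (0 : F) ((q : ℝ) ^ (-(n + 1) : ℤ))).indicator
        (fun _ => ENNReal.ofReal ((q : ℝ) ^ (n + 1))⁻¹ *
          ENNReal.ofReal ((q : ℝ) ^ (n + 1) * (1 - (q : ℝ)⁻¹))) x := fun x => by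
    simp only [ite_and]
    rw [h.lintegral_radial hμ fun r => if ‖x‖ * r ≤ 1 then ENNReal.ofReal r⁻¹ else 0]
    refine tsum_congr fun n => ?_
    have e : ((q : ℝ) ^ (-(n + 1) : ℤ)) = ((q : ℝ) ^ (n + 1))⁻¹ := by
      rw [zpow_neg]
      norm_cast
    rw [Set.indicator_apply, mem_closedBall_zero_iff, e, ← one_div, le_div_iff₀ (by positivity),
      ite_mul, zero_mul, one_div]
  simp only [inner]
  rw [lintegral_tsum fun n => (measurable_const.indicator
    Metric.isClosed_closedBall.measurableSet).aemeasurable, ← h.tsum_shells]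
  refine tsum_congr fun n => ?_
  rw [lintegral_indicator_const Metric.isClosed_closedBall.measurableSet, h.measure_closedBall hμ,
    mul_right_comm, ← ENNReal.ofReal_mul (by positivity)]
  congr 2
  rw [zpow_neg, sq]
  norm_cast

end HasResidueCard

/-! ### Integral points over a non-archimedean local field -/

theorem coxRel_planeParam {F : Type*} [Field F] (p : F × F) : coxRel (planeParam p) = 0 := by
  simp [coxRel, planeParam]

theorem planeParam_mem_torsor {F : Type*} [Field F] (p : F × F) : planeParam p ∈ torsor F := by
  refine mem_torsor_of_isUnit (c := {6, 7, 8}) (coxRel_planeParam p) (by decide) fun j hj => ?_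
  fin_cases j <;> simp_all [planeParam]

/-- Cox coordinates of the point with plane coordinates `(x, y)` determine `(x, y)`, and `x + y`
through the relation of the Cox ring. -/
theorem planeCoord_of_represents {F : Type*} [Field F] {x y : F} {η : Fin 9 → F} {P : Surface F}
    (h : Represents (planeParam (x, y)) P) (hη : Represents η P) :
    (∀ j : Fin 9, j < 6 → η j ≠ 0) ∧
      x * (η 1 * η 2 * η 4 * η 5) = η 3 * η 6 ∧
      y * (η 0 * η 1 * η 3 * η 4) = η 5 * η 7 ∧
      (x + y) * (η 0 * η 1 * η 2 * η 3 * η 5) = -η 8 := by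
  obtain ⟨h1, rfl⟩ := h
  obtain ⟨h2, h3⟩ := hη
  obtain ⟨t, ht⟩ := Quotient.exact h3.symm
  replace ht : ∀ j, η j = ((∏ k, t k ^ curveClass j k : Fˣ) : F) * planeParam (x, y) j := ht
  have t0 : ∀ k, (t k : F) ≠ 0 := fun k => (t k).ne_zero
  refine ⟨fun j hj => ?_, ?_, ?_, ?_⟩
  · rw [ht j]
    refine mul_ne_zero (Units.ne_zero _) ?_
    fin_cases j <;> simp_all [planeParam]
  all_goals
    simp only [ht]
    simp [Fin.prod_univ_succ, curveClass, planeParam, Fin.succ]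
    have := t0 0
    have := t0 1
    have := t0 2
    have := t0 3
    have := t0 4
    have := t0 5
    field_simp
  ring

theorem norm_eq_of_norm_add_le {F : Type*} [NormedField F] [IsUltrametricDist F] {x y : F}
    (hx : 1 < ‖x‖) (hxy : ‖x + y‖ ≤ 1) : ‖y‖ = ‖x‖ := by
  have h1 := IsUltrametricDist.norm_add_le_max (x + y) (-x)
  have h2 := IsUltrametricDist.norm_add_le_max (x + y) (-y)
  rw [add_neg_cancel_comm, norm_neg] at h1
  rw [add_neg_cancel_right, norm_neg] at h2
  rcases le_max_iff.1 h2 with h3 | h3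
  · linarith
  · exact (h1.trans (max_le (hxy.trans hx.le) le_rfl)).antisymm h3

section Completion

open NumberField IsDedekindDomain

variable {K : Type*} [Field K] [NumberField K] {v : HeightOneSpectrum (𝓞 K)}

theorem isUnit_integer_iff (x : v.adicCompletionIntegers K) :
    IsUnit x ↔ ‖(x : v.adicCompletion K)‖ = 1 := by
  have hx := (mem_integers_iff_norm_le_one K v x).1 x.2
  constructor
  · rintro ⟨u, rfl⟩
    have h1 := (mem_integers_iff_norm_le_one K v _).1 (u⁻¹ : (v.adicCompletionIntegers K)ˣ).1.2
    have h2 : ((u : v.adicCompletionIntegers K) : v.adicCompletion K) *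
        ((u⁻¹ : (v.adicCompletionIntegers K)ˣ) : v.adicCompletionIntegers K) = 1 := by
      rw [← MulMemClass.coe_mul, Units.mul_inv]
      rfl
    have h3 := congrArg norm h2
    rw [norm_mul, norm_one] at h3
    nlinarith [norm_nonneg ((u : v.adicCompletionIntegers K) : v.adicCompletion K)]
  · intro h
    have h0 : (x : v.adicCompletion K) ≠ 0 := norm_ne_zero_iff.1 (by rw [h]; exact one_ne_zero)
    have hinv : (x : v.adicCompletion K)⁻¹ ∈ v.adicCompletionIntegers K := by
      rw [mem_integers_iff_norm_le_one, norm_inv, h, inv_one]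
    exact IsUnit.of_mul_eq_one ⟨_, hinv⟩ (Subtype.ext (mul_inv_cancel₀ h0))

/-- Since the ring of integers is local, an integral point of the torsor has unit coordinates
outside one of the maximal sets of curves with a common point: the curves in that set are those
which may contain the reduction of the point. -/
theorem exists_maxMeeting_of_mem_torsor_integers {η : Fin 9 → v.adicCompletionIntegers K}
    (h : η ∈ torsor (v.adicCompletionIntegers K)) :
    ∃ c ∈ maxMeeting, ∀ j, j ∉ c → ‖(η j : v.adicCompletion K)‖ = 1 := by
  by_contra hc
  push Not at hc
  refine IsLocalRing.maximalIdeal.isMaximal (v.adicCompletionIntegers K) |>.ne_top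
    (top_le_iff.1 (h.2.symm.le.trans (Ideal.span_le.2 ?_)))
  rintro m ⟨c, hm, rfl⟩
  obtain ⟨j, hj, hu⟩ := hc c hm
  refine Ideal.mem_of_dvd _ (Finset.dvd_prod_of_mem η (Finset.mem_compl.2 hj)) ?_
  exact (IsLocalRing.mem_maximalIdeal _).2 fun hu' => hu ((isUnit_integer_iff _).1 hu')

theorem exists_integralPoint {i : Bdry} {x y : v.adicCompletion K}
    (η : Fin 9 → v.adicCompletion K) (h0 : coxRel η = 0) (t : Fin 6 → (v.adicCompletion K)ˣ)
    (ht : ∀ j, η j = ((∏ k, t k ^ curveClass j k : (v.adicCompletion K)ˣ) : v.adicCompletion K) *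
      planeParam (x, y) j)
    (h1 : ∀ j, ‖η j‖ ≤ 1) (c : Finset (Fin 9)) (hc : c ∈ maxMeeting)
    (hu : ∀ j, j ∉ c → ‖η j‖ = 1) (hb : ∀ j ∈ boundary i, ‖η j‖ = 1) :
    ∃ P ∈ integralPoints K i v, Represents (planeParam (x, y)) P := by
  have hP : Represents (planeParam (x, y))
      (Quotient.mk (torusSetoid _) ⟨_, planeParam_mem_torsor (x, y)⟩) := ⟨_, rfl⟩
  refine ⟨_, ⟨fun j => ⟨η j, (mem_integers_iff_norm_le_one K v _).2 (h1 j)⟩, ?_,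
    fun j hj => (isUnit_integer_iff _).2 (hb j hj), ?_⟩, hP⟩
  · refine mem_torsor_of_isUnit (Subtype.ext ?_) hc fun j hj => (isUnit_integer_iff _).2 (hu j hj)
    exact h0
  · refine represents_of_scaling hP (mem_torsor_of_isUnit h0 hc fun j hj => ?_) t ht
    exact isUnit_iff_ne_zero.2 (norm_ne_zero_iff.1 (by rw [hu j hj]; exact one_ne_zero))

/-- The plane coordinates of an integral point.  The four alternatives correspond to a reduction
outside `E₄ ∪ E₅ ∪ E₆`, or on `E₅`, `E₆` or `E₄`. -/
theorem norm_planeCoord_of_integral {x y : v.adicCompletion K}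
    {η : Fin 9 → v.adicCompletionIntegers K} (h : η ∈ torsor (v.adicCompletionIntegers K))
    (hb : ∀ j ∈ boundary .sing, IsUnit (η j)) {P : Surface (v.adicCompletion K)}
    (hP : Represents (fun j => (η j : v.adicCompletion K)) P)
    (hxy : Represents (planeParam (x, y)) P) :
    (‖x‖ ≤ 1 ∧ ‖y‖ ≤ 1) ∨ (1 < ‖x‖ ∧ ‖x + y‖ ≤ 1) ∨ (1 < ‖x‖ ∧ ‖x‖ * ‖y‖ ≤ 1) ∨
      (‖(η 3 : v.adicCompletion K)‖ < 1 ∧ 1 < ‖y‖ ∧ ‖x‖ * ‖y‖ ≤ 1) := by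
  obtain ⟨hne, ex, ey, es⟩ := planeCoord_of_represents hxy hP
  obtain ⟨c, hc, hu⟩ := exists_maxMeeting_of_mem_torsor_integers h
  have b0 := (isUnit_integer_iff _).1 (hb 0 (by decide))
  have b1 := (isUnit_integer_iff _).1 (hb 1 (by decide))
  have b2 := (isUnit_integer_iff _).1 (hb 2 (by decide))
  have hle : ∀ j, ‖(η j : v.adicCompletion K)‖ ≤ 1 :=
    fun j => (mem_integers_iff_norm_le_one K v _).1 (η j).2
  have p3 : 0 < ‖(η 3 : v.adicCompletion K)‖ := norm_pos_iff.2 (hne 3 (by decide))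
  have p4 : 0 < ‖(η 4 : v.adicCompletion K)‖ := norm_pos_iff.2 (hne 4 (by decide))
  have p5 : 0 < ‖(η 5 : v.adicCompletion K)‖ := norm_pos_iff.2 (hne 5 (by decide))
  have nx := congrArg norm ex
  have ny := congrArg norm ey
  have ns := congrArg norm es
  simp only [norm_mul, norm_neg, b0, b1, b2, one_mul] at nx ny ns
  have l6 := hle 6
  have l7 := hle 7
  have l8 := hle 8
  -- at most one of `η₄, η₅, η₆` is not a unit, and then at most one of `η₇, η₈, η₉`
  have key : ∀ j : Fin 9, ‖(η j : v.adicCompletion K)‖ < 1 → j ∈ c := fun j hj => by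
    by_contra hjc
    exact hj.ne (hu j hjc)
  rcases (hle 3).lt_or_eq with h3 | h3
  · have hc3 := key 3 h3
    have hcc : c = {0, 3} ∨ c = {3, 6} :=
      (by decide +kernel : ∀ c ∈ maxMeeting, 3 ∈ c → c = {0, 3} ∨ c = {3, 6}) c hc hc3
    have e4 : ‖(η 4 : v.adicCompletion K)‖ = 1 := hu 4 (by rcases hcc with rfl | rfl <;> decide)
    have e5 : ‖(η 5 : v.adicCompletion K)‖ = 1 := hu 5 (by rcases hcc with rfl | rfl <;> decide)
    have e7 : ‖(η 7 : v.adicCompletion K)‖ = 1 := hu 7 (by rcases hcc with rfl | rfl <;> decide)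
    rw [e4, e5] at nx
    rw [e4, e5, e7] at ny
    refine Or.inr (Or.inr (Or.inr ⟨h3, ?_, ?_⟩))
    · by_contra hy
      nlinarith [norm_nonneg y]
    · have : ‖x‖ * ‖y‖ = ‖(η 6 : v.adicCompletion K)‖ := by
        have hx : ‖x‖ = ‖(η 3 : v.adicCompletion K)‖ * ‖(η 6 : v.adicCompletion K)‖ := by linarith
        have hy : ‖(η 3 : v.adicCompletion K)‖ * ‖y‖ = 1 := by linarith
        rw [hx, mul_right_comm, hy, one_mul]
      rwa [this]
  rcases (hle 4).lt_or_eq with h4 | h4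
  · have hc4 := key 4 h4
    have hcc : c = {1, 4} ∨ c = {4, 8} :=
      (by decide +kernel : ∀ c ∈ maxMeeting, 4 ∈ c → c = {1, 4} ∨ c = {4, 8}) c hc hc4
    have e5 : ‖(η 5 : v.adicCompletion K)‖ = 1 := hu 5 (by rcases hcc with rfl | rfl <;> decide)
    have e6 : ‖(η 6 : v.adicCompletion K)‖ = 1 := hu 6 (by rcases hcc with rfl | rfl <;> decide)
    rw [h3, e5, e6] at nx
    rw [h3, e5] at ns
    refine Or.inr (Or.inl ⟨?_, ?_⟩)
    · by_contra hx
      nlinarith [norm_nonneg x]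
    · linarith
  rcases (hle 5).lt_or_eq with h5 | h5
  · have hc5 := key 5 h5
    have hcc : c = {2, 5} ∨ c = {5, 7} :=
      (by decide +kernel : ∀ c ∈ maxMeeting, 5 ∈ c → c = {2, 5} ∨ c = {5, 7}) c hc hc5
    have e6 : ‖(η 6 : v.adicCompletion K)‖ = 1 := hu 6 (by rcases hcc with rfl | rfl <;> decide)
    rw [h3, h4, e6] at nx
    rw [h3, h4] at ny
    refine Or.inr (Or.inr (Or.inl ⟨?_, ?_⟩))
    · by_contra hx
      nlinarith [norm_nonneg x]
    · have : ‖x‖ * ‖y‖ = ‖(η 7 : v.adicCompletion K)‖ := by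
        have hx : ‖x‖ * ‖(η 5 : v.adicCompletion K)‖ = 1 := by linarith
        have hy : ‖y‖ = ‖(η 5 : v.adicCompletion K)‖ * ‖(η 7 : v.adicCompletion K)‖ := by linarith
        rw [hy, ← mul_assoc, hx, one_mul]
      rwa [this]
  · rw [h3, h4, h5] at nx
    rw [h3, h4, h5] at ny
    exact Or.inl ⟨by linarith, by linarith⟩

variable (i : Bdry) (x y : v.adicCompletion K)

theorem exists_integralPoint_unit (hx : ‖x‖ ≤ 1) (hy : ‖y‖ ≤ 1) :
    ∃ P ∈ integralPoints K i v, Represents (planeParam (x, y)) P := by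
  have hs : ‖-x - y‖ ≤ 1 := by
    rw [← neg_add', norm_neg]
    exact (IsUltrametricDist.norm_add_le_max x y).trans (max_le hx hy)
  refine exists_integralPoint (planeParam (x, y)) (coxRel_planeParam _) 1 (by simp)
    (fun j => ?_) {6, 7, 8} (by decide) (fun j hj => ?_) fun j hj => ?_
  · fin_cases j <;> simp [planeParam, hx, hy, hs]
  · fin_cases j <;> simp_all [planeParam]
  · cases i <;> fin_cases j <;> simp_all [planeParam, boundary]

theorem norm_neg_one_sub_mul_inv {x y : v.adicCompletion K} (hx : 1 < ‖x‖)
    (hxy : ‖x‖ * ‖y‖ ≤ 1) : ‖-1 - y * x⁻¹‖ = 1 := by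
  have hyx : ‖y * x⁻¹‖ < 1 := by
    rw [norm_mul, norm_inv, ← div_eq_mul_inv]
    exact (div_lt_one (zero_lt_one.trans hx)).2 (by nlinarith [norm_nonneg y])
  have h1 := IsUltrametricDist.norm_add_le_max (1 : v.adicCompletion K) (y * x⁻¹)
  have h2 := IsUltrametricDist.norm_add_le_max (-1 - y * x⁻¹) (y * x⁻¹)
  rw [sub_add_cancel, norm_neg, norm_one] at h2
  rw [← norm_neg, neg_add', norm_one, max_eq_left hyx.le] at h1
  exact h1.antisymm ((le_max_iff.1 h2).resolve_right hyx.not_ge)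

theorem exists_integralPoint_diagonal (hx : 1 < ‖x‖) (hxy : ‖x + y‖ ≤ 1) :
    ∃ P ∈ integralPoints K i v, Represents (planeParam (x, y)) P := by
  have hx0 : x ≠ 0 := norm_pos_iff.1 (zero_lt_one.trans hx)
  have hs : ‖-x - y‖ ≤ 1 := by rwa [← neg_add', norm_neg]
  have hxi : ‖x‖⁻¹ ≤ 1 := inv_le_one_of_one_le₀ hx.le
  have hyx := norm_eq_of_norm_add_le hx hxy
  let s : (v.adicCompletion K)ˣ := (Units.mk0 x hx0)⁻¹
  have hy : ‖y‖ * ‖x‖⁻¹ = 1 := by rw [hyx, mul_inv_cancel₀ (zero_lt_one.trans hx).ne']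
  refine exists_integralPoint ![1, 1, 1, 1, x⁻¹, 1, 1, y * x⁻¹, -x - y] ?_ ![s, 1, 1, s, 1, 1]
    (fun j => ?_) (fun j => ?_) {4, 8} (by decide) (fun j hj => ?_) fun j hj => ?_
  · simp [coxRel]
    field_simp
    ring
  · fin_cases j <;> simp [Fin.prod_univ_succ, curveClass, planeParam, s, hx0, mul_comm]
  · fin_cases j <;> simp [hxi, hs, hy]
  · fin_cases j <;> simp_all
  · cases i <;> fin_cases j <;> simp_all [boundary]

theorem exists_integralPoint_hyperbola (hx : 1 < ‖x‖) (hxy : ‖x‖ * ‖y‖ ≤ 1) :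
    ∃ P ∈ integralPoints K i v, Represents (planeParam (x, y)) P := by
  have hx0 : x ≠ 0 := norm_pos_iff.1 (zero_lt_one.trans hx)
  have hxi : ‖x‖⁻¹ ≤ 1 := inv_le_one_of_one_le₀ hx.le
  have hs := norm_neg_one_sub_mul_inv hx hxy
  let s : (v.adicCompletion K)ˣ := (Units.mk0 x hx0)⁻¹
  refine exists_integralPoint ![1, 1, 1, 1, 1, x⁻¹, 1, x * y, -1 - y * x⁻¹] ?_ ![s, 1, s, 1, 1, s]
    (fun j => ?_) (fun j => ?_) {5, 7} (by decide) (fun j hj => ?_) fun j hj => ?_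
  · simp [coxRel]
    field_simp
    ring
  · fin_cases j <;> simp [Fin.prod_univ_succ, curveClass, planeParam, s, hx0]
    field_simp
  · fin_cases j <;> simp [hxi, hs, hxy]
  · fin_cases j <;> simp_all
  · cases i <;> fin_cases j <;> simp_all [boundary]

theorem exists_integralPoint_hyperbola' (hy : 1 < ‖y‖) (hxy : ‖x‖ * ‖y‖ ≤ 1) :
    ∃ P ∈ integralPoints K .sing v, Represents (planeParam (x, y)) P := by
  have hy0 : y ≠ 0 := norm_pos_iff.1 (zero_lt_one.trans hy)
  have hyi : ‖y‖⁻¹ ≤ 1 := inv_le_one_of_one_le₀ hy.le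
  have hs := norm_neg_one_sub_mul_inv hy (mul_comm ‖x‖ ‖y‖ ▸ hxy)
  let s : (v.adicCompletion K)ˣ := (Units.mk0 y hy0)⁻¹
  refine exists_integralPoint ![1, 1, 1, y⁻¹, 1, 1, x * y, 1, -1 - x * y⁻¹] ?_ ![s, s, 1, 1, s, 1]
    (fun j => ?_) (fun j => ?_) {3, 6} (by decide) (fun j hj => ?_) fun j hj => ?_
  · simp [coxRel]
    field_simp
    ring
  · fin_cases j <;> simp [Fin.prod_univ_succ, curveClass, planeParam, s, hy0] <;> field_simp
    ring
  · fin_cases j <;> simp [hyi, hs, hxy]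
  · fin_cases j <;> simp_all
  · fin_cases j <;> simp_all [boundary]

theorem exists_integralPoint_sing_iff :
    (∃ P ∈ integralPoints K .sing v, Represents (planeParam (x, y)) P) ↔
      (‖x‖ ≤ 1 ∧ ‖y‖ ≤ 1) ∨ (1 < ‖x‖ ∧ ‖x + y‖ ≤ 1) ∨ (1 < ‖x‖ ∧ ‖x‖ * ‖y‖ ≤ 1) ∨
        (1 < ‖y‖ ∧ ‖x‖ * ‖y‖ ≤ 1) := by
  constructor
  · rintro ⟨P, ⟨η, h, hb, hP⟩, hxy⟩
    have := norm_planeCoord_of_integral h hb hP hxy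
    tauto
  · rintro (h | h | h | h)
    · exact exists_integralPoint_unit _ x y h.1 h.2
    · exact exists_integralPoint_diagonal _ x y h.1 h.2
    · exact exists_integralPoint_hyperbola _ x y h.1 h.2
    · exact exists_integralPoint_hyperbola' x y h.1 h.2

theorem exists_integralPoint_line_iff :
    (∃ P ∈ integralPoints K .line v, Represents (planeParam (x, y)) P) ↔
      (‖x‖ ≤ 1 ∧ ‖y‖ ≤ 1) ∨ (1 < ‖x‖ ∧ ‖x + y‖ ≤ 1) ∨ (1 < ‖x‖ ∧ ‖x‖ * ‖y‖ ≤ 1) := by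
  constructor
  · rintro ⟨P, ⟨η, h, hb, hP⟩, hxy⟩
    have := norm_planeCoord_of_integral h
      (fun j hj => hb j (by revert hj; revert j; decide)) hP hxy
    have h3 := (isUnit_integer_iff _).1 (hb 3 (by decide))
    rcases this with h | h | h | h
    · exact Or.inl h
    · exact Or.inr (Or.inl h)
    · exact Or.inr (Or.inr h)
    · exact absurd h3 h.1.ne
  · rintro (h | h | h)
    · exact exists_integralPoint_unit _ x y h.1 h.2
    · exact exists_integralPoint_diagonal _ x y h.1 h.2
    · exact exists_integralPoint_hyperbola _ x y h.1 h.2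

end Completion

/-! ### The local volumes -/

section Norms

variable {F : Type*} [NormedField F] (x y : F)

theorem logFormNorm_sing : logFormNorm (fun z : F => ‖z‖₊) .sing (planeParam (x, y)) =
    ‖x‖₊ ⊔ (‖y‖₊ ⊔ (1 ⊔ ‖x‖₊ * ‖y‖₊)) := by
  simp [logFormNorm, logSections, mon, Fin.prod_univ_succ, planeParam, boundary, Fin.succ]

theorem logFormNorm_line : logFormNorm (fun z : F => ‖z‖₊) .line (planeParam (x, y)) =
    ‖x‖₊ ⊔ (1 ⊔ ‖x‖₊ * ‖y‖₊) := by
  simp [logFormNorm, logSections, mon, Fin.prod_univ_succ, planeParam, boundary, Fin.succ]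

end Norms

theorem coe_inv_eq_ofReal {a : ℝ≥0} (h : 0 < a) : ((a : ℝ≥0∞))⁻¹ = ENNReal.ofReal (a : ℝ)⁻¹ := by
  rw [ENNReal.ofReal_inv_of_pos (by exact_mod_cast h), ENNReal.ofReal_coe_nnreal]

section Measurability

variable {F : Type*} [NormedField F] [MeasurableSpace F] [BorelSpace F] {μ : Measure F}

theorem measurable_region_unit (x : F) :
    Measurable fun y : F => if ‖x‖ ≤ 1 ∧ ‖y‖ ≤ 1 then (1 : ℝ≥0∞) else 0 := by
  refine Measurable.ite ((MeasurableSet.const _).inter ?_) measurable_const measurable_const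
  exact (isClosed_le continuous_norm continuous_const).measurableSet

theorem measurable_region_diagonal (x : F) : Measurable fun y : F =>
    if 1 < ‖x‖ ∧ ‖x + y‖ ≤ 1 then ENNReal.ofReal (‖x‖⁻¹ ^ 2) else 0 := by
  refine Measurable.ite ((MeasurableSet.const _).inter ?_) measurable_const measurable_const
  exact (isClosed_le (continuous_const.add continuous_id).norm continuous_const).measurableSet

theorem measurable_region_hyperbola (x : F) : Measurable fun y : F =>
    if 1 < ‖x‖ ∧ ‖x‖ * ‖y‖ ≤ 1 then ENNReal.ofReal ‖x‖⁻¹ else 0 := by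
  refine Measurable.ite ((MeasurableSet.const _).inter ?_) measurable_const measurable_const
  exact (isClosed_le (continuous_const.mul continuous_norm) continuous_const).measurableSet

theorem measurable_unit_ball : Measurable fun x : F => if ‖x‖ ≤ 1 then (1 : ℝ≥0∞) else 0 :=
  Measurable.ite (isClosed_le continuous_norm continuous_const).measurableSet
    measurable_const measurable_const

theorem lintegral_unit_ball (hμ : μ (Metric.closedBall (0 : F) 1) = 1) :
    ∫⁻ x : F, (if ‖x‖ ≤ 1 then (1 : ℝ≥0∞) else 0) ∂μ = 1 := by
  simpa using lintegral_region_unit hμ (0 : F)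

end Measurability

section Density

variable {F : Type*} [NormedField F] [IsUltrametricDist F]

open Classical in
/-- The density of the measure on the integral points, split according to the reduction. -/
theorem density_line (x y : F) :
    (if (‖x‖ ≤ 1 ∧ ‖y‖ ≤ 1) ∨ (1 < ‖x‖ ∧ ‖x + y‖ ≤ 1) ∨ (1 < ‖x‖ ∧ ‖x‖ * ‖y‖ ≤ 1) then
      ((logFormNorm (fun z : F => ‖z‖₊) .line (planeParam (x, y)))⁻¹ : ℝ≥0∞) else 0) =
    (if ‖x‖ ≤ 1 ∧ ‖y‖ ≤ 1 then 1 else 0) +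
      ((if 1 < ‖x‖ ∧ ‖x + y‖ ≤ 1 then ENNReal.ofReal (‖x‖⁻¹ ^ 2) else 0) +
      (if 1 < ‖x‖ ∧ ‖x‖ * ‖y‖ ≤ 1 then ENNReal.ofReal ‖x‖⁻¹ else 0)) := by
  rw [logFormNorm_line, coe_inv_eq_ofReal (by positivity)]
  simp only [NNReal.coe_max, NNReal.coe_mul, NNReal.coe_one, coe_nnnorm]
  by_cases hx : 1 < ‖x‖
  · have hx' := hx.not_ge
    by_cases hd : ‖x + y‖ ≤ 1
    · have hyx := norm_eq_of_norm_add_le hx hd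
      have hh : ¬ ‖x‖ * ‖y‖ ≤ 1 := by rw [hyx]; nlinarith
      have hm : max ‖x‖ (max 1 (‖x‖ * ‖y‖)) = ‖x‖ ^ 2 := by
        rw [hyx, max_eq_right (by nlinarith : (1 : ℝ) ≤ ‖x‖ * ‖x‖), max_eq_right (by nlinarith), sq]
      rw [hm]
      simp [hx, hx', hd, hh]
    · by_cases hh : ‖x‖ * ‖y‖ ≤ 1
      · have hm : max ‖x‖ (max 1 (‖x‖ * ‖y‖)) = ‖x‖ := by
          rw [max_eq_left hh, max_eq_left hx.le]
        rw [hm]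
        simp [hx, hx', hd, hh]
      · simp [hx', hd, hh]
  · have hx' := not_lt.1 hx
    by_cases hy : ‖y‖ ≤ 1
    · have hm : max ‖x‖ (max 1 (‖x‖ * ‖y‖)) = 1 := by
        rw [max_eq_left (mul_le_one₀ hx' (norm_nonneg _) hy), max_eq_right hx']
      rw [hm]
      simp [hx, hx', hy]
    · simp [hx, hy]

open Classical in
/-- As `density_line`, with a further term for the points that reduce to `E₄`. -/
theorem density_sing (x y : F) :
    (if (‖x‖ ≤ 1 ∧ ‖y‖ ≤ 1) ∨ (1 < ‖x‖ ∧ ‖x + y‖ ≤ 1) ∨ (1 < ‖x‖ ∧ ‖x‖ * ‖y‖ ≤ 1) ∨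
        (1 < ‖y‖ ∧ ‖x‖ * ‖y‖ ≤ 1) then
      ((logFormNorm (fun z : F => ‖z‖₊) .sing (planeParam (x, y)))⁻¹ : ℝ≥0∞) else 0) =
    (if ‖x‖ ≤ 1 ∧ ‖y‖ ≤ 1 then 1 else 0) +
      ((if 1 < ‖x‖ ∧ ‖x + y‖ ≤ 1 then ENNReal.ofReal (‖x‖⁻¹ ^ 2) else 0) +
      ((if 1 < ‖x‖ ∧ ‖x‖ * ‖y‖ ≤ 1 then ENNReal.ofReal ‖x‖⁻¹ else 0) +
      (if 1 < ‖y‖ ∧ ‖x‖ * ‖y‖ ≤ 1 then ENNReal.ofReal ‖y‖⁻¹ else 0))) := by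
  rw [logFormNorm_sing, coe_inv_eq_ofReal (by positivity)]
  simp only [NNReal.coe_max, NNReal.coe_mul, NNReal.coe_one, coe_nnnorm]
  by_cases hx : 1 < ‖x‖
  · have hx' := hx.not_ge
    by_cases hd : ‖x + y‖ ≤ 1
    · have hyx := norm_eq_of_norm_add_le hx hd
      have hh : ¬ ‖x‖ * ‖y‖ ≤ 1 := by rw [hyx]; nlinarith
      have hm : max ‖x‖ (max ‖y‖ (max 1 (‖x‖ * ‖y‖))) = ‖x‖ ^ 2 := by
        rw [hyx, max_eq_right (by nlinarith : (1 : ℝ) ≤ ‖x‖ * ‖x‖),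
          max_eq_right (by nlinarith : ‖x‖ ≤ ‖x‖ * ‖x‖), max_eq_right (by nlinarith), sq]
      rw [hm]
      simp [hx, hx', hd, hh]
    · by_cases hh : ‖x‖ * ‖y‖ ≤ 1
      · have hy : ‖y‖ ≤ 1 := by nlinarith [norm_nonneg y]
        have hm : max ‖x‖ (max ‖y‖ (max 1 (‖x‖ * ‖y‖))) = ‖x‖ := by
          rw [max_eq_left hh, max_eq_right hy, max_eq_left hx.le]
        rw [hm]
        simp [hx, hx', hd, hh, hy.not_gt]
      · simp [hx', hd, hh]
  · have hx' := not_lt.1 hx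
    by_cases hy : ‖y‖ ≤ 1
    · have hm : max ‖x‖ (max ‖y‖ (max 1 (‖x‖ * ‖y‖))) = 1 := by
        rw [max_eq_left (mul_le_one₀ hx' (norm_nonneg _) hy), max_eq_right hy, max_eq_right hx']
      rw [hm]
      simp [hx, hx', hy, hy.not_gt]
    · have hy' := not_le.1 hy
      by_cases hh : ‖x‖ * ‖y‖ ≤ 1
      · have hm : max ‖x‖ (max ‖y‖ (max 1 (‖x‖ * ‖y‖))) = ‖y‖ := by
          rw [max_eq_left hh, max_eq_left hy'.le, max_eq_right (hx'.trans hy'.le)]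
        rw [hm]
        simp [hx, hy, hy', hh]
      · simp [hx, hy, hh]

end Density

namespace HasResidueCard

variable {F : Type*} [NormedField F] [IsUltrametricDist F] [MeasurableSpace F] [BorelSpace F]
  {μ : Measure F} [μ.IsAddHaarMeasure] {q : ℕ}

open Classical in
theorem volume_line (h : HasResidueCard F q) (hμ : μ (Metric.closedBall (0 : F) 1) = 1) :
    ∫⁻ x, ∫⁻ y, (if (‖x‖ ≤ 1 ∧ ‖y‖ ≤ 1) ∨ (1 < ‖x‖ ∧ ‖x + y‖ ≤ 1) ∨
        (1 < ‖x‖ ∧ ‖x‖ * ‖y‖ ≤ 1) then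
      ((logFormNorm (fun z : F => ‖z‖₊) .line (planeParam (x, y)))⁻¹ : ℝ≥0∞) else 0) ∂μ ∂μ =
    1 + (ENNReal.ofReal (q : ℝ)⁻¹ + ENNReal.ofReal (q : ℝ)⁻¹) := by
  simp only [density_line]
  simp only [lintegral_add_left (measurable_region_unit _),
    lintegral_add_left (measurable_region_diagonal _), lintegral_region_unit hμ,
    lintegral_region_diagonal hμ, h.lintegral_region_hyperbola hμ]
  rw [lintegral_add_left measurable_unit_ball, lintegral_add_left measurable_inv_sq,
    lintegral_unit_ball hμ, h.lintegral_inv_sq hμ]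

open Classical in
theorem volume_sing (h : HasResidueCard F q) (hμ : μ (Metric.closedBall (0 : F) 1) = 1) :
    ∫⁻ x, ∫⁻ y, (if (‖x‖ ≤ 1 ∧ ‖y‖ ≤ 1) ∨ (1 < ‖x‖ ∧ ‖x + y‖ ≤ 1) ∨
        (1 < ‖x‖ ∧ ‖x‖ * ‖y‖ ≤ 1) ∨ (1 < ‖y‖ ∧ ‖x‖ * ‖y‖ ≤ 1) then
      ((logFormNorm (fun z : F => ‖z‖₊) .sing (planeParam (x, y)))⁻¹ : ℝ≥0∞) else 0) ∂μ ∂μ =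
    1 + (ENNReal.ofReal (q : ℝ)⁻¹ + (ENNReal.ofReal (q : ℝ)⁻¹ + ENNReal.ofReal (q : ℝ)⁻¹)) := by
  simp only [density_sing]
  simp only [lintegral_add_left (measurable_region_unit _),
    lintegral_add_left (measurable_region_diagonal _),
    lintegral_add_left (measurable_region_hyperbola _), lintegral_region_unit hμ,
    lintegral_region_diagonal hμ, h.lintegral_region_hyperbola hμ]
  rw [lintegral_add_left measurable_unit_ball, lintegral_add_left measurable_inv_sq,
    lintegral_add_left measurable_inv_sq, lintegral_unit_ball hμ, h.lintegral_inv_sq hμ,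
    h.lintegral_region_hyperbola' hμ]

end HasResidueCard

section Completion

open NumberField IsDedekindDomain

variable (K : Type*) [Field K] [NumberField K] (v : HeightOneSpectrum (𝓞 K))

theorem localHaar_spec : (localHaar K v).IsAddHaarMeasure ∧
    localHaar K v (Metric.closedBall (0 : v.adicCompletion K) 1) = 1 := by
  have hset : (v.adicCompletionIntegers K : Set (v.adicCompletion K)) =
      Metric.closedBall (0 : v.adicCompletion K) 1 := by
    ext x
    rw [SetLike.mem_coe, mem_integers_iff_norm_le_one, mem_closedBall_zero_iff]
  have h : ∃ μ : Measure (v.adicCompletion K), μ.IsAddHaarMeasure ∧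
      μ (v.adicCompletionIntegers K : Set (v.adicCompletion K)) = 1 := by
    rw [hset]
    exact (hasResidueCard_adicCompletion K v).exists_haar
  rw [← hset, localHaar, dif_pos h]
  exact h.choose_spec

theorem localVolume_sing : localVolume K .sing v = 1 + 3 / (Ideal.absNorm v.asIdeal : ℝ) := by
  obtain ⟨_, hμ⟩ := localHaar_spec K v
  have h := hasResidueCard_adicCompletion K v
  have h0 : (0 : ℝ) ≤ (Ideal.absNorm v.asIdeal : ℝ)⁻¹ := inv_nonneg.2 h.cast_pos.le
  unfold localVolume
  simp only [exists_integralPoint_sing_iff]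
  rw [h.volume_sing hμ, ← ENNReal.ofReal_one, ← ENNReal.ofReal_add h0 h0,
    ← ENNReal.ofReal_add h0 (by positivity), ← ENNReal.ofReal_add zero_le_one (by positivity),
    ENNReal.toReal_ofReal (by positivity)]
  ring

theorem localVolume_line : localVolume K .line v = 1 + 2 / (Ideal.absNorm v.asIdeal : ℝ) := by
  obtain ⟨_, hμ⟩ := localHaar_spec K v
  have h := hasResidueCard_adicCompletion K v
  have h0 : (0 : ℝ) ≤ (Ideal.absNorm v.asIdeal : ℝ)⁻¹ := inv_nonneg.2 h.cast_pos.le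
  unfold localVolume
  simp only [exists_integralPoint_line_iff]
  rw [h.volume_line hμ, ← ENNReal.ofReal_one, ← ENNReal.ofReal_add h0 h0,
    ← ENNReal.ofReal_add zero_le_one (by positivity), ENNReal.toReal_ofReal (by positivity)]
  ring

end Completion

/-! ### Convergence of the Euler product -/

section EulerProduct

open NumberField IsDedekindDomain

variable (K : Type*) [Field K] [NumberField K]

theorem exists_prime_dvd_absNorm (v : HeightOneSpectrum (𝓞 K)) :
    ∃ p : ℕ, p.Prime ∧ (p : 𝓞 K) ∈ v.asIdeal ∧ p ∣ Ideal.absNorm v.asIdeal := by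
  have := v.isMaximal
  obtain ⟨p, n, hn, hp, hprime, he⟩ := Ideal.exists_prime_and_absNorm_eq_pow v.asIdeal
  exact ⟨p, hprime, hp, he ▸ dvd_pow_self p hn.ne'⟩

/-- There are at most `[K : ℚ]` primes above a prime number `p`: the product of their norms divides
`p ^ [K : ℚ]`. -/
theorem card_primes_le_finrank {p : ℕ} (hp : p.Prime) (s : Finset (HeightOneSpectrum (𝓞 K)))
    (hs : ∀ v ∈ s, (p : 𝓞 K) ∈ v.asIdeal ∧ p ∣ Ideal.absNorm v.asIdeal) :
    s.card ≤ Module.finrank ℚ K := by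
  classical
  have h1 : ∏ P ∈ s.image HeightOneSpectrum.asIdeal, P ∣ Ideal.span {(p : 𝓞 K)} := by
    refine Finset.prod_primes_dvd _ (fun P hP => ?_) fun P hP => ?_
    · obtain ⟨v, -, rfl⟩ := Finset.mem_image.1 hP
      exact v.prime
    · obtain ⟨v, hv, rfl⟩ := Finset.mem_image.1 hP
      rw [Ideal.dvd_span_singleton]
      exact (hs v hv).1
  rw [Finset.prod_image fun v _ w _ h => HeightOneSpectrum.ext h] at h1
  have h2 := Ideal.absNorm_dvd_absNorm_of_le (Ideal.le_of_dvd h1)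
  rw [Ideal.absNorm_span_natCast, RingOfIntegers.rank, map_prod] at h2
  have h3 : p ^ s.card ∣ p ^ Module.finrank ℚ K := by
    refine dvd_trans ?_ h2
    rw [← Finset.prod_const]
    exact Finset.prod_dvd_prod_of_dvd _ _ fun v hv => (hs v hv).2
  exact (Nat.pow_dvd_pow_iff_le_right hp.one_lt).1 h3

theorem summable_inv_absNorm_sq :
    Summable fun v : HeightOneSpectrum (𝓞 K) => ((Ideal.absNorm v.asIdeal : ℝ)⁻¹) ^ 2 := by
  classical
  choose p hp hmem hdvd using exists_prime_dvd_absNorm K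
  have hsum : Summable fun n : ℕ => ((n : ℝ)⁻¹) ^ 2 := by
    simpa only [inv_pow] using Real.summable_nat_pow_inv.2 one_lt_two
  refine summable_of_sum_le (c := Module.finrank ℚ K * ∑' n : ℕ, ((n : ℝ)⁻¹) ^ 2)
    (fun v => by positivity) fun s => ?_
  have hle : ∀ v, ((Ideal.absNorm v.asIdeal : ℝ)⁻¹) ^ 2 ≤ ((p v : ℝ)⁻¹) ^ 2 := fun v => by
    have h0 : (0 : ℝ) < p v := by exact_mod_cast (hp v).pos
    have hN : 0 < Ideal.absNorm v.asIdeal :=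
      zero_lt_one.trans (hasResidueCard_adicCompletion K v).one_lt
    have h1 : (p v : ℝ) ≤ Ideal.absNorm v.asIdeal := by exact_mod_cast Nat.le_of_dvd hN (hdvd v)
    gcongr
  refine (Finset.sum_le_sum fun v _ => hle v).trans ?_
  rw [Finset.sum_comp (fun n : ℕ => ((n : ℝ)⁻¹) ^ 2) p]
  calc _ ≤ ∑ n ∈ s.image p, Module.finrank ℚ K • ((n : ℝ)⁻¹) ^ 2 := by
        refine Finset.sum_le_sum fun n hn => ?_
        obtain ⟨w, -, rfl⟩ := Finset.mem_image.1 hn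
        refine nsmul_le_nsmul_left (by positivity) (card_primes_le_finrank K (hp w) _
          fun v hv => ?_)
        rw [← (Finset.mem_filter.1 hv).2]
        exact ⟨hmem v, hdvd v⟩
    _ = Module.finrank ℚ K * ∑ n ∈ s.image p, ((n : ℝ)⁻¹) ^ 2 := by
        rw [Finset.mul_sum]
        simp
    _ ≤ _ := by
        gcongr
        exact hsum.sum_le_tsum _ fun n _ => by positivity

theorem localFactor_sing (v : HeightOneSpectrum (𝓞 K)) : localFactor K .sing v =
    (1 - 1 / (Ideal.absNorm v.asIdeal : ℝ)) ^ 3 * (1 + 3 / (Ideal.absNorm v.asIdeal : ℝ)) := by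
  rw [localFactor, rankPic_sing, localVolume_sing]

theorem localFactor_line (v : HeightOneSpectrum (𝓞 K)) : localFactor K .line v =
    (1 - 1 / (Ideal.absNorm v.asIdeal : ℝ)) ^ 2 * (1 + 2 / (Ideal.absNorm v.asIdeal : ℝ)) := by
  rw [localFactor, rankPic_line, localVolume_line]

/-- The convergence factors cancel the terms of order `1 / N𝔭` of the local volumes. -/
theorem abs_localFactor_sub_one_le (i : Bdry) (v : HeightOneSpectrum (𝓞 K)) :
    |localFactor K i v - 1| ≤ 6 * ((Ideal.absNorm v.asIdeal : ℝ)⁻¹) ^ 2 := by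
  have h1 := (hasResidueCard_adicCompletion K v).one_lt_cast
  have hu0 : 0 ≤ (Ideal.absNorm v.asIdeal : ℝ)⁻¹ := inv_nonneg.2 (by linarith)
  have hu1 : (Ideal.absNorm v.asIdeal : ℝ)⁻¹ ≤ 1 := inv_le_one_of_one_le₀ h1.le
  cases i
  · rw [localFactor_sing]
    simp only [div_eq_mul_inv]
    generalize (Ideal.absNorm v.asIdeal : ℝ)⁻¹ = u at *
    rw [show (1 - 1 * u) ^ 3 * (1 + 3 * u) - 1 = u ^ 2 * (-6 + 8 * u - 3 * u ^ 2) by ring, abs_mul,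
      abs_of_nonneg (sq_nonneg u), mul_comm]
    refine mul_le_mul_of_nonneg_right (abs_le.2 ⟨?_, ?_⟩) (sq_nonneg u) <;> nlinarith
  · rw [localFactor_line]
    simp only [div_eq_mul_inv]
    generalize (Ideal.absNorm v.asIdeal : ℝ)⁻¹ = u at *
    rw [show (1 - 1 * u) ^ 2 * (1 + 2 * u) - 1 = u ^ 2 * (-3 + 2 * u) by ring, abs_mul,
      abs_of_nonneg (sq_nonneg u), mul_comm]
    refine mul_le_mul_of_nonneg_right (abs_le.2 ⟨?_, ?_⟩) (sq_nonneg u) <;> nlinarith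

theorem multipliable_localFactor (i : Bdry) : Multipliable (localFactor K i) := by
  have h : Summable fun v => ‖localFactor K i v - 1‖ :=
    Summable.of_nonneg_of_le (fun v => norm_nonneg _) (fun v => abs_localFactor_sub_one_le K i v)
      ((summable_inv_absNorm_sq K).mul_left 6)
  simpa using multipliable_one_add_of_summable h

theorem expectedExponent_sing : expectedExponent .sing = 5 := by
  rw [expectedExponent, rankPic_sing, faces_sup_card]

theorem expectedExponent_line : expectedExponent .line = 4 := by
  rw [expectedExponent, rankPic_line, faces_sup_card]

theorem expectedMainTerm_eq (i : Bdry) (B : ℝ) :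
    expectedMainTerm K i B = mainTheoremTerm K i B := by
  have hd : √(|discr K| : ℝ) ^ 2 = |(discr K : ℝ)| := Real.sq_sqrt (abs_nonneg _)
  cases i
  · rw [expectedMainTerm, finitePart, archPart, archContribution_eq, polytopeConstant_sing,
      expectedExponent_sing, rankPic_sing, mainTheoremTerm, hd, tprod_congr (localFactor_sing K)]
    ring
  · rw [expectedMainTerm, finitePart, archPart, archContribution_eq, polytopeConstant_line,
      expectedExponent_line, rankPic_line, mainTheoremTerm, hd, tprod_congr (localFactor_line K)]
    ring

end EulerProduct

end A3Surface

end

theorem corollary4p6 :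
    -- the maximal faces of the Clemens complexes
    A3Surface.maxFaces .sing = {{0, 1}, {1, 2}} ∧
    A3Surface.maxFaces .line = {{0, 1}, {1, 2}, {0, 3}} ∧
    -- the residue measures
    (∀ i, ∀ A ∈ A3Surface.maxFaces i,
      A3Surface.residueMeasure i A (A3Surface.stratum A) = ENNReal.ofReal (4 * Real.pi ^ 2)) ∧
    -- the polytope volumes, in the coordinates `(t₄, t₅, t₆, t₈)` and `(t₅, t₆, t₈)`
    A3Surface.alpha .sing {0, 1} = MeasureTheory.volume.real {t : Fin 4 → ℝ | (∀ k, 0 ≤ t k) ∧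
      1 ≤ -t 0 + 3 * t 2 + 2 * t 3 ∧ t 1 + 2 * t 2 + t 3 ≤ 1 ∧ t 0 + t 2 + t 3 ≤ 1} ∧
    A3Surface.alpha .sing {1, 2} = MeasureTheory.volume.real {t : Fin 4 → ℝ | (∀ k, 0 ≤ t k) ∧
      0 ≤ -t 0 - t 1 + t 2 + t 3 ∧ -t 0 + 3 * t 2 + 2 * t 3 ≤ 1 ∧ t 0 + t 2 + t 3 ≤ 1} ∧
    A3Surface.alpha .line {0, 1} = MeasureTheory.volume.real {t : Fin 3 → ℝ | (∀ k, 0 ≤ t k) ∧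
      1 ≤ 3 * t 1 + 2 * t 2 ∧ t 0 + 2 * t 1 + t 2 ≤ 1 ∧ t 1 + t 2 ≤ 1} ∧
    A3Surface.alpha .line {1, 2} = MeasureTheory.volume.real {t : Fin 3 → ℝ | (∀ k, 0 ≤ t k) ∧
      3 * t 1 + 2 * t 2 ≤ 1 ∧ 0 ≤ -t 0 + t 1 + t 2 ∧ t 1 + t 2 ≤ 1} ∧
    A3Surface.alpha .line {0, 3} = MeasureTheory.volume.real {t : Fin 3 → ℝ | (∀ k, 0 ≤ t k) ∧
      2 * t 0 + t 1 ≤ 1 ∧ 1 ≤ t 0 + 2 * t 1 + t 2 ∧ t 1 + t 2 ≤ 1} ∧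
    -- the archimedean contribution
    (∀ i, A3Surface.archContribution i = A3Surface.polytopeConstant i) ∧
    A3Surface.polytopeConstant .sing = Real.pi ^ 2 / 18 ∧
    A3Surface.polytopeConstant .line = 11 * Real.pi ^ 2 / 18 ∧
    -- agreement with the expected asymptotic formula over every imaginary quadratic field
    A3Surface.expectedExponent .sing = 5 ∧ A3Surface.expectedExponent .line = 4 ∧
    ∀ (K : Type*) [Field K] [NumberField K] [NumberField.IsTotallyComplex K],
      Module.finrank ℚ K = 2 → ∀ i, Multipliable (A3Surface.localFactor K i) ∧
        ∀ B : ℝ, A3Surface.expectedMainTerm K i B = A3Surface.mainTheoremTerm K i B :=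
  ⟨A3Surface.maxFaces_sing, A3Surface.maxFaces_line, A3Surface.residueMeasure_maxFaces,
    A3Surface.alpha_sing₁₂, A3Surface.alpha_sing₂₃, A3Surface.alpha_line₁₂,
    A3Surface.alpha_line₂₃, A3Surface.alpha_line₁₄, A3Surface.archContribution_eq,
    A3Surface.polytopeConstant_sing, A3Surface.polytopeConstant_line,
    A3Surface.expectedExponent_sing, A3Surface.expectedExponent_line,
    fun K _ _ _ _ i => ⟨A3Surface.multipliable_localFactor K i,
      A3Surface.expectedMainTerm_eq K i⟩⟩
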